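/- Let $k$ be an algebraically closed field of characteristic $0$, let $X$ be a nonsingular variety over $k$ (an integral separated scheme, smooth and of finite type over $k$), and let $\Lambda_0$ be a Poisson structure on $X$: a $k$-bilinear skew-symmetric bracket $\{-,-\}$ on $\mathcal{O}_X$ which is a derivation in each argument and satisfies the Jacobi identity, regarded as a section of $\wedge^2T_X$, where $\wedge^pT_X:=\mathscr{H}om_{\mathcal{O}_X}(\wedge^p\Omega^1_{X/k},\mathcal{O}_X)$ is the sheaf of skew-symmetric $p$-derivations of $\mathcal O_X$. Let $T_X^\bullet$ be the truncated Lichnerowicz–Poisson complex $$T_X\to\wedge^2T_X\to\wedge^3T_X\to\cdots,$$ with $T_X$ in degree $0$ and differential $[\Lambda_0,-]$ given by the Schouten bracket $$[\Lambda_0,Q](F_0,\dots,F_p)=\sum_i(-1)^{p+i}\{Q(\dots,\widehat{F_i},\dots),F_i\}+\sum_{i<j}(-1)^{p+i+j+1}Q(\{F_i,F_j\},\dots,\widehat{F_i},\dots,\widehat{F_j},\dots),$$ and let $\mathbb{H}^1(X,\Lambda_0,T_X^\bullet)$ be its first hypercohomology group. A first-order Poisson deformation $\xi$ of $(X,\Lambda_0)$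 is a flat scheme $\mathcal{X}\to\mathrm{Spec}\,k[\epsilon]$ (where $\epsilon^2=0$) with a $k[\epsilon]$-bilinear Poisson structure $\Lambda$, together with a morphism $X\to\mathcal{X}$ that identifies $X$ with $\mathcal{X}\times_{\mathrm{Spec}\,k[\epsilon]}\mathrm{Spec}\,k$ and for which $\Lambda$ induces $\Lambda_0$. An isomorphism of two such deformations is an isomorphism of Poisson schemes over $\mathrm{Spec}\,k[\epsilon]$ compatible with the morphisms from $X$. The deformation $\xi$ is trivial if it is isomorphic to $(X\times_k\mathrm{Spec}\,k[\epsilon],\Lambda_0)$. Let $Def_{(X,\Lambda_0)}(k[\epsilon])$ be the set of isomorphism classes. Then there is a canonical bijection $$\kappa:Def_{(X,\Lambda_0)}(k[\epsilon])\to\mathbb{H}^1(X,\Lambda_0,T_X^\bullet),$$ with $\kappa(\xi)=0$ if and only if $\xi$ is trivial. It is determined as follows. Every first-order Poisson deformation $\xi=(\mathcal X,\Lambda)$ admits an affine open cover $\{U_i\}$ of $X$ with trivializations $\mathcal{X}|_{U_i}\cong U_i\times\mathrm{Spec}\,k[\epsilon]$ inducing the identity on $U_i$, that is, with homomorphisms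 of sheaves of $k$-algebras $s_i:\mathcal{O}_{U_i}\to\mathcal{O}_{\mathcal{X}}|_{U_i}$ splitting $\mathcal{O}_{\mathcal X}\to\mathcal{O}_X$, together with sections $\Lambda_i\in\Gamma(U_i,\wedge^2T_X)$ and $p_{ij}\in\Gamma(U_i\cap U_j,T_X)$ such that $$\{s_if,s_ig\}_\Lambda=s_i\{f,g\}+\epsilon\,s_i(\Lambda_i(f,g)),\qquad s_jf=s_if+\epsilon\,s_i(p_{ij}f).$$ For every choice of such data, $\kappa(\xi)$ is the class of the Čech $1$-cocycle $$(\{p_{ij}\},\{-\Lambda_i\})\in C^1(\{U_i\},T_X)\oplus C^0(\{U_i\},\wedge^2T_X),$$ where the total Čech differential on $C^0(\{U_i\},T_X)$ is $\{a_i\}\mapsto(\{a_i-a_j\},\{[\Lambda_0,a_i]\})$. -/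

import Mathlib

universe u v

/-- A Poisson algebra structure on the commutative `R`-algebra `A`: an `R`-bilinear bracket which is
alternating (the same as skew-symmetric when `2` is invertible), a biderivation, and satisfies the
Jacobi identity. -/
structure PoissonBracket (R : Type u) (A : Type v) [CommRing R] [CommRing A] [Algebra R A] where
  br : A →ₗ[R] A →ₗ[R] A
  self : ∀ f : A, br f f = 0
  leibniz : ∀ f g h : A, br (f * g) h = f * br g h + g * br f h
  jacobi : ∀ f g h : A, br f (br g h) + br g (br h f) + br h (br f g) = 0

/-- Alternating `R`-multiderivations of `A` in `p` arguments: alternating `R`-multilinear maps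
`A × ⋯ × A → A` that are derivations in every argument. By the universal property of Kähler
differentials this is `Hom_A(⋀^p Ω_{A/R}, A)`, with `P (F₁, …, F_p) = P (dF₁ ∧ ⋯ ∧ dF_p)`. -/
def multiDer (R : Type u) (A : Type v) [CommRing R] [CommRing A] [Algebra R A] (p : ℕ) :
    AddSubgroup (A [⋀^Fin p]→ₗ[R] A) where
  carrier := {P | ∀ (F : Fin p → A) (i : Fin p) (x y : A),
    P (Function.update F i (x * y)) =
      x * P (Function.update F i y) + y * P (Function.update F i x)}
  zero_mem' := by intro F i x y; simp
  add_mem' := by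
    intro P Q hP hQ F i x y
    simp only [AlternatingMap.add_apply, hP F i x y, hQ F i x y]; ring
  neg_mem' := by
    intro P hP F i x y
    simp only [AlternatingMap.neg_apply, hP F i x y]; ring

namespace PoissonBracket

variable {R : Type u} {A : Type v} [CommRing R] [CommRing A] [Algebra R A] (Λ : PoissonBracket R A)

/-- The Schouten bracket `[Λ, Q]` of the Poisson bivector `Λ` with a `p`-vector `Q`, as a function of
`F₀, …, F_p`. With `F_î` the tuple `F` with `F_i` left out, it is
`∑_i (-1)^(p+i) {Q(F_î), F_i}` plus the terms that feed `{F_j, F_i}`, for `i < j`, into the slot of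
`F_j` in `Q(F_î)`. The lemma `lichFun_eq_sum_shuffle` rewrites it, on multiderivations, as the usual
sum over shuffles
`∑_i (-1)^(p+i) {Q(F_î), F_i} + ∑_{i<j} (-1)^(p+i+j+1) Q({F_i, F_j}, F_îĵ)`.
For a derivation `D` it is `[Λ, D](f, g) = {D f, g} + {f, D g} - D {f, g}`. -/
def lichFun (p : ℕ) (Q : (Fin p → A) → A) (F : Fin (p + 1) → A) : A :=
  ∑ i : Fin (p + 1), (-1) ^ (p + (i : ℕ)) *
    (Λ.br (Q (i.removeNth F)) (F i) -
      ∑ j : Fin p, if i ≤ j.castSucc then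
        Q (Function.update (i.removeNth F) j (Λ.br (F (i.succAbove j)) (F i))) else 0)

/-- Insertion of `x` as first argument. -/
def contr {p : ℕ} (x : A) (Q : (Fin (p + 1) → A) → A) (F : Fin p → A) : A := Q (Fin.cons x F)

/-- The Lie derivative of `Q` along the derivation `{-, x}`. -/
def lieFun {p : ℕ} (x : A) (Q : (Fin p → A) → A) (F : Fin p → A) : A :=
  Λ.br (Q F) x - ∑ j : Fin p, Q (Function.update F j (Λ.br (F j) x))

theorem contr_lichFun (p : ℕ) (Q : (Fin (p + 1) → A) → A) (x : A) :
    contr x (Λ.lichFun (p + 1) Q) =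
      (-1 : A) ^ (p + 1) • Λ.lieFun x Q + Λ.lichFun p (contr x Q) := by
  funext F
  simp only [contr, lichFun, Pi.add_apply, Pi.smul_apply, smul_eq_mul]
  rw [Fin.sum_univ_succ]
  refine congrArg₂ (· + ·) (by simp [lieFun]) (Finset.sum_congr rfl fun i _ => ?_)
  · have h1 : (-1 : A) ^ (p + 1 + (i.succ : ℕ)) = (-1) ^ (p + (i : ℕ)) := by
      rw [Fin.val_succ, show p + 1 + ((i : ℕ) + 1) = p + i + 2 by ring, pow_add]; simp
    have h2 : (i.succ.removeNth (Fin.cons x F : Fin (p + 2) → A)) =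
        (Fin.cons x (i.removeNth F) : Fin (p+1) → A) := by
      funext k
      refine Fin.cases ?_ (fun k => ?_) k <;> simp [Fin.removeNth]
    rw [h1, h2, Fin.sum_univ_succ]
    simp only [Fin.cons_succ, Fin.castSucc_zero, Fin.le_zero_iff, Fin.succ_ne_zero, if_false,
      zero_add, Fin.succ_succAbove_succ]
    congr 2
    refine Finset.sum_congr rfl fun j _ => ?_
    simp only [Fin.castSucc_succ, Fin.succ_le_succ_iff, Fin.cons_update]

theorem contr_lieFun {p : ℕ} (x y : A) (Q : (Fin (p + 1) → A) → A) :
    contr y (Λ.lieFun x Q) = Λ.lieFun x (contr y Q) - contr (Λ.br y x) Q := by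
  funext F
  simp only [contr, lieFun, Pi.sub_apply, Fin.sum_univ_succ, Fin.cons_zero, Fin.cons_succ,
    Fin.update_cons_zero, Fin.cons_update]
  ring


theorem ext_contr {p : ℕ} {Q S : (Fin (p + 1) → A) → A} (h : ∀ z, contr z Q = contr z S) :
    Q = S := by
  funext F
  rw [← Fin.cons_self_tail F]
  exact congrFun (h (F 0)) (Fin.tail F)

theorem skew (f g : A) : Λ.br f g = -Λ.br g f := by
  have h := Λ.self (f + g)
  simp only [map_add, LinearMap.add_apply, Λ.self, zero_add, add_zero] at h
  exact eq_neg_of_add_eq_zero_right h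

theorem lichFun_add (p : ℕ) (Q S : (Fin p → A) → A) :
    Λ.lichFun p (Q + S) = Λ.lichFun p Q + Λ.lichFun p S := by
  funext F
  simp only [lichFun, Pi.add_apply, ← Finset.sum_add_distrib]
  refine Finset.sum_congr rfl fun i _ => ?_
  rw [← mul_add, map_add, LinearMap.add_apply, ← add_sub_add_comm, ← Finset.sum_add_distrib]
  congr 3 with j
  split_ifs <;> simp

theorem lichFun_smul (p : ℕ) (r : R) (Q : (Fin p → A) → A) :
    Λ.lichFun p (r • Q) = r • Λ.lichFun p Q := by
  funext F
  simp only [lichFun, Pi.smul_apply, Finset.smul_sum]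
  refine Finset.sum_congr rfl fun i _ => ?_
  rw [← mul_smul_comm, map_smul, LinearMap.smul_apply, smul_sub, Finset.smul_sum]
  congr 3 with j
  split_ifs <;> simp

theorem lieFun_add {p : ℕ} (x : A) (Q S : (Fin p → A) → A) :
    Λ.lieFun x (Q + S) = Λ.lieFun x Q + Λ.lieFun x S := by
  funext F
  simp only [lieFun, Pi.add_apply, Finset.sum_add_distrib, map_add, LinearMap.add_apply]
  ring

theorem lieFun_smul {p : ℕ} (x : A) (r : R) (Q : (Fin p → A) → A) :
    Λ.lieFun x (r • Q) = r • Λ.lieFun x Q := by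
  funext F
  simp only [lieFun, Pi.smul_apply, ← Finset.smul_sum, map_smul, LinearMap.smul_apply, smul_sub]

theorem lichFun_zero (p : ℕ) : Λ.lichFun p 0 = 0 := by
  simpa using Λ.lichFun_smul p 0 0

theorem lieFun_zero {p : ℕ} (x : A) : Λ.lieFun (p := p) x 0 = 0 := by
  simpa using Λ.lieFun_smul (p := p) x 0 0

/-- Linearity in the first argument. -/
def IsLinFst (R : Type u) {A : Type v} [CommRing R] [CommRing A] [Algebra R A] {p : ℕ}
    (Q : (Fin (p + 1) → A) → A) : Prop :=
  (∀ x y, contr (x + y) Q = contr x Q + contr y Q) ∧ ∀ (r : R) x, contr (r • x) Q = r • contr x Q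

/-- Being alternating and multilinear, expressed through first arguments only. -/
def IsAlt (R : Type u) {A : Type v} [CommRing R] [CommRing A] [Algebra R A] :
    ∀ p : ℕ, ((Fin p → A) → A) → Prop
  | 0, _ => True
  | 1, Q => IsLinFst R Q
  | (p + 2), Q => (∀ x, IsAlt R (p + 1) (contr x Q)) ∧ IsLinFst R Q ∧ ∀ x, contr x (contr x Q) = 0

theorem IsLinFst.neg {p : ℕ} {Q : (Fin (p + 1) → A) → A} (hQ : IsLinFst R Q) (x : A) :
    contr (-x) Q = - contr x Q := by
  have := hQ.2 (-1) x
  simpa using this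

theorem IsLinFst.lieFun {p : ℕ} {Q : (Fin (p + 1) → A) → A} (hQ : IsLinFst R Q) (x : A) :
    IsLinFst R (Λ.lieFun x Q) := by
  refine ⟨fun y z => ?_, fun r y => ?_⟩
  · simp only [contr_lieFun, hQ.1, lieFun_add, map_add, LinearMap.add_apply]; abel
  · simp only [contr_lieFun, hQ.2, lieFun_smul, map_smul, LinearMap.smul_apply, smul_sub]

theorem IsLinFst.add {p : ℕ} {Q S : (Fin (p + 1) → A) → A} (hQ : IsLinFst R Q)
    (hS : IsLinFst R S) : IsLinFst R (Q + S) := by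
  refine ⟨fun y z => ?_, fun r y => ?_⟩
  · change contr _ Q + contr _ S = (contr _ Q + contr _ S) + (contr _ Q + contr _ S)
    rw [hQ.1, hS.1]; abel
  · change contr _ Q + contr _ S = r • (contr _ Q + contr _ S)
    rw [hQ.2, hS.2, smul_add]

theorem IsLinFst.smul {p : ℕ} {Q : (Fin (p + 1) → A) → A} (hQ : IsLinFst R Q) (c : R) :
    IsLinFst R (c • Q) := by
  refine ⟨fun y z => ?_, fun r y => ?_⟩
  · change c • contr _ Q = c • contr _ Q + c • contr _ Q
    rw [hQ.1, smul_add]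
  · change c • contr _ Q = r • c • contr _ Q
    rw [hQ.2, smul_comm]

theorem IsAlt.add : ∀ {p : ℕ} {Q S : (Fin p → A) → A}, IsAlt R p Q → IsAlt R p S →
    IsAlt R p (Q + S)
  | 0, _, _, _, _ => trivial
  | 1, _, _, hQ, hS => IsLinFst.add hQ hS
  | (p + 2), Q, S, hQ, hS => ⟨fun x => IsAlt.add (hQ.1 x) (hS.1 x), hQ.2.1.add hS.2.1, fun x => by
      change contr x (contr x Q) + contr x (contr x S) = 0
      rw [hQ.2.2, hS.2.2, add_zero]⟩

theorem IsAlt.smul (c : R) : ∀ {p : ℕ} {Q : (Fin p → A) → A}, IsAlt R p Q → IsAlt R p (c • Q)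
  | 0, _, _ => trivial
  | 1, _, hQ => IsLinFst.smul hQ c
  | (p + 2), Q, hQ => ⟨fun x => IsAlt.smul c (hQ.1 x), hQ.2.1.smul c, fun x => by
      change c • contr x (contr x Q) = 0
      rw [hQ.2.2, smul_zero]⟩

theorem IsAlt.lin : ∀ {p : ℕ} {Q : (Fin (p + 1) → A) → A}, IsAlt R (p + 1) Q → IsLinFst R Q
  | 0, _, h => h
  | (_ + 1), _, h => h.2.1

theorem IsAlt.contr : ∀ {p : ℕ} {Q : (Fin (p + 1) → A) → A}, IsAlt R (p + 1) Q →
    ∀ x, IsAlt R p (contr x Q)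
  | 0, _, _ => fun _ => trivial
  | (_ + 1), _, h => h.1

theorem IsAlt.swap {p : ℕ} {Q : (Fin (p + 2) → A) → A} (h : IsAlt R (p + 2) Q) (x y : A) :
    PoissonBracket.contr x (PoissonBracket.contr y Q) +
      PoissonBracket.contr y (PoissonBracket.contr x Q) = 0 := by
  have h1 := h.2.2 (x + y)
  rw [h.2.1.1, ((h.1 x).add (h.1 y)).lin.1] at h1
  change (_ + PoissonBracket.contr x (PoissonBracket.contr y Q)) +
    (PoissonBracket.contr y (PoissonBracket.contr x Q) + _) = 0 at h1
  change (PoissonBracket.contr x (PoissonBracket.contr x Q) + _) +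
    (_ + PoissonBracket.contr y (PoissonBracket.contr y Q)) = 0 at h1
  rwa [h.2.2, h.2.2, zero_add, add_zero] at h1

theorem contr_add {p : ℕ} (x : A) (Q S : (Fin (p + 1) → A) → A) :
    contr x (Q + S) = contr x Q + contr x S := rfl

theorem contr_sub {p : ℕ} (x : A) (Q S : (Fin (p + 1) → A) → A) :
    contr x (Q - S) = contr x Q - contr x S := rfl

theorem contr_smul {B : Type*} [SMul B A] {p : ℕ} (x : A) (c : B) (Q : (Fin (p + 1) → A) → A) :
    contr x (c • Q) = c • contr x Q := rfl

theorem IsAlt.sub {p : ℕ} {Q S : (Fin p → A) → A} (hQ : IsAlt R p Q) (hS : IsAlt R p S) :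
    IsAlt R p (Q - S) := by
  have := hQ.add (hS.smul (-1 : R))
  rwa [neg_one_smul, ← sub_eq_add_neg] at this

theorem IsAlt.lieFun (x : A) : ∀ {p : ℕ} {Q : (Fin p → A) → A}, IsAlt R p Q →
    IsAlt R p (Λ.lieFun x Q)
  | 0, _, _ => trivial
  | 1, _, hQ => IsLinFst.lieFun Λ hQ x
  | (p + 2), Q, hQ => ⟨fun y => by
      rw [contr_lieFun]
      exact (IsAlt.lieFun x (hQ.1 y)).sub (hQ.1 _), hQ.2.1.lieFun Λ x, fun y => by
      rw [contr_lieFun, contr_sub, contr_lieFun, hQ.2.2, lieFun_zero, zero_sub,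
        ← neg_add', hQ.swap, neg_zero]⟩

theorem lieFun_linear {p : ℕ} {Q : (Fin p → A) → A} (hQ : IsAlt R p Q) :
    (∀ x y, Λ.lieFun (x + y) Q = Λ.lieFun x Q + Λ.lieFun y Q) ∧
      ∀ (r : R) x, Λ.lieFun (r • x) Q = r • Λ.lieFun x Q := by
  induction p with
  | zero =>
    refine ⟨fun x y => ?_, fun r x => ?_⟩ <;> funext F <;> simp [PoissonBracket.lieFun]
  | succ p ih =>
    refine ⟨fun x y => ?_, fun r x => ?_⟩ <;> funext F <;> rw [← Fin.cons_self_tail F]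
    · change contr (F 0) (Λ.lieFun (x + y) Q) (Fin.tail F) =
        contr (F 0) (Λ.lieFun x Q + Λ.lieFun y Q) (Fin.tail F)
      rw [contr_add]
      simp only [contr_lieFun, (ih (hQ.contr _)).1, map_add, hQ.lin.1]
      simp only [Pi.sub_apply, Pi.add_apply]
      ring
    · change contr (F 0) (Λ.lieFun (r • x) Q) (Fin.tail F) =
        contr (F 0) (r • Λ.lieFun x Q) (Fin.tail F)
      rw [contr_smul]
      simp only [contr_lieFun, (ih (hQ.contr _)).2, map_smul, hQ.lin.2, smul_sub]

theorem coe_neg_one_pow_smul {p : ℕ} (n : ℕ) (Q : (Fin p → A) → A) :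
    (-1 : A) ^ n • Q = (-1 : R) ^ n • Q := by
  rcases neg_one_pow_eq_or A n with h | h
  · rcases Nat.even_or_odd n with h' | h'
    · simp [h'.neg_one_pow]
    · simp [h'.neg_one_pow]
  · rcases Nat.even_or_odd n with h' | h'
    · simp [h'.neg_one_pow]
    · simp [h'.neg_one_pow]

theorem contr_lichFun' (p : ℕ) (Q : (Fin (p + 1) → A) → A) (x : A) :
    contr x (Λ.lichFun (p + 1) Q) =
      (-1 : R) ^ (p + 1) • Λ.lieFun x Q + Λ.lichFun p (contr x Q) := by
  rw [contr_lichFun, coe_neg_one_pow_smul (R := R)]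

theorem contr_lichFun_zero (Q : (Fin 0 → A) → A) (x : A) :
    contr x (Λ.lichFun 0 Q) = Λ.lieFun x Q := by
  funext F
  simp only [contr, lichFun, lieFun, Finset.univ_eq_empty, Finset.sum_empty, sub_zero]
  simp

theorem IsAlt.lichFun : ∀ {p : ℕ} {Q : (Fin p → A) → A}, IsAlt R p Q →
    IsAlt R (p + 1) (Λ.lichFun p Q)
  | 0, Q, hQ => by
    refine ⟨fun x y => ?_, fun r x => ?_⟩
    · simp only [contr_lichFun_zero, (Λ.lieFun_linear hQ).1]
    · simp only [contr_lichFun_zero, (Λ.lieFun_linear hQ).2]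
  | (p + 1), Q, hQ => by
    refine ⟨fun x => ?_, ⟨fun x y => ?_, fun r x => ?_⟩, fun x => ?_⟩
    · rw [contr_lichFun' (R := R)]
      exact ((hQ.lieFun Λ x).smul _).add (IsAlt.lichFun (hQ.contr x))
    · simp only [contr_lichFun' (R := R), (Λ.lieFun_linear hQ).1, hQ.lin.1, lichFun_add, smul_add]
      abel
    · simp only [contr_lichFun' (R := R), (Λ.lieFun_linear hQ).2, hQ.lin.2, lichFun_smul, smul_add]
      rw [smul_comm]
    · rw [contr_lichFun' (R := R), contr_add, contr_smul, contr_lieFun, Λ.self]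
      have h0 : PoissonBracket.contr 0 Q = 0 := by simpa using hQ.lin.2 0 0
      rw [h0, sub_zero]
      cases p with
      | zero =>
        rw [contr_lichFun_zero]; simp
      | succ p =>
        rw [contr_lichFun' (R := R), hQ.2.2, lichFun_zero, add_zero, ← add_smul, pow_succ]
        simp

theorem lieFun_comm {p : ℕ} {Q : (Fin p → A) → A} (hQ : IsAlt R p Q) (hJ : ∀ f g h : A,
      Λ.br f (Λ.br g h) + Λ.br g (Λ.br h f) + Λ.br h (Λ.br f g) = 0) (x y : A) :
    Λ.lieFun x (Λ.lieFun y Q) - Λ.lieFun y (Λ.lieFun x Q) = Λ.lieFun (Λ.br y x) Q := by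
  have hJ' : ∀ m, Λ.br (Λ.br m y) x - Λ.br (Λ.br m x) y = Λ.br m (Λ.br y x) := by
    intro m
    have := hJ m y x
    rw [Λ.skew (Λ.br m y), Λ.skew (Λ.br m x), Λ.skew m x]
    simp only [map_neg]
    linear_combination -this
  induction p with
  | zero =>
    funext F
    simpa [PoissonBracket.lieFun] using hJ' (Q F)
  | succ p ih =>
    refine ext_contr fun z => ?_
    have h1 : ∀ u v : A, contr z (Λ.lieFun u (Λ.lieFun v Q)) =
        Λ.lieFun u (Λ.lieFun v (contr z Q)) - Λ.lieFun u (contr (Λ.br z v) Q) -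
          Λ.lieFun v (contr (Λ.br z u) Q) + contr (Λ.br (Λ.br z u) v) Q := by
      intro u v
      have hs : ∀ P S : (Fin p → A) → A, Λ.lieFun u (P - S) = Λ.lieFun u P - Λ.lieFun u S := by
        intro P S
        have := Λ.lieFun_add u P ((-1 : R) • S)
        rw [lieFun_smul] at this
        simpa [← sub_eq_add_neg] using this
      rw [contr_lieFun, contr_lieFun, contr_lieFun, hs]
      abel
    have h2 : contr (Λ.br (Λ.br z x) y) Q - contr (Λ.br (Λ.br z y) x) Q =
        - contr (Λ.br z (Λ.br y x)) Q := by
      rw [← hJ' z, sub_eq_add_neg (Λ.br (Λ.br z y) x), hQ.lin.1, hQ.lin.neg]; abel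
    rw [contr_sub, h1, h1, contr_lieFun, ← ih (hQ.contr z), ← sub_eq_zero]
    rw [sub_eq_iff_eq_add] at h2
    rw [h2]
    abel

theorem lieFun_lichFun {p : ℕ} {Q : (Fin p → A) → A} (hQ : IsAlt R p Q) (x : A) :
    Λ.lieFun x (Λ.lichFun p Q) = Λ.lichFun p (Λ.lieFun x Q) := by
  induction p with
  | zero =>
    refine ext_contr fun z => ?_
    rw [contr_lieFun, contr_lichFun_zero, contr_lichFun_zero, contr_lichFun_zero,
      ← Λ.lieFun_comm hQ Λ.jacobi]
    abel
  | succ p ih =>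
    refine ext_contr fun z => ?_
    have hs : ∀ P S : (Fin p → A) → A, Λ.lichFun p (P - S) = Λ.lichFun p P - Λ.lichFun p S := by
      intro P S
      have := Λ.lichFun_add p P ((-1 : R) • S)
      rw [lichFun_smul] at this
      simpa [← sub_eq_add_neg] using this
    rw [contr_lieFun, contr_lichFun' (R := R), contr_lichFun' (R := R), contr_lichFun' (R := R),
      lieFun_add, lieFun_smul, ih (hQ.contr z), contr_lieFun, hs,
      ← Λ.lieFun_comm hQ Λ.jacobi x z, smul_sub]
    abel

theorem lichFun_lichFun {p : ℕ} {Q : (Fin p → A) → A} (hQ : IsAlt R p Q) :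
    Λ.lichFun (p + 1) (Λ.lichFun p Q) = 0 := by
  induction p with
  | zero =>
    refine ext_contr fun z => ?_
    rw [contr_lichFun' (R := R), contr_lichFun_zero, lieFun_lichFun Λ hQ]
    simp
    rfl
  | succ p ih =>
    refine ext_contr fun z => ?_
    rw [contr_lichFun' (R := R), contr_lichFun' (R := R), lichFun_add, lichFun_smul,
      ih (hQ.contr _), lieFun_lichFun Λ hQ, pow_succ]
    simp
    rfl

theorem isAlt_coe : ∀ {p : ℕ} (P : A [⋀^Fin p]→ₗ[R] A), IsAlt R p P
  | 0, _ => trivial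
  | 1, P => ⟨fun x y => congrArg DFunLike.coe (P.curryLeft.map_add x y),
      fun r x => congrArg DFunLike.coe (P.curryLeft.map_smul r x)⟩
  | (p + 2), P => ⟨fun x => isAlt_coe (P.curryLeft x),
      ⟨fun x y => congrArg DFunLike.coe (P.curryLeft.map_add x y),
      fun r x => congrArg DFunLike.coe (P.curryLeft.map_smul r x)⟩, fun x => by
        funext F
        exact P.map_eq_zero_of_eq _ (i := 0) (j := 1) rfl (by simp)⟩

theorem IsAlt.exists_alternatingMap : ∀ {p : ℕ} {Q : (Fin p → A) → A}, IsAlt R p Q →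
    ∃ P : A [⋀^Fin p]→ₗ[R] A, ⇑P = Q
  | 0, Q, _ => ⟨AlternatingMap.constOfIsEmpty R A (Fin 0) (Q Fin.elim0), by
      funext F; simp [Subsingleton.elim F Fin.elim0]⟩
  | (p + 1), Q, hQ => by
    have ih : ∀ x, ∃ P : A [⋀^Fin p]→ₗ[R] A, ⇑P = PoissonBracket.contr x Q :=
      fun x => IsAlt.exists_alternatingMap (hQ.contr x)
    choose P hP using ih
    have hP' : ∀ F, Q F = P (F 0) (Fin.tail F) := by
      intro F
      rw [hP, PoissonBracket.contr, Fin.cons_self_tail]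
    have hadd : ∀ x y, P (x + y) = P x + P y := fun x y => by
      ext F
      rw [AlternatingMap.add_apply, hP, hP, hP, hQ.lin.1, Pi.add_apply]
    have hsmul : ∀ (r : R) x, P (r • x) = r • P x := fun r x => by
      ext F
      rw [AlternatingMap.smul_apply, hP, hP, hQ.lin.2, Pi.smul_apply]
    let L : A →ₗ[R] A [⋀^Fin p]→ₗ[R] A :=
      { toFun := P, map_add' := hadd, map_smul' := hsmul }
    let M : MultilinearMap R (fun _ : Fin (p + 1) => A) A :=
      LinearMap.uncurryLeft (AlternatingMap.toMultilinearMapLM (S := R) ∘ₗ L)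
    have hM : ∀ F, M F = Q F := fun F => (hP' F).symm
    have key : ∀ (F : Fin (p + 1) → A) (j : Fin p), F 0 = F j.succ → Q F = 0 := by
      intro F j h
      cases p with
      | zero => exact j.elim0
      | succ q =>
        have h1 : ∀ G : Fin (q + 1) → A, G 0 = F 0 → P (F 0) G = 0 := by
          intro G hG
          rw [hP, ← Fin.cons_self_tail G, hG]
          exact congrFun (hQ.2.2 (F 0)) _
        rw [hP']
        by_cases hj : j = 0
        · subst hj
          exact h1 _ h.symm
        · have := (P (F 0)).map_swap (Fin.tail F) (Ne.symm hj)
          rw [h1 _ (by simp [Fin.tail, h])] at this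
          exact (neg_eq_zero.mp this.symm)
    refine ⟨{ M with map_eq_zero_of_eq' := ?_ }, funext hM⟩
    intro F i j hF hij
    change M F = 0
    rw [hM]
    revert hF hij
    refine Fin.cases ?_ (fun i => ?_) i <;> refine Fin.cases ?_ (fun j => ?_) j
    · intro _ h; exact absurd rfl h
    · intro h _; exact key F j h
    · intro h _; exact key F i h.symm
    · intro h hij
      rw [hP']
      exact (P (F 0)).map_eq_zero_of_eq _ h (fun h => hij (by rw [h]))


theorem update_eq_neg_one_pow {p : ℕ} (P : A [⋀^Fin (p + 1)]→ₗ[R] A) (F : Fin (p + 1) → A)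
    (i : Fin (p + 1)) (x : A) :
    P (Function.update F i x) = (-1) ^ (i : ℕ) * P (Fin.cons x (i.removeNth F)) := by
  have h := P.map_insertNth i x (i.removeNth F)
  rw [Fin.insertNth_removeNth] at h
  rw [h]
  rcases neg_one_pow_eq_or A (i : ℕ) with h' | h' <;>
  rcases Nat.even_or_odd (i : ℕ) with h'' | h'' <;> simp [h''.neg_one_pow, Matrix.vecCons]

theorem lichFun_mul (p : ℕ) (x : A) (S : (Fin p → A) → A) (F : Fin (p + 1) → A) :
    Λ.lichFun p (x • S) F = x * Λ.lichFun p S F +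
      ∑ i : Fin (p + 1), (-1) ^ (p + (i : ℕ)) * (S (i.removeNth F) * Λ.br x (F i)) := by
  simp only [lichFun, Pi.smul_apply, smul_eq_mul, Finset.mul_sum, ← Finset.sum_add_distrib,
    Λ.leibniz]
  refine Finset.sum_congr rfl fun i _ => ?_
  simp only [← mul_ite_zero, ← Finset.mul_sum]
  ring

theorem leibniz_right (f g h : A) : Λ.br f (g * h) = g * Λ.br f h + h * Λ.br f g := by
  rw [Λ.skew, Λ.leibniz, Λ.skew f g, Λ.skew f h]; ring

theorem lieFun_mul {p : ℕ} (P : multiDer R A p) (x y : A) (F : Fin p → A) :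
    Λ.lieFun (x * y) P.1 F = x * Λ.lieFun y P.1 F + y * Λ.lieFun x P.1 F -
      ∑ j : Fin p, (Λ.br (F j) x * P.1 (Function.update F j y) +
        Λ.br (F j) y * P.1 (Function.update F j x)) := by
  have hP : ∀ j : Fin p, P.1 (Function.update F j (Λ.br (F j) (x * y))) =
      (x * P.1 (Function.update F j (Λ.br (F j) y)) +
        y * P.1 (Function.update F j (Λ.br (F j) x))) +
      (Λ.br (F j) x * P.1 (Function.update F j y) +
        Λ.br (F j) y * P.1 (Function.update F j x)) := by
    intro j
    rw [leibniz_right, AlternatingMap.map_update_add, P.2, P.2]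
    ring
  simp only [lieFun, hP, Finset.sum_add_distrib, ← Finset.mul_sum]
  rw [leibniz_right]
  ring

theorem lichFun_cons_mul {p : ℕ} (P : multiDer R A p) (x y : A) (F : Fin p → A) :
    Λ.lichFun p P.1 (Fin.cons (x * y) F) =
      x * Λ.lichFun p P.1 (Fin.cons y F) + y * Λ.lichFun p P.1 (Fin.cons x F) := by
  change contr (x * y) (Λ.lichFun p P.1) F =
    x * contr y (Λ.lichFun p P.1) F + y * contr x (Λ.lichFun p P.1) F
  cases p with
  | zero => simp only [contr_lichFun_zero, lieFun_mul]; simp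
  | succ p =>
    have h1 : contr (x * y) P.1 = x • contr y P.1 + y • contr x P.1 := by
      funext G
      have := P.2 (Fin.cons x G) 0 x y
      simp only [Fin.update_cons_zero] at this
      exact this
    simp only [contr_lichFun, Pi.add_apply, Pi.smul_apply, lieFun_mul, h1, lichFun_add,
      lichFun_mul, smul_eq_mul]
    have h2 : ∑ j : Fin (p + 1), (Λ.br (F j) x * P.1 (Function.update F j y) +
        Λ.br (F j) y * P.1 (Function.update F j x)) =
        (-1) ^ (p + 1) * (∑ i : Fin (p + 1), (-1) ^ (p + (i : ℕ)) *
          (contr y P.1 (i.removeNth F) * Λ.br x (F i)) +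
        ∑ i : Fin (p + 1), (-1) ^ (p + (i : ℕ)) *
          (contr x P.1 (i.removeNth F) * Λ.br y (F i))) := by
      rw [← Finset.sum_add_distrib, Finset.mul_sum]
      refine Finset.sum_congr rfl fun i _ => ?_
      rw [update_eq_neg_one_pow, update_eq_neg_one_pow, Λ.skew (F i) x, Λ.skew (F i) y]
      have : (-1 : A) ^ (p + 1) * (-1) ^ (p + (i : ℕ)) = - (-1) ^ (i : ℕ) := by
        rw [← pow_add, show p + 1 + (p + (i : ℕ)) = 2 * p + 1 + i by ring, pow_add, pow_add,
          pow_mul]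
        simp
      simp only [contr]
      linear_combination (-(P.1 (Fin.cons y (i.removeNth F)) * Λ.br x (F i)) -
        P.1 (Fin.cons x (i.removeNth F)) * Λ.br y (F i)) * this
    have h3 : (-1 : A) ^ (p + 1) * (-1) ^ (p + 1) = 1 := by
      rw [← mul_pow]; simp
    rw [h2]
    linear_combination (-(∑ i : Fin (p + 1), (-1) ^ (p + (i : ℕ)) *
          (contr y P.1 (i.removeNth F) * Λ.br x (F i)) +
        ∑ i : Fin (p + 1), (-1) ^ (p + (i : ℕ)) *
          (contr x P.1 (i.removeNth F) * Λ.br y (F i)))) * h3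

/-- The Lichnerowicz–Poisson differential `[Λ, -]` on alternating multiderivations. -/
noncomputable def lich (p : ℕ) : multiDer R A p →+ multiDer R A (p + 1) where
  toFun P :=
    ⟨{ toFun := Λ.lichFun p P.1
       map_update_add' := by
        intro _ F i x y
        obtain ⟨D, hD⟩ := ((isAlt_coe P.1).lichFun Λ).exists_alternatingMap
        rw [← hD]; exact D.map_update_add' F i x y
       map_update_smul' := by
        intro _ F i x y
        obtain ⟨D, hD⟩ := ((isAlt_coe P.1).lichFun Λ).exists_alternatingMap
        rw [← hD]; exact D.map_update_smul' F i x y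
       map_eq_zero_of_eq' := by
        intro F i j h hij
        obtain ⟨D, hD⟩ := ((isAlt_coe P.1).lichFun Λ).exists_alternatingMap
        rw [← hD]; exact D.map_eq_zero_of_eq F h hij }, by
      intro F i x y
      rw [update_eq_neg_one_pow, update_eq_neg_one_pow, update_eq_neg_one_pow]
      have := Λ.lichFun_cons_mul P x y (i.removeNth F)
      simp only [AlternatingMap.coe_mk, MultilinearMap.coe_mk] at this ⊢
      rw [this]; ring⟩
  map_zero' := by
    ext F; exact congrFun (Λ.lichFun_zero p) F
  map_add' P Q := by
    ext F; exact congrFun (Λ.lichFun_add p P.1 Q.1) F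

theorem lich_lich {p : ℕ} (P : multiDer R A p) : Λ.lich (p + 1) (Λ.lich p P) = 0 := by
  ext F
  exact congrFun (Λ.lichFun_lichFun (isAlt_coe P.1)) F

/-- The expansion of `[Λ, P]` as a sum over shuffles; the pair `(i, j)` with `i ≤ j` stands for the
pair of positions `i < j + 1`. -/
theorem lichFun_eq_sum_shuffle {p : ℕ} (P : multiDer R A (p + 1)) (F : Fin (p + 2) → A) :
    Λ.lichFun (p + 1) P.1 F =
      (∑ i : Fin (p + 2), (-1) ^ (p + 1 + (i : ℕ)) * Λ.br (P.1 (i.removeNth F)) (F i)) +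
        ∑ i : Fin (p + 2), ∑ j : Fin (p + 1), if i ≤ j.castSucc then
          (-1) ^ (p + 1 + (i : ℕ) + (j : ℕ)) *
            P.1 (Fin.cons (Λ.br (F i) (F j.succ)) (j.removeNth (i.removeNth F))) else 0 := by
  rw [← Finset.sum_add_distrib]
  refine Finset.sum_congr rfl fun i _ => ?_
  rw [mul_sub, sub_eq_add_neg, ← mul_neg, ← Finset.sum_neg_distrib, Finset.mul_sum]
  congr 1
  refine Finset.sum_congr rfl fun j _ => ?_
  split_ifs with h
  · rw [update_eq_neg_one_pow, Fin.succAbove_of_le_castSucc _ _ h]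
    have h3 : P.1 (Fin.cons (Λ.br (F j.succ) (F i)) (j.removeNth (i.removeNth F))) =
        -P.1 (Fin.cons (Λ.br (F i) (F j.succ)) (j.removeNth (i.removeNth F))) := by
      have := ((isAlt_coe P.1).lin.neg (Λ.br (F i) (F j.succ)))
      rw [← Λ.skew] at this
      exact congrFun this _
    rw [h3, pow_add _ (p + 1 + (i : ℕ))]
    ring
  · simp

end PoissonBracket

open CategoryTheory AlgebraicGeometry TopologicalSpace Opposite

/-- Sections of the structure sheaf of a scheme over `Spec R` form an `R`-algebra. -/
noncomputable instance schemeSectionsAlgebra (R : Type u) [CommRing R] (X : Scheme.{u})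
    [X.Over (Spec (.of R))] (U : X.Opens) : Algebra R Γ(X, U) :=
  ((Scheme.ΓSpecIso (.of R)).inv ≫ (X ↘ Spec (.of R)).appLE ⊤ U
    (le_top.trans_eq (Scheme.Hom.preimage_top _).symm)).hom.toAlgebra

/-- Restriction of sections of the structure sheaf, as a homomorphism of `R`-algebras. -/
noncomputable def resHom (R : Type u) [CommRing R] {X : Scheme.{u}} [X.Over (Spec (.of R))]
    {U V : X.Opens} (h : V ≤ U) : Γ(X, U) →ₐ[R] Γ(X, V) where
  toRingHom := (X.presheaf.map (homOfLE h).op).hom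
  commutes' r := by
    change (((Scheme.ΓSpecIso (.of R)).inv ≫ (X ↘ Spec (.of R)).appLE ⊤ U
    (le_top.trans_eq (Scheme.Hom.preimage_top _).symm)) ≫
      X.presheaf.map (homOfLE h).op).hom r = _
    rw [Category.assoc, Scheme.Hom.appLE_map]
    rfl

section
variable (R : Type u) [CommRing R] {X : Scheme.{u}} [X.Over (Spec (.of R))]

@[simp] theorem resHom_refl {U : X.Opens} (h : U ≤ U) (x : Γ(X, U)) : resHom R h x = x := by
  change (X.presheaf.map (𝟙 _)).hom x = x
  rw [X.presheaf.map_id]; rfl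

@[simp] theorem resHom_resHom {U V W : X.Opens} (h : V ≤ U) (h' : W ≤ V) (x : Γ(X, U)) :
    resHom R h' (resHom R h x) = resHom R (h'.trans h) x := by
  change (X.presheaf.map _ ≫ X.presheaf.map _).hom x = _
  rw [← X.presheaf.map_comp]; rfl

theorem resHom_ext {ι : Type*} {V : X.Opens} (U : ι → X.Opens) (hU : ∀ i, U i ≤ V)
    (hV : V ≤ iSup U) (x y : Γ(X, V)) (h : ∀ i, resHom R (hU i) x = resHom R (hU i) y) : x = y :=
  TopCat.Sheaf.eq_of_locally_eq' X.sheaf U V (fun i => homOfLE (hU i)) hV x y h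

theorem resHom_glue {ι : Type*} {V : X.Opens} (U : ι → X.Opens) (hU : ∀ i, U i ≤ V)
    (hV : V ≤ iSup U) (x : ∀ i, Γ(X, U i))
    (hx : ∀ i j, resHom R (inf_le_left : U i ⊓ U j ≤ U i) (x i) =
      resHom R (inf_le_right : U i ⊓ U j ≤ U j) (x j)) :
    ∃ y : Γ(X, V), ∀ i, resHom R (hU i) y = x i :=
  (TopCat.Sheaf.existsUnique_gluing' X.sheaf U V (fun i => homOfLE (hU i)) hV x (fun i j => hx i j)).exists
end

/-- A Poisson structure on a scheme `X` over `Spec R`: the structure of a sheaf of Poisson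
`R`-algebras on `𝒪_X`. -/
structure PoissonStructure (R : Type u) [CommRing R] (X : Scheme.{u}) [X.Over (Spec (.of R))] where
  bracket : ∀ U : X.Opens, PoissonBracket R Γ(X, U)
  res_bracket : ∀ {U V : X.Opens} (h : V ≤ U) (f g : Γ(X, U)),
    resHom R h ((bracket U).br f g) = (bracket V).br (resHom R h f) (resHom R h g)

/-- The group `Γ(U, ⋀^p T_X) = Γ(U, ℋom(⋀^p Ω_{X/R}, 𝒪_X))`: families of alternating
`R`-multiderivations of `𝒪_X(V)`, for `V ⊆ U` open, compatible with restriction. -/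
def polyvectorFields (R : Type u) [CommRing R] (X : Scheme.{u}) [X.Over (Spec (.of R))]
    (p : ℕ) (U : X.Opens) :
    AddSubgroup (∀ V : {V : X.Opens // V ≤ U}, multiDer R Γ(X, V.1) p) where
  carrier := {P | ∀ (V W : {V : X.Opens // V ≤ U}) (h : W.1 ≤ V.1) (F : Fin p → Γ(X, V.1)),
    resHom R h ((P V).1 F) = (P W).1 (fun i => resHom R h (F i))}
  zero_mem' := by intro V W h F; exact map_zero _
  add_mem' := by
    intro P Q hP hQ V W h F
    exact (map_add _ _ _).trans (congrArg₂ (· + ·) (hP V W h F) (hQ V W h F))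
  neg_mem' := by
    intro P hP V W h F
    exact (map_neg _ _).trans (congrArg Neg.neg (hP V W h F))

/-- Sections of `⋀^p T_X` over `U`. -/
abbrev PolyvectorField (R : Type u) [CommRing R] (X : Scheme.{u}) [X.Over (Spec (.of R))]
    (p : ℕ) (U : X.Opens) : Type u := polyvectorFields R X p U

namespace PolyvectorField
variable {R : Type u} [CommRing R] {X : Scheme.{u}} [X.Over (Spec (.of R))] {p : ℕ}

/-- The value of a polyvector field over `U` on functions on `V ⊆ U`. -/
noncomputable def eval {U : X.Opens} (P : PolyvectorField R X p U) {V : X.Opens} (h : V ≤ U) 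
    (F : Fin p → Γ(X, V)) : Γ(X, V) := (P.1 ⟨V, h⟩).1 F

theorem ext {U : X.Opens} {P Q : PolyvectorField R X p U}
    (h : ∀ (V : X.Opens) (hV : V ≤ U) (F : Fin p → Γ(X, V)), P.eval hV F = Q.eval hV F) :
    P = Q :=
  Subtype.ext (funext fun V => Subtype.ext (AlternatingMap.ext fun F => h V.1 V.2 F))

theorem res_eval {U : X.Opens} (P : PolyvectorField R X p U) {V W : X.Opens} (h : V ≤ U)
    (h' : W ≤ V) (F : Fin p → Γ(X, V)) :
    resHom R h' (P.eval h F) = P.eval (h'.trans h) (fun i => resHom R h' (F i)) :=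
  P.2 ⟨V, h⟩ ⟨W, h'.trans h⟩ h' F

/-- Restriction of polyvector fields. -/
noncomputable def res {U U' : X.Opens} (h : U' ≤ U) :
    PolyvectorField R X p U →+ PolyvectorField R X p U' where
  toFun P := ⟨fun V => P.1 ⟨V.1, V.2.trans h⟩, fun V W hVW F =>
    P.2 ⟨V.1, V.2.trans h⟩ ⟨W.1, W.2.trans h⟩ hVW F⟩
  map_zero' := rfl
  map_add' _ _ := rfl

@[simp] theorem res_eval' {U U' V : X.Opens} (h : U' ≤ U) (P : PolyvectorField R X p U)
    (hV : V ≤ U') (F : Fin p → Γ(X, V)) : (res h P).eval hV F = P.eval (hV.trans h) F := rfl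

end PolyvectorField

/-- The presheaf `⋀^p T_X`. -/
noncomputable def polyvectorPresheaf (R : Type u) [CommRing R] (X : Scheme.{u}) [X.Over (Spec (.of R))]
    (p : ℕ) : TopCat.Presheaf AddCommGrpCat.{u} X where
  obj U := .of (polyvectorFields R X p U.unop)
  map f := AddCommGrpCat.ofHom (PolyvectorField.res f.unop.le)
  map_id _ := rfl
  map_comp _ _ := rfl

section
variable {R : Type u} [CommRing R] {X : Scheme.{u}} [X.Over (Spec (.of R))] {p : ℕ}

theorem polyvector_glue {ι : Type u} (U : ι → X.Opens)
    (P : ∀ i, PolyvectorField R X p (U i))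
    (hP : ∀ i j, PolyvectorField.res (inf_le_left : U i ⊓ U j ≤ U i) (P i) =
      PolyvectorField.res (inf_le_right : U i ⊓ U j ≤ U j) (P j)) :
    ∃ Q : PolyvectorField R X p (iSup U),
      ∀ i, PolyvectorField.res (le_iSup U i) Q = P i := by
  have hP' : ∀ i j (V : X.Opens) (hi : V ≤ U i) (hj : V ≤ U j) (F : Fin p → Γ(X, V)),
      (P i).eval hi F = (P j).eval hj F := fun i j V hi hj F => by
    have := congrArg (fun Q => Q.eval (le_inf hi hj) F) (hP i j)
    exact this
  have hcov : ∀ V : X.Opens, V ≤ iSup U → V ≤ ⨆ i, V ⊓ U i := fun V hV => by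
    rw [← inf_iSup_eq]; exact le_inf le_rfl hV
  have hex : ∀ (V : X.Opens) (hV : V ≤ iSup U) (F : Fin p → Γ(X, V)), ∃ y : Γ(X, V), ∀ i,
      resHom R (inf_le_left : V ⊓ U i ≤ V) y =
        (P i).eval inf_le_right (fun k => resHom R inf_le_left (F k)) := fun V hV F => by
    refine resHom_glue R (fun i => V ⊓ U i) (fun i => inf_le_left) (hcov V hV) _ fun i j => ?_
    rw [PolyvectorField.res_eval, PolyvectorField.res_eval]
    simp only [resHom_resHom]
    exact hP' _ _ _ _ _ _
  choose D hD using hex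
  have hloc : ∀ (V : X.Opens) (hV : V ≤ iSup U) (x y : Γ(X, V)),
      (∀ i, resHom R (inf_le_left : V ⊓ U i ≤ V) x = resHom R inf_le_left y) → x = y :=
    fun V hV x y h => resHom_ext R (fun i => V ⊓ U i) (fun i => inf_le_left) (hcov V hV) x y h
  have hupd : ∀ {V W : X.Opens} (h : W ≤ V) (F : Fin p → Γ(X, V)) [DecidableEq (Fin p)] i x,
      (fun k => resHom R h (Function.update F i x k)) =
        Function.update (fun k => resHom R h (F k)) i (resHom R h x) := by
    intro V W h F _ i x
    funext k
    by_cases hk : k = i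
    · subst hk; simp
    · simp [hk]
  have hev : ∀ {W : X.Opens} (i : ι) (hW : W ≤ U i) (F : Fin p → Γ(X, W)),
      (P i).eval hW F = ((P i).1 ⟨W, hW⟩).1 F := fun _ _ _ => rfl
  refine ⟨⟨fun V => ⟨{
      toFun := D V.1 V.2
      map_update_add' := ?_
      map_update_smul' := ?_
      map_eq_zero_of_eq' := ?_ }, ?_⟩, ?_⟩, ?_⟩
  · intro _ F k x y
    refine hloc _ V.2 _ _ fun i => ?_
    simp only [map_add, hD, hupd, hev, AlternatingMap.map_update_add]
  · intro _ F k r x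
    refine hloc _ V.2 _ _ fun i => ?_
    simp only [map_smul, hD, hupd, hev, AlternatingMap.map_update_smul]
  · intro F k l h hkl
    refine hloc _ V.2 _ _ fun i => ?_
    rw [hD, map_zero]
    exact AlternatingMap.map_eq_zero_of_eq _ _ (by simp only [h]) hkl
  · intro F k x y
    refine hloc _ V.2 _ _ fun i => ?_
    have := ((P i).1 ⟨V.1 ⊓ U i, inf_le_right⟩).2
    simp only [AlternatingMap.coe_mk, MultilinearMap.coe_mk, map_add, map_mul, hD, hupd, hev]
    exact this _ _ _ _
  · intro V W h F
    refine hloc _ W.2 _ _ fun i => ?_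
    change resHom R _ (resHom R h (D V.1 V.2 F)) = resHom R _ (D W.1 W.2 _)
    rw [hD, resHom_resHom]
    have h1 : resHom R (inf_le_left.trans h : W.1 ⊓ U i ≤ V.1) (D V.1 V.2 F) =
        resHom R (inf_le_inf_right _ h : W.1 ⊓ U i ≤ V.1 ⊓ U i)
          (resHom R inf_le_left (D V.1 V.2 F)) := by
      rw [resHom_resHom]
    rw [h1, hD, PolyvectorField.res_eval]
    simp only [resHom_resHom]
  · intro i
    refine PolyvectorField.ext fun V hV F => ?_
    have hV' : V ≤ iSup U := hV.trans (le_iSup U i)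
    refine hloc V hV' _ _ fun j => ?_
    change resHom R _ (D V hV' F) = _
    rw [hD, PolyvectorField.res_eval]
    exact hP' _ _ _ _ _ _

theorem polyvectorPresheaf_isSheaf : (polyvectorPresheaf R X p).IsSheaf := by
  rw [TopCat.Presheaf.isSheaf_iff_isSheafUniqueGluing]
  intro ι U P hP
  obtain ⟨Q, hQ⟩ := polyvector_glue (R := R) (X := X) (p := p) U P hP
  refine ⟨Q, hQ, ?_⟩
  intro (Q' : PolyvectorField R X p (iSup U)) hQ'
  have hQ'' : ∀ i, PolyvectorField.res (le_iSup U i) Q' = P i := hQ'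
  change Q' = Q
  refine PolyvectorField.ext fun V hV F => ?_
  refine resHom_ext R (fun i => V ⊓ U i) (fun i => inf_le_left)
    (by rw [← inf_iSup_eq]; exact le_inf le_rfl hV) _ _ fun i => ?_
  rw [PolyvectorField.res_eval, PolyvectorField.res_eval]
  have h := congrArg (fun Q => PolyvectorField.eval Q (inf_le_right : V ⊓ U i ≤ U i)
    (fun k => resHom R inf_le_left (F k))) ((hQ'' i).trans (hQ i).symm)
  exact h

/-- The sheaf `⋀^p T_X`. -/
noncomputable def polyvectorSheaf (R : Type u) [CommRing R] (X : Scheme.{u}) [X.Over (Spec (.of R))]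
    (p : ℕ) : TopCat.Sheaf AddCommGrpCat.{u} X :=
  ⟨polyvectorPresheaf R X p, polyvectorPresheaf_isSheaf⟩

end

namespace PoissonStructure
variable {R : Type u} [CommRing R] {X : Scheme.{u}} [X.Over (Spec (.of R))]
  (Λ : PoissonStructure R X)

/-- The map `[Λ, -]` on sections over `U`. -/
noncomputable def lichSections (p : ℕ) (U : X.Opens) :
    PolyvectorField R X p U →+ PolyvectorField R X (p + 1) U where
  toFun P := ⟨fun V => (Λ.bracket V.1).lich p (P.1 V), by
    intro V W h F
    change resHom R h ((Λ.bracket V.1).lichFun p (P.1 V).1 F) =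
      (Λ.bracket W.1).lichFun p (P.1 W).1 _
    simp only [PoissonBracket.lichFun, map_sum, map_mul, map_pow, map_neg, map_one, map_sub,
      Λ.res_bracket, apply_ite (resHom R h), map_zero, P.2 V W h]
    refine Finset.sum_congr rfl fun i _ => ?_
    congr 2
    refine Finset.sum_congr rfl fun j _ => ?_
    congr 2
    funext k
    by_cases hk : k = j
    · subst hk; simp [Λ.res_bracket]
    · simp [hk, Fin.removeNth]⟩
  map_zero' := Subtype.ext (funext fun V => map_zero _)
  map_add' P Q := Subtype.ext (funext fun V => map_add _ _ _)

/-- The map of sheaves `[Λ, -] : ⋀^p T_X ⟶ ⋀^(p+1) T_X`. -/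
noncomputable def lichMap (p : ℕ) : polyvectorSheaf R X p ⟶ polyvectorSheaf R X (p + 1) :=
  ⟨{ app := fun U => AddCommGrpCat.ofHom (Λ.lichSections p U.unop)
     naturality := fun _ _ _ => rfl }⟩

theorem lichMap_lichMap (p : ℕ) : Λ.lichMap p ≫ Λ.lichMap (p + 1) = 0 := by
  apply CategoryTheory.Sheaf.hom_ext
  ext U P
  exact Subtype.ext (funext fun V => (Λ.bracket V.1).lich_lich (P.1 V))

/-- The truncated Lichnerowicz–Poisson complex `T_X ⟶ ⋀² T_X ⟶ ⋀³ T_X ⟶ ⋯` with differential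
`[Λ, -]`, shifted so that `T_X` is in degree `0`. -/
noncomputable def truncatedComplex :
    CochainComplex (TopCat.Sheaf AddCommGrpCat.{u} X) ℕ :=
  CochainComplex.of (fun n => polyvectorSheaf R X (n + 1)) (fun n => Λ.lichMap (n + 1))
    (fun n => Λ.lichMap_lichMap (n + 1))

end PoissonStructure

/-- An injective resolution of a cochain complex concentrated in degrees `≥ 0`: a quasi-isomorphism
to such a complex of injective objects. -/
structure InjectiveResolutionOfComplex {C : Type*} [Category* C] [Abelian C]
    (F : CochainComplex C ℕ) where
  cocomplex : CochainComplex C ℕ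
  injective : ∀ n, Injective (cocomplex.X n)
  ι : F ⟶ cocomplex
  quasiIso : QuasiIso ι

theorem InjectiveResolutionOfComplex.nonempty {C : Type*} [Category* C] [Abelian C]
    [EnoughInjectives C] (F : CochainComplex C ℕ) : Nonempty (InjectiveResolutionOfComplex F) := by
  let e := ComplexShape.embeddingUpNat
  obtain ⟨L, i, hi, hL, hge⟩ :=
    CochainComplex.Plus.modelCategoryQuillen.exists_quasiIso_injective (F.extend e) 0
  let M := L.restriction e
  have hz : ∀ n : ℤ, (∀ k, e.f k ≠ n) → Limits.IsZero (L.X n) := fun n hn => by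
    refine L.isZero_of_isStrictlyGE 0 n ?_
    by_contra h
    exact hn n.toNat (by change ((n.toNat : ℤ)) = n; omega)
  have hlift : e.HasLift (𝟙 M) := by
    intro j hj i' hij
    exact (hz i' (fun k hk => by
      subst hk
      exact hj.2 k hij)).eq_of_src _ _
  let φ : L ⟶ M.extend e := e.liftExtend (𝟙 M) hlift
  have : ∀ n, IsIso (φ.f n) := fun n => by
    by_cases h : ∃ k, e.f k = n
    · obtain ⟨k, hk⟩ := h
      rw [e.isIso_liftExtend_f_iff _ _ hk]
      change IsIso (𝟙 (M.X k))
      infer_instance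
    · push Not at h
      exact ⟨0, (hz n h).eq_of_src _ _, (M.isZero_extend_X e n h).eq_of_src _ _⟩
  have : IsIso φ := HomologicalComplex.Hom.isIso_of_components φ
  obtain ⟨ψ, hψ⟩ := (e.extendFunctor C).map_surjective (X := F) (Y := M) (i ≫ φ)
  refine ⟨⟨M, fun n => hL _, ψ, ?_⟩⟩
  rw [← HomologicalComplex.quasiIso_extendMap_iff ψ e]
  change QuasiIso ((e.extendFunctor C).map ψ)
  rw [hψ]
  exact quasiIso_comp i φ

/-- The global sections functor on sheaves of abelian groups. -/
noncomputable def globalSections (X : TopCat.{u}) :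
    TopCat.Sheaf AddCommGrpCat.{u} X ⥤ AddCommGrpCat.{u} :=
  (sheafSections (Opens.grothendieckTopology X) AddCommGrpCat.{u}).obj (op ⊤)

instance (X : TopCat.{u}) : (globalSections X).Additive where
  map_add := rfl

/-- The complex of global sections of a complex of sheaves. -/
noncomputable def globalComplex {X : TopCat.{u}}
    (F : CochainComplex (TopCat.Sheaf AddCommGrpCat.{u} X) ℕ) : CochainComplex AddCommGrpCat.{u} ℕ :=
  ((globalSections X).mapHomologicalComplex _).obj F

/-- A chosen injective resolution. -/
noncomputable def injRes {C : Type*} [Category* C] [Abelian C] [EnoughInjectives C]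
    (F : CochainComplex C ℕ) : InjectiveResolutionOfComplex F :=
  (InjectiveResolutionOfComplex.nonempty F).some

/-- The hypercohomology group `ℍⁿ(X, F)` of a complex of abelian sheaves in degrees `≥ 0`: the `n`-th
cohomology of the global sections of an injective resolution of `F`. -/
noncomputable def hypercohomology {X : TopCat.{u}}
    (F : CochainComplex (TopCat.Sheaf AddCommGrpCat.{u} X) ℕ) (n : ℕ) : AddCommGrpCat.{u} :=
  (globalComplex (injRes F).cocomplex).homology n

/-- Restriction of sections of a sheaf. -/
noncomputable def sectionsRes {X : TopCat.{u}} (F : TopCat.Sheaf AddCommGrpCat.{u} X)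
    {U V : Opens X} (h : V ≤ U) : F.obj.obj (op U) →+ F.obj.obj (op V) :=
  (F.obj.map (homOfLE h).op).hom

/-- The map induced on sections by a morphism of sheaves. -/
noncomputable def sectionsMap {X : TopCat.{u}} {F G : TopCat.Sheaf AddCommGrpCat.{u} X}
    (φ : F ⟶ G) (U : Opens X) : F.obj.obj (op U) →+ G.obj.obj (op U) :=
  (φ.hom.app (op U)).hom

/-- The class `c ∈ ℍ¹(X, F)` is represented by the Čech cochain
`({p_ij}, {m_i}) ∈ C¹(U, F⁰) ⊕ C⁰(U, F¹)` of the open cover `U`.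

The total differential of the Čech double complex is `(-δ, d)` on `C⁰(U, F⁰)`, that is
`a ↦ ({a_i - a_j}, {d a_i})`. With `j : F ⟶ I` the injective resolution that computes `ℍ¹`, the
Čech hypercohomology of `I` is the cohomology of its complex of global sections, a global cocycle
`z ∈ Γ(X, I¹)` being sent to `(0, {z|_{U_i}})`. So `c = [z]` is the image of `({p_ij}, {m_i})` if
and only if `(j p, j m) - (0, z|)` is the total differential of some `{a_i} ∈ C⁰(U, I⁰)` (up to
changing `z` by a coboundary). -/
def IsCechClass {X : TopCat.{u}} {F : CochainComplex (TopCat.Sheaf AddCommGrpCat.{u} X) ℕ}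
    {I : Type u} (U : I → Opens X) (p : ∀ i j, (F.X 0).obj.obj (op (U i ⊓ U j)))
    (m : ∀ i, (F.X 1).obj.obj (op (U i))) (c : hypercohomology F 1) : Prop :=
  ∃ (a : ∀ i, ((injRes F).cocomplex.X 0).obj.obj (op (U i)))
    (z : (globalComplex (injRes F).cocomplex).cycles 1),
    (∀ i j, sectionsMap ((injRes F).ι.f 0) _ (p i j) =
      sectionsRes _ inf_le_left (a i) - sectionsRes _ inf_le_right (a j)) ∧
    (∀ i, sectionsRes ((injRes F).cocomplex.X 1) (le_top : U i ≤ ⊤)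
        ((globalComplex (injRes F).cocomplex).iCycles 1 z) =
      sectionsMap ((injRes F).ι.f 1) _ (m i) -
        sectionsMap ((injRes F).cocomplex.d 0 1) _ (a i)) ∧
    (globalComplex (injRes F).cocomplex).homologyπ 1 z = c

/-- A morphism of schemes `f : X ⟶ Y` is a Poisson morphism if `f^# : 𝒪_Y ⟶ f_* 𝒪_X` preserves the
brackets. -/
def IsPoissonHom {R S : Type u} [CommRing R] [CommRing S] {X Y : Scheme.{u}}
    [X.Over (Spec (.of R))] [Y.Over (Spec (.of S))] (f : X ⟶ Y)
    (Λ : PoissonStructure R X) (Λ' : PoissonStructure S Y) : Prop :=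
  ∀ (V : Y.Opens) (a b : Γ(Y, V)),
    (f.app V).hom ((Λ'.bracket V).br a b) =
      (Λ.bracket (f ⁻¹ᵁ V)).br ((f.app V).hom a) ((f.app V).hom b)

section
variable {R S T : Type u} [CommRing R] [CommRing S] [CommRing T] {X Y Z : Scheme.{u}}
  [X.Over (Spec (.of R))] [Y.Over (Spec (.of S))] [Z.Over (Spec (.of T))]
  {Λ : PoissonStructure R X} {Λ' : PoissonStructure S Y} {Λ'' : PoissonStructure T Z}

theorem IsPoissonHom.id : IsPoissonHom (𝟙 X) Λ Λ := fun V a b => by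
  simp; rfl

theorem IsPoissonHom.comp {f : X ⟶ Y} {g : Y ⟶ Z} (hf : IsPoissonHom f Λ Λ')
    (hg : IsPoissonHom g Λ' Λ'') : IsPoissonHom (f ≫ g) Λ Λ'' := fun V a b => by
  have h := hf (g ⁻¹ᵁ V) ((g.app V).hom a) ((g.app V).hom b)
  rw [← hg] at h
  rw [Scheme.Hom.comp_app]
  exact h

theorem IsPoissonHom.appLE {f : X ⟶ Y} (hf : IsPoissonHom f Λ Λ') {V : Y.Opens} {W : X.Opens}
    (e : W ≤ f ⁻¹ᵁ V) (a b : Γ(Y, V)) :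
    (f.appLE V W e).hom ((Λ'.bracket V).br a b) =
      (Λ.bracket W).br ((f.appLE V W e).hom a) ((f.appLE V W e).hom b) := by
  have h := congrArg (resHom R e) (hf V a b)
  rw [Λ.res_bracket] at h
  exact h

theorem IsPoissonHom.inv {φ : X ≅ Y} (hφ : IsPoissonHom φ.hom Λ Λ') :
    IsPoissonHom φ.inv Λ' Λ := fun V a b => by
  have hV : V ≤ φ.hom ⁻¹ᵁ (φ.inv ⁻¹ᵁ V) := by
    change V ≤ (φ.hom ≫ φ.inv) ⁻¹ᵁ V
    rw [φ.hom_inv_id]; exact le_rfl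
  have hV' : φ.hom ⁻¹ᵁ (φ.inv ⁻¹ᵁ V) = V := by
    change (φ.hom ≫ φ.inv) ⁻¹ᵁ V = V
    rw [φ.hom_inv_id]; rfl
  have hid : ∀ c : Γ(X, V), (φ.hom.appLE (φ.inv ⁻¹ᵁ V) V hV).hom ((φ.inv.app V).hom c) = c := by
    intro c
    have h1 : φ.inv.app V ≫ φ.hom.appLE (φ.inv ⁻¹ᵁ V) V hV = 𝟙 _ := by
      have h2 : ∀ (g : X ⟶ X) (e : V ≤ g ⁻¹ᵁ V), g = 𝟙 X → g.appLE V V e = 𝟙 _ := by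
        intro g e hg
        subst hg
        rw [Scheme.Hom.appLE, Scheme.Hom.id_app]
        exact (Category.id_comp _).trans (X.presheaf.map_id _)
      exact (Scheme.Hom.comp_appLE φ.hom φ.inv V V hV).symm.trans (h2 _ _ φ.hom_inv_id)
    exact congrArg (fun g => g.hom c) h1
  have hinj : Function.Injective (φ.hom.appLE (φ.inv ⁻¹ᵁ V) V hV).hom := by
    have : IsIso (φ.hom.appLE (φ.inv ⁻¹ᵁ V) V hV) := by
      have h : φ.hom.appLE (φ.inv ⁻¹ᵁ V) V hV =
        φ.hom.app (φ.inv ⁻¹ᵁ V) ≫ X.presheaf.map (eqToHom hV'.symm).op := rfl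
      rw [h]; infer_instance
    exact (ConcreteCategory.bijective_of_isIso (φ.hom.appLE (φ.inv ⁻¹ᵁ V) V hV)).1
  apply hinj
  rw [hφ.appLE, hid, hid, hid]

end

/-- A Poisson deformation of `(X, Λ₀)` over a `k`-algebra `A` with augmentation `A → k`: a flat Poisson
scheme `(𝒳, Λ)` over `Spec A` and a cartesian square with sides `X ⟶ 𝒳` and `Spec k ⟶ Spec A`, such
that `Λ` induces `Λ₀` on `X`. -/
structure PoissonDeformation {k : Type u} [Field k] {X : Scheme.{u}} [X.Over (Spec (.of k))]
    (Λ₀ : PoissonStructure k X) {A : Type u} [CommRing A] [Algebra k A] (aug : A →ₐ[k] k) where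
  total : Scheme.{u}
  [overBase : total.Over (Spec (.of A))]
  flat : Flat (total ↘ Spec (.of A))
  poisson : PoissonStructure A total
  incl : X ⟶ total
  isPullback : IsPullback incl (X ↘ Spec (.of k)) (total ↘ Spec (.of A))
    (Spec.map (CommRingCat.ofHom aug.toRingHom))
  incl_poisson : IsPoissonHom incl Λ₀ poisson

attribute [instance] PoissonDeformation.overBase

namespace PoissonDeformation
variable {k : Type u} [Field k] {X : Scheme.{u}} [X.Over (Spec (.of k))]
    {Λ₀ : PoissonStructure k X} {A : Type u} [CommRing A] [Algebra k A] {aug : A →ₐ[k] k}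

/-- Two Poisson deformations are isomorphic if there is an isomorphism of Poisson schemes over `Spec A`
between their total spaces which is compatible with the inclusions of `X`. -/
def Isomorphic (ξ η : PoissonDeformation Λ₀ aug) : Prop :=
  ∃ φ : ξ.total ≅ η.total,
    φ.hom ≫ (η.total ↘ Spec (.of A)) = ξ.total ↘ Spec (.of A) ∧
    ξ.incl ≫ φ.hom = η.incl ∧ IsPoissonHom φ.hom ξ.poisson η.poisson

/-- Isomorphism of Poisson deformations as an equivalence relation. -/
instance setoid (Λ₀ : PoissonStructure k X) (aug : A →ₐ[k] k) :
    Setoid (PoissonDeformation Λ₀ aug) where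
  r := Isomorphic
  iseqv :=
    { refl := fun ξ => ⟨Iso.refl _, by simp, by simp, IsPoissonHom.id⟩
      symm := fun {ξ η} ⟨φ, h1, h2, h3⟩ =>
        ⟨φ.symm, by rw [← h1]; exact Iso.inv_hom_id_assoc _ _, by
          rw [← h2, Category.assoc]; exact (congrArg _ φ.hom_inv_id).trans (Category.comp_id _),
          IsPoissonHom.inv h3⟩
      trans := fun {ξ η ζ} ⟨φ, h1, h2, h3⟩ ⟨ψ, h1', h2', h3'⟩ =>
        ⟨φ ≪≫ ψ, by
          rw [Iso.trans_hom, Category.assoc, h1', h1], by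
          rw [Iso.trans_hom, ← Category.assoc, h2, h2'], h3.comp h3'⟩ }

/-- The Poisson deformation is trivial, i.e. isomorphic to `(X ×_k Spec A, Λ₀)`: there is
`r : 𝒳 ⟶ X` which, with the structure morphism, identifies `𝒳` with `X ×_k Spec A`, restricts to the
identity on `X`, and is a Poisson morphism. The last condition says that `Λ` is the `A`-bilinear
extension of `Λ₀`, as `𝒪_X ⊗_k A` is generated over `A` by `𝒪_X`. -/
def IsTrivial (ξ : PoissonDeformation Λ₀ aug) : Prop :=
  ∃ r : ξ.total ⟶ X,
    IsPullback r (ξ.total ↘ Spec (.of A)) (X ↘ Spec (.of k))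
      (Spec.map (CommRingCat.ofHom (algebraMap k A))) ∧
    ξ.incl ≫ r = 𝟙 X ∧ IsPoissonHom r ξ.poisson Λ₀

end PoissonDeformation

/-- The set `Def_{(X, Λ₀)}(A)` of isomorphism classes of Poisson deformations over `A`. -/
def PoissonDef {k : Type u} [Field k] {X : Scheme.{u}} [X.Over (Spec (.of k))]
    (Λ₀ : PoissonStructure k X) {A : Type u} [CommRing A] [Algebra k A] (aug : A →ₐ[k] k) :
    Type (u + 1) :=
  Quotient (PoissonDeformation.setoid Λ₀ aug)

open DualNumber

/-- First-order Poisson deformations: Poisson deformations over `k[ε]`, with augmentation `ε ↦ 0`. -/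
abbrev FirstOrderPoissonDeformation {k : Type u} [Field k] {X : Scheme.{u}}
    [X.Over (Spec (.of k))] (Λ₀ : PoissonStructure k X) : Type (u + 1) :=
  PoissonDeformation Λ₀ (TrivSqZeroExt.fstHom k k k : k[ε] →ₐ[k] k)

/-- The data from which the Čech cocycle of a first-order Poisson deformation `ξ = (𝒳, Λ)` is built.

* `U` is a cover of `X` by affine open sets.
* `s i` is a trivialization `U_i × Spec k[ε] ≅ 𝒳|_{U_i}` inducing the identity on `U_i`, given by the
  homomorphism of sheaves of `k`-algebras `s_i : 𝒪_{U_i} ⟶ 𝒪_𝒳|_{U_i}` splitting `𝒪_𝒳 ⟶ 𝒪_X` (`X` and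
  `𝒳` have the same underlying space, an open set `V` of `𝒳` corresponding to the open set
  `incl ⁻¹ᵁ V` of `X`); the trivialization is `f + ε g ↦ s_i f + ε s_i g`, which is an isomorphism
  because `𝒳` is flat.
* `Λ i` is the bivector field such that the Poisson structure of `𝒳|_{U_i}` is `Λ₀ + ε Λ_i` in this
  trivialization.
* `p i j` is the vector field such that the transition automorphism is `Id + ε p_ij`, that is
  `s_i⁻¹ s_j = Id + ε p_ij` on `U_i ∩ U_j`. -/
structure CechData {k : Type u} [Field k] {X : Scheme.{u}}
    [X.Over (Spec (.of k))] {Λ₀ : PoissonStructure k X} (ξ : FirstOrderPoissonDeformation Λ₀) where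
  /-- the index set of the cover -/
  I : Type u
  /-- the affine open sets -/
  U : I → X.Opens
  isAffineOpen : ∀ i, IsAffineOpen (U i)
  iSup_eq_top : ⨆ i, U i = ⊤
  /-- the splittings -/
  s : ∀ (i : I) (V : ξ.total.Opens), ξ.incl ⁻¹ᵁ V ≤ U i → (Γ(X, ξ.incl ⁻¹ᵁ V) →+* Γ(ξ.total, V))
  s_algebraMap : ∀ (i : I) (V : ξ.total.Opens) (h : ξ.incl ⁻¹ᵁ V ≤ U i) (c : k),
    s i V h (algebraMap k Γ(X, ξ.incl ⁻¹ᵁ V) c) =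
      algebraMap k[ε] Γ(ξ.total, V) (algebraMap k k[ε] c)
  res_s : ∀ (i : I) (V W : ξ.total.Opens) (h : ξ.incl ⁻¹ᵁ V ≤ U i) (hW : W ≤ V)
    (hW' : ξ.incl ⁻¹ᵁ W ≤ ξ.incl ⁻¹ᵁ V) (f : Γ(X, ξ.incl ⁻¹ᵁ V)),
    resHom k[ε] hW (s i V h f) = s i W (hW'.trans h) (resHom k hW' f)
  incl_s : ∀ (i : I) (V : ξ.total.Opens) (h : ξ.incl ⁻¹ᵁ V ≤ U i) (f : Γ(X, ξ.incl ⁻¹ᵁ V)),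
    (ξ.incl.app V).hom (s i V h f) = f
  /-- the bivector fields -/
  Λ : ∀ i : I, PolyvectorField k X 2 (U i)
  bracket_s : ∀ (i : I) (V : ξ.total.Opens) (h : ξ.incl ⁻¹ᵁ V ≤ U i) (f g : Γ(X, ξ.incl ⁻¹ᵁ V)),
    (ξ.poisson.bracket V).br (s i V h f) (s i V h g) =
      s i V h ((Λ₀.bracket _).br f g) + (ε : k[ε]) • s i V h ((Λ i).eval h ![f, g])
  /-- the vector fields -/
  p : ∀ i j : I, PolyvectorField k X 1 (U i ⊓ U j)
  transition : ∀ (i j : I) (V : ξ.total.Opens) (h : ξ.incl ⁻¹ᵁ V ≤ U i ⊓ U j)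
    (f : Γ(X, ξ.incl ⁻¹ᵁ V)),
    s j V (h.trans inf_le_right) f =
      s i V (h.trans inf_le_left) f +
        (ε : k[ε]) • s i V (h.trans inf_le_left) ((p i j).eval h ![f])

/-! Everything rests on expansion in powers of `ε`. The inclusion of `X` in `𝒳` is a homeomorphism,
and flatness over `k[ε]` gives an exact sequence `0 → 𝒪_X → 𝒪_𝒳 → 𝒪_X → 0`: the right map is
reduction (`proj`), the left map multiplies a local lift by `ε` (`infl`), and its image is an ideal
of square zero. Smoothness provides multiplicative splittings `S_i` of the reduction over small
affine open sets. Two splittings differ by a derivation, `S_j = S_i + ε p_ij`, and the bracket read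
through `S_i` is `Λ₀ + ε Λ_i` with `Λ_i` a biderivation. Then `p_ik = p_ij + p_jk` holds trivially,
comparing the brackets gives `Λ_j - Λ_i = [Λ₀, p_ij]`, and the `ε`-part of the Jacobi identity is
`[Λ₀, Λ_i] = 0`. Together these say that `({p_ij}, {-Λ_i})` is a Čech 1-cocycle.

The passage to `ℍ¹`, which is defined by an injective resolution `F ⟶ I` of the complex, uses
neither a general Čech comparison theorem nor vanishing of cohomology on affine schemes. Two facts
suffice. An injective sheaf has no first Čech cohomology (`exists_coboundary_of_injective`). The
mapping cone `0 → F⁰ → F¹ ⊞ I⁰ → F² ⊞ I¹ → F³ ⊞ I²` is exact, so that a pair `(m, a)` of sections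
with `d m = 0` and the same image of `m` and `a` in `I¹` comes from a unique section of `F⁰`. It
follows that a cocycle has exactly one class, that every class comes from a cocycle on a cover by
members of any given basis, and that two cocycles with the same class, even on different covers `U`
and `U'`, are linked by sections `q_ij` over `U_i ∩ U'_j` with `d q_ij = m_i - m'_j`
(`IsCechClass.exists_comparison`).

Independence of choices: the union of two covers, with both families of splittings, carries one
cocycle that restricts to the two given ones.

Injectivity: twisting the splittings of one deformation by `q_ij` makes its transition and bivector
fields on `U_i ∩ U'_j` equal to those of the other. A section of a thickening amounts to its
reduction `f` with local coefficients `g_i` satisfying `g_i = g_j + p_ij f`, and sums, products and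
brackets are given by formulas in `p` and `Λ` only. Equal data therefore give isomorphic sheaves of
Poisson algebras, hence isomorphic deformations.

Surjectivity: a class has a cocycle on an affine cover. The structure sheaf of `X × Spec k[ε]` is
reglued along `Id + ε p_ij` on the same topological space, the charts of the product make it a flat
scheme with closed fibre `X`, and the brackets `Λ₀ + ε Λ_i` glue by the cocycle condition.

A trivial deformation has the zero cocycle, so by injectivity the class vanishes exactly for trivial
deformations. -/

section QuasiIsoRefinements

/-! ### Exactness of the mapping cone of a quasi-isomorphism in low degrees. -/

variable {C : Type*} [Category* C] [Abelian C] {F K : CochainComplex C ℕ} (φ : F ⟶ K) [QuasiIso φ]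

/-- Exactness of the mapping cone at `F.X (n + 1) ⊞ K.X n`, in generalized elements: injectivity of
`φ` on homology in degree `n + 1` kills the class of `m`, and surjectivity in degree `n` corrects
the remaining cycle. The epimorphism `π` is the cover on which preimages exist. For `n = 0` the
convention `prev 0 = 0` makes `K.d i n` zero, so `c` contributes nothing. -/
theorem exists_refinement_of_quasiIso (i n : ℕ) (hi : (ComplexShape.up ℕ).prev n = i) {A : C}
    (m : A ⟶ F.X (n + 1)) (a : A ⟶ K.X n) (hm : m ≫ F.d (n + 1) (n + 2) = 0)
    (h : m ≫ φ.f (n + 1) = a ≫ K.d n (n + 1)) :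
    ∃ (A' : C) (π : A' ⟶ A) (_ : Epi π) (b : A' ⟶ F.X n) (c : A' ⟶ K.X i),
      π ≫ m = b ≫ F.d n (n + 1) ∧ π ≫ a = b ≫ φ.f n + c ≫ K.d i n := by
  have hp : (ComplexShape.up ℕ).prev (n + 1) = n := by simp
  have hn : (ComplexShape.up ℕ).next (n + 1) = n + 2 := by simp
  have hn' : (ComplexShape.up ℕ).next n = n + 1 := by simp
  have h0 : F.liftCycles m (n + 2) hn hm ≫ F.homologyπ (n + 1) = 0 := by
    rw [← cancel_mono (HomologicalComplex.homologyMap φ (n + 1)), Limits.zero_comp, Category.assoc,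
      HomologicalComplex.homologyπ_naturality, HomologicalComplex.liftCycles_comp_cyclesMap_assoc,
      K.liftCycles_comp_homologyπ_eq_zero_iff_up_to_refinements n (n + 1) (n + 2) hp hn]
    exact ⟨A, 𝟙 A, inferInstance, a, by simpa using h⟩
  rw [F.liftCycles_comp_homologyπ_eq_zero_iff_up_to_refinements n (n + 1) (n + 2) hp hn] at h0
  obtain ⟨A₁, π₁, _, b₁, hb₁⟩ := h0
  -- Once `m = d b₁` on a cover, `a - φ b₁` is a cycle of `K`, and its homology class lifts to a
  -- cycle `z` of `F`. The final `b` is `z + b₁`.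
  have hz : (π₁ ≫ a - b₁ ≫ φ.f n) ≫ K.d n (n + 1) = 0 := by
    rw [Preadditive.sub_comp, Category.assoc, Category.assoc, φ.comm, ← reassoc_of% hb₁, h, sub_self]
  obtain ⟨A₂, π₂, _, z, hz', h2⟩ := F.eq_liftCycles_homologyπ_up_to_refinements
    (K.liftCycles _ (n + 1) hn' hz ≫ K.homologyπ n ≫ inv (HomologicalComplex.homologyMap φ n))
    (n + 1) hn'
  have h3 : K.liftCycles (π₂ ≫ (π₁ ≫ a - b₁ ≫ φ.f n)) (n + 1) hn' (by
        rw [Category.assoc, hz, Limits.comp_zero]) ≫ K.homologyπ n =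
      K.liftCycles (z ≫ φ.f n) (n + 1) hn' (by
        rw [Category.assoc, φ.comm, reassoc_of% hz', Limits.zero_comp]) ≫ K.homologyπ n := by
    rw [← HomologicalComplex.comp_liftCycles, Category.assoc]
    · have := congrArg (· ≫ HomologicalComplex.homologyMap φ n) h2
      simp only [Category.assoc, IsIso.inv_hom_id, Category.comp_id,
        HomologicalComplex.homologyπ_naturality,
        HomologicalComplex.liftCycles_comp_cyclesMap_assoc] at this
      exact this
  rw [K.liftCycles_comp_homologyπ_eq_iff_up_to_refinements i n (n + 1) hi hn'] at h3
  obtain ⟨A₃, π₃, _, c, hc⟩ := h3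
  refine ⟨A₃, π₃ ≫ π₂ ≫ π₁, inferInstance, π₃ ≫ (z + π₂ ≫ b₁), c, ?_, ?_⟩
  · simp [Preadditive.add_comp, Preadditive.comp_add, hz', hb₁]
  · have : π₃ ≫ π₂ ≫ π₁ ≫ a = π₃ ≫ (π₂ ≫ (π₁ ≫ a - b₁ ≫ φ.f n)) + π₃ ≫ π₂ ≫ b₁ ≫ φ.f n := by
      simp [Preadditive.comp_sub]
    simp only [Category.assoc]
    rw [this, hc]
    simp [Preadditive.add_comp, Preadditive.comp_add]
    abel

/-- There are no nonzero boundaries in degree 0, so a cycle there is determined by its homology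
class, and `φ` is injective on homology. -/
theorem eq_zero_of_quasiIso_zero {A : C} (x : A ⟶ F.X 0) (hd : x ≫ F.d 0 1 = 0)
    (hj : x ≫ φ.f 0 = 0) : x = 0 := by
  have hn : (ComplexShape.up ℕ).next 0 = 1 := by simp
  have hp : (ComplexShape.up ℕ).prev 0 = 0 := by simp
  have h0 : F.liftCycles x 1 hn hd ≫ F.homologyπ 0 = 0 := by
    rw [← cancel_mono (HomologicalComplex.homologyMap φ 0), Limits.zero_comp, Category.assoc,
      HomologicalComplex.homologyπ_naturality, HomologicalComplex.liftCycles_comp_cyclesMap_assoc,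
      K.liftCycles_comp_homologyπ_eq_zero_iff_up_to_refinements 0 0 1 hp hn]
    exact ⟨A, 𝟙 A, inferInstance, 0, by simp [hj]⟩
  rw [F.liftCycles_comp_homologyπ_eq_zero_iff_up_to_refinements 0 0 1 hp hn] at h0
  obtain ⟨A₁, π₁, _, b₁, hb₁⟩ := h0
  rw [← cancel_epi π₁, hb₁, Limits.comp_zero, F.shape _ _ (by simp), Limits.comp_zero]

/-- The differential `F⁰ ⟶ F¹ ⊞ K⁰` of the mapping cone. -/
noncomputable def coneD₀ {F K : CochainComplex C ℕ} (φ : F ⟶ K) : F.X 0 ⟶ F.X 1 ⊞ K.X 0 :=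
  Limits.biprod.lift (F.d 0 1) (φ.f 0)

/-- The differential `Fⁿ⁺¹ ⊞ Kⁿ ⟶ Fⁿ⁺² ⊞ Kⁿ⁺¹` of the mapping cone. -/
noncomputable def coneD {F K : CochainComplex C ℕ} (φ : F ⟶ K) (n : ℕ) :
    F.X (n + 1) ⊞ K.X n ⟶ F.X (n + 2) ⊞ K.X (n + 1) :=
  Limits.biprod.lift (Limits.biprod.fst ≫ F.d (n + 1) (n + 2))
    (Limits.biprod.fst ≫ φ.f (n + 1) - Limits.biprod.snd ≫ K.d n (n + 1))

@[simp]
theorem coneD₀_fst {F K : CochainComplex C ℕ} (φ : F ⟶ K) :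
    coneD₀ φ ≫ Limits.biprod.fst = F.d 0 1 := Limits.biprod.lift_fst _ _

@[simp]
theorem coneD₀_snd {F K : CochainComplex C ℕ} (φ : F ⟶ K) :
    coneD₀ φ ≫ Limits.biprod.snd = φ.f 0 := Limits.biprod.lift_snd _ _

@[simp]
theorem coneD_fst {F K : CochainComplex C ℕ} (φ : F ⟶ K) (n : ℕ) :
    coneD φ n ≫ Limits.biprod.fst = Limits.biprod.fst ≫ F.d (n + 1) (n + 2) :=
  Limits.biprod.lift_fst _ _

@[simp]
theorem coneD_snd {F K : CochainComplex C ℕ} (φ : F ⟶ K) (n : ℕ) :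
    coneD φ n ≫ Limits.biprod.snd =
      Limits.biprod.fst ≫ φ.f (n + 1) - Limits.biprod.snd ≫ K.d n (n + 1) :=
  Limits.biprod.lift_snd _ _

/-- The beginning `F⁰ ⟶ F¹ ⊞ K⁰ ⟶ F² ⊞ K¹` of the mapping cone. -/
noncomputable abbrev coneStart {F K : CochainComplex C ℕ} (φ : F ⟶ K) : ShortComplex C :=
  ShortComplex.mk (coneD₀ φ) (coneD φ 0) (by
    apply Limits.biprod.hom_ext <;>
    simp [Preadditive.comp_sub, reassoc_of% (coneD₀_fst φ), reassoc_of% (coneD₀_snd φ)])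

/-- The part `F¹ ⊞ K⁰ ⟶ F² ⊞ K¹ ⟶ F³ ⊞ K²` of the mapping cone. -/
noncomputable abbrev coneNext {F K : CochainComplex C ℕ} (φ : F ⟶ K) : ShortComplex C :=
  ShortComplex.mk (coneD φ 0) (coneD φ 1) (by
    apply Limits.biprod.hom_ext <;>
    simp [Preadditive.comp_sub, Preadditive.sub_comp, reassoc_of% (coneD_fst φ 0),
      reassoc_of% (coneD_snd φ 0)])

theorem coneStart_exact : (coneStart φ).Exact := by
  rw [ShortComplex.exact_iff_exact_up_to_refinements]
  intro A x hx
  have h1 := congrArg (· ≫ Limits.biprod.fst) hx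
  have h2 := congrArg (· ≫ Limits.biprod.snd) hx
  simp only [Category.assoc, coneD_fst, coneD_snd,
    Limits.zero_comp, Preadditive.comp_sub, sub_eq_zero] at h1 h2
  simp only [← Category.assoc] at h1 h2
  obtain ⟨A', π, hπ, b, c, hb, hc⟩ := exists_refinement_of_quasiIso φ 0 0 (by simp) _ _ h1 h2
  rw [K.shape 0 0 (by simp), Limits.comp_zero, add_zero] at hc
  exact ⟨A', π, hπ, b, by apply Limits.biprod.hom_ext <;> simp [hb, hc]⟩

instance coneStart_mono : Mono (coneStart φ).f := by
  rw [Preadditive.mono_iff_cancel_zero]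
  intro A (x : A ⟶ F.X 0) hx
  have h1 := congrArg (· ≫ Limits.biprod.fst) hx
  have h2 := congrArg (· ≫ Limits.biprod.snd) hx
  simp only [Category.assoc, coneD₀_fst, coneD₀_snd, Limits.zero_comp] at h1 h2
  exact eq_zero_of_quasiIso_zero φ x h1 h2

theorem coneNext_exact : (coneNext φ).Exact := by
  rw [ShortComplex.exact_iff_exact_up_to_refinements]
  intro A x hx
  have h1 := congrArg (· ≫ Limits.biprod.fst) hx
  have h2 := congrArg (· ≫ Limits.biprod.snd) hx
  simp only [Category.assoc, coneD_fst, coneD_snd,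
    Limits.zero_comp, Preadditive.comp_sub, sub_eq_zero] at h1 h2
  simp only [← Category.assoc] at h1 h2
  obtain ⟨A', π, hπ, b, c, hb, hc⟩ := exists_refinement_of_quasiIso φ 0 1 (by simp) _ _ h1 h2
  -- The sign of `c` compensates for the minus sign in `coneD`.
  refine ⟨A', π, hπ, Limits.biprod.lift b (-c), ?_⟩
  apply Limits.biprod.hom_ext <;> simp [hb, hc, Preadditive.comp_sub]

end QuasiIsoRefinements

/-! ### Elements of a biproduct under an additive functor to abelian groups. -/

section Elements

variable {C : Type*} [Category* C] [Abelian C] (Γ : C ⥤ AddCommGrpCat.{u}) [Γ.Additive]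

theorem map_hom_comp_apply {A B D : C} (f : A ⟶ B) (g : B ⟶ D) (x : Γ.obj A) :
    (Γ.map g).hom ((Γ.map f).hom x) = (Γ.map (f ≫ g)).hom x := by
  rw [Γ.map_comp]; rfl

theorem map_hom_sub_apply {A B : C} (f g : A ⟶ B) (x : Γ.obj A) :
    (Γ.map (f - g)).hom x = (Γ.map f).hom x - (Γ.map g).hom x := by
  rw [Γ.map_sub]; rfl

/-- An additive functor preserves the decomposition of the identity of `A ⊞ B` through its two
summands, so elements have components. -/
theorem map_biprod_ext {A B : C} {x y : Γ.obj (A ⊞ B)}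
    (h₁ : (Γ.map Limits.biprod.fst).hom x = (Γ.map Limits.biprod.fst).hom y)
    (h₂ : (Γ.map Limits.biprod.snd).hom x = (Γ.map Limits.biprod.snd).hom y) : x = y := by
  have key : ∀ z : Γ.obj (A ⊞ B), z =
      (Γ.map Limits.biprod.inl).hom ((Γ.map Limits.biprod.fst).hom z) +
        (Γ.map Limits.biprod.inr).hom ((Γ.map Limits.biprod.snd).hom z) := fun z => by
    rw [map_hom_comp_apply, map_hom_comp_apply]
    have : (Γ.map (Limits.biprod.fst ≫ Limits.biprod.inl +
      Limits.biprod.snd ≫ Limits.biprod.inr : A ⊞ B ⟶ A ⊞ B)).hom z = z := by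
        rw [Limits.biprod.total, Γ.map_id]; rfl
    rw [Γ.map_add] at this
    exact this.symm
  rw [key x, key y, h₁, h₂]

theorem exists_map_biprod {A B : C} (x : Γ.obj A) (y : Γ.obj B) :
    ∃ z : Γ.obj (A ⊞ B), (Γ.map Limits.biprod.fst).hom z = x ∧
      (Γ.map Limits.biprod.snd).hom z = y := by
  refine ⟨(Γ.map Limits.biprod.inl).hom x + (Γ.map Limits.biprod.inr).hom y, ?_, ?_⟩ <;>
  simp [map_hom_comp_apply]

variable {F K : CochainComplex C ℕ} (φ : F ⟶ K)

theorem map_coneStart_g_eq_zero (z : Γ.obj (F.X 1 ⊞ K.X 0))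
    (hm : (Γ.map (F.d 1 2)).hom ((Γ.map Limits.biprod.fst).hom z) = 0)
    (h : (Γ.map (φ.f 1)).hom ((Γ.map Limits.biprod.fst).hom z) =
      (Γ.map (K.d 0 1)).hom ((Γ.map Limits.biprod.snd).hom z)) :
    (Γ.map (coneStart φ).g).hom z = 0 := by
  apply map_biprod_ext Γ
  · rw [map_hom_comp_apply] at hm ⊢
    simpa using hm
  · rw [map_hom_comp_apply, map_hom_comp_apply, ← sub_eq_zero, ← map_hom_sub_apply] at h
    rw [map_hom_comp_apply]
    simpa using h

theorem map_coneNext_g_eq_zero (z : Γ.obj (F.X 2 ⊞ K.X 1))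
    (hm : (Γ.map (F.d 2 3)).hom ((Γ.map Limits.biprod.fst).hom z) = 0)
    (h : (Γ.map (φ.f 2)).hom ((Γ.map Limits.biprod.fst).hom z) =
      (Γ.map (K.d 1 2)).hom ((Γ.map Limits.biprod.snd).hom z)) :
    (Γ.map (coneNext φ).g).hom z = 0 := by
  apply map_biprod_ext Γ
  · rw [map_hom_comp_apply] at hm ⊢
    simpa using hm
  · rw [map_hom_comp_apply, map_hom_comp_apply, ← sub_eq_zero, ← map_hom_sub_apply] at h
    rw [map_hom_comp_apply]
    simpa using h

theorem fst_map_coneStart_f (q : Γ.obj (F.X 0)) :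
    (Γ.map Limits.biprod.fst).hom ((Γ.map (coneStart φ).f).hom q) = (Γ.map (F.d 0 1)).hom q := by
  rw [map_hom_comp_apply]; simp

theorem snd_map_coneStart_f (q : Γ.obj (F.X 0)) :
    (Γ.map Limits.biprod.snd).hom ((Γ.map (coneStart φ).f).hom q) = (Γ.map (φ.f 0)).hom q := by
  rw [map_hom_comp_apply]; simp

theorem fst_map_coneNext_f (q : Γ.obj (F.X 1 ⊞ K.X 0)) :
    (Γ.map Limits.biprod.fst).hom ((Γ.map (coneNext φ).f).hom q) =
      (Γ.map (F.d 1 2)).hom ((Γ.map Limits.biprod.fst).hom q) := by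
  rw [map_hom_comp_apply, map_hom_comp_apply]; simp

theorem snd_map_coneNext_f (q : Γ.obj (F.X 1 ⊞ K.X 0)) :
    (Γ.map Limits.biprod.snd).hom ((Γ.map (coneNext φ).f).hom q) =
      (Γ.map (φ.f 1)).hom ((Γ.map Limits.biprod.fst).hom q) -
        (Γ.map (K.d 0 1)).hom ((Γ.map Limits.biprod.snd).hom q) := by
  rw [map_hom_comp_apply, map_hom_comp_apply, map_hom_comp_apply, ← map_hom_sub_apply]
  simp

end Elements

/-! ### Sections of exact sequences of sheaves and of the mapping cone. -/

section SheafSections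

variable {X : TopCat.{u}} {F G H : TopCat.Sheaf AddCommGrpCat.{u} X}

theorem sectionsRes_sectionsMap (φ : F ⟶ G) {U V : Opens X} (h : V ≤ U)
    (x : F.obj.obj (op U)) :
    sectionsRes G h (sectionsMap φ U x) = sectionsMap φ V (sectionsRes F h x) :=
  (ConcreteCategory.congr_hom (φ.hom.naturality (homOfLE h).op) x).symm

@[simp] theorem sectionsRes_refl {U : Opens X} (h : U ≤ U) (x : F.obj.obj (op U)) :
    sectionsRes F h x = x :=
  ConcreteCategory.congr_hom (F.obj.map_id (op U)) x

@[simp] theorem sectionsRes_sectionsRes {U V W : Opens X} (h : V ≤ U) (h' : W ≤ V)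
    (x : F.obj.obj (op U)) :
    sectionsRes F h' (sectionsRes F h x) = sectionsRes F (h'.trans h) x :=
  (ConcreteCategory.congr_hom (F.obj.map_comp (homOfLE h).op (homOfLE h').op) x).symm

theorem sectionsMap_comp (φ : F ⟶ G) (ψ : G ⟶ H) (U : Opens X) (x : F.obj.obj (op U)) :
    sectionsMap (φ ≫ ψ) U x = sectionsMap ψ U (sectionsMap φ U x) := rfl

theorem sections_ext {ι : Type*} {V : Opens X} (U : ι → Opens X) (hU : ∀ i, U i ≤ V)
    (hV : V ≤ iSup U) (x y : F.obj.obj (op V))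
    (h : ∀ i, sectionsRes F (hU i) x = sectionsRes F (hU i) y) : x = y :=
  TopCat.Sheaf.eq_of_locally_eq' F U V (fun i => homOfLE (hU i)) hV x y h

theorem sections_glue {ι : Type*} {V : Opens X} (U : ι → Opens X) (hU : ∀ i, U i ≤ V)
    (hV : V ≤ iSup U) (x : ∀ i, F.obj.obj (op (U i)))
    (hx : ∀ i j, sectionsRes F (inf_le_left : U i ⊓ U j ≤ U i) (x i) =
      sectionsRes F (inf_le_right : U i ⊓ U j ≤ U j) (x j)) :
    ∃ y : F.obj.obj (op V), ∀ i, sectionsRes F (hU i) y = x i :=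
  (TopCat.Sheaf.existsUnique_gluing' F U V (fun i => homOfLE (hU i)) hV x
    (fun i j => hx i j)).exists

/-- The functor of sections over an open set. -/
noncomputable def sectionsFunctor (U : Opens X) :
    TopCat.Sheaf AddCommGrpCat.{u} X ⥤ AddCommGrpCat.{u} :=
  (sheafSections (Opens.grothendieckTopology X) AddCommGrpCat.{u}).obj (op U)

instance sectionsFunctor_additive (U : Opens X) : (sectionsFunctor U).Additive where
  map_add := rfl

instance sectionsFunctor_preservesLimits (U : Opens X) :
    Limits.PreservesLimits (sectionsFunctor U) :=
  inferInstanceAs (Limits.PreservesLimits (sheafToPresheaf _ _ ⋙ (evaluation _ _).obj (op U)))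

/-- Taking sections is left exact: `S.f` is a kernel of `S.g`, and the sections functor preserves
limits. -/
theorem exists_sectionsMap_eq_of_exact {S : ShortComplex (TopCat.Sheaf AddCommGrpCat.{u} X)}
    (hS : S.Exact) [Mono S.f] {U : Opens X} (x : S.X₂.obj.obj (op U))
    (hx : sectionsMap S.g U x = 0) : ∃ y, sectionsMap S.f U y = x := by
  have := hS.map_of_mono_of_preservesKernel (sectionsFunctor U) inferInstance inferInstance
  rw [ShortComplex.ab_exact_iff] at this
  exact this x hx

theorem sectionsMap_injective_of_mono (φ : F ⟶ G) [Mono φ] (U : Opens X) :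
    Function.Injective (sectionsMap φ U) := by
  have : Mono ((sectionsFunctor U).map φ) := inferInstance
  exact (AddCommGrpCat.mono_iff_injective _).1 this

/-- Factor `S.f` through the kernel of `S.g`. Sections of the kernel are the sections killed by
`S.g`, and the first factor is an epimorphism of sheaves, that is, locally surjective. -/
theorem exists_local_sectionsMap_eq_of_exact
    {S : ShortComplex (TopCat.Sheaf AddCommGrpCat.{u} X)}
    (hS : S.Exact) {U : Opens X} (x : S.X₂.obj.obj (op U))
    (hx : sectionsMap S.g U x = 0) (t : X) (ht : t ∈ U) :
    ∃ (V : Opens X) (hV : V ≤ U) (_ : t ∈ V) (y : S.X₁.obj.obj (op V)),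
      sectionsMap S.f V y = sectionsRes S.X₂ hV x := by
  let T : ShortComplex (TopCat.Sheaf AddCommGrpCat.{u} X) :=
    ShortComplex.mk (Limits.kernel.ι S.g) S.g (by simp)
  have hT : T.Exact := ShortComplex.exact_kernel S.g
  have : Mono T.f := inferInstanceAs (Mono (Limits.kernel.ι S.g))
  obtain ⟨z, hz⟩ := exists_sectionsMap_eq_of_exact hT x hx
  have hepi : Epi (Limits.kernel.lift S.g S.f S.zero) := hS.epi_kernelLift
  rw [← TopCat.Sheaf.isLocallySurjective_iff_epi, TopCat.Presheaf.isLocallySurjective_iff] at hepi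
  obtain ⟨V, hV, ⟨y, hy⟩, htV⟩ := hepi U z t ht
  refine ⟨V, hV, htV, y, ?_⟩
  rw [← hz, sectionsRes_sectionsMap]
  have h2 : S.f = Limits.kernel.lift S.g S.f S.zero ≫ T.f := (Limits.kernel.lift_ι _ _ _).symm
  rw [h2, sectionsMap_comp]
  exact congrArg _ hy

variable {F K : CochainComplex (TopCat.Sheaf AddCommGrpCat.{u} X) ℕ} (φ : F ⟶ K)

theorem sectionsMap_d_f (m n : ℕ) (U : Opens X) (x : (F.X m).obj.obj (op U)) :
    sectionsMap (K.d m n) U (sectionsMap (φ.f m) U x) =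
      sectionsMap (φ.f n) U (sectionsMap (F.d m n) U x) :=
  congrArg (fun ψ => sectionsMap ψ U x) (φ.comm m n)

theorem sectionsMap_d_d (l m n : ℕ) (U : Opens X) (x : (F.X l).obj.obj (op U)) :
    sectionsMap (F.d m n) U (sectionsMap (F.d l m) U x) = 0 :=
  congrArg (fun ψ => sectionsMap ψ U x) (F.d_comp_d l m n)

variable [QuasiIso φ]

/-- The first map of the mapping cone is a monomorphism. Identities in `F⁰` can therefore be checked
after `φ` and after `d`. -/
theorem eq_of_sectionsMap_eq {U : Opens X} (x y : (F.X 0).obj.obj (op U))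
    (hj : sectionsMap (φ.f 0) U x = sectionsMap (φ.f 0) U y)
    (hd : sectionsMap (F.d 0 1) U x = sectionsMap (F.d 0 1) U y) : x = y := by
  refine sectionsMap_injective_of_mono (coneStart φ).f U ?_
  refine map_biprod_ext (sectionsFunctor U) ?_ ?_
  · exact ((fst_map_coneStart_f (sectionsFunctor U) φ x).trans hd).trans
      (fst_map_coneStart_f (sectionsFunctor U) φ y).symm
  · exact ((snd_map_coneStart_f (sectionsFunctor U) φ x).trans hj).trans
      (snd_map_coneStart_f (sectionsFunctor U) φ y).symm

/-- Exactness of the cone at `F¹ ⊞ K⁰`. As the map out of `F⁰` is mono, the preimage exists over all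
of `U`, without shrinking. -/
theorem exists_of_cocycle {U : Opens X} (m : (F.X 1).obj.obj (op U)) (a : (K.X 0).obj.obj (op U))
    (hm : sectionsMap (F.d 1 2) U m = 0)
    (h : sectionsMap (φ.f 1) U m = sectionsMap (K.d 0 1) U a) :
    ∃ q, sectionsMap (φ.f 0) U q = a ∧ sectionsMap (F.d 0 1) U q = m := by
  obtain ⟨z, hz₁, hz₂⟩ := exists_map_biprod (sectionsFunctor U) (A := F.X 1) (B := K.X 0) m a
  have hz : sectionsMap (coneStart φ).g U z = 0 := by
    refine map_coneStart_g_eq_zero (sectionsFunctor U) φ z ?_ ?_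
    · rw [hz₁]; exact hm
    · rw [hz₁, hz₂]; exact h
  obtain ⟨q, hq⟩ := exists_sectionsMap_eq_of_exact (coneStart_exact φ) z hz
  subst hq
  exact ⟨q, (snd_map_coneStart_f (sectionsFunctor U) φ q).symm.trans hz₂,
    (fst_map_coneStart_f (sectionsFunctor U) φ q).symm.trans hz₁⟩

/-- Exactness of the cone at `F² ⊞ K¹`, applied to the pair `(0, z)`. Here the preimage is only
local. This extracts sections of `F¹` from a cocycle of the resolution. -/
theorem exists_local_of_cocycle {U : Opens X} (z : (K.X 1).obj.obj (op U))
    (hz : sectionsMap (K.d 1 2) U z = 0) (t : X) (ht : t ∈ U) :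
    ∃ (V : Opens X) (hV : V ≤ U) (_ : t ∈ V) (m : (F.X 1).obj.obj (op V))
      (a : (K.X 0).obj.obj (op V)), sectionsMap (F.d 1 2) V m = 0 ∧
      sectionsRes _ hV z = sectionsMap (φ.f 1) V m - sectionsMap (K.d 0 1) V a := by
  obtain ⟨w, hw₁, hw₂⟩ := exists_map_biprod (sectionsFunctor U) (A := F.X 2) (B := K.X 1) 0 z
  have hw : sectionsMap (coneNext φ).g U w = 0 := by
    refine map_coneNext_g_eq_zero (sectionsFunctor U) φ w ?_ ?_
    · rw [hw₁, map_zero]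
    · rw [hw₁, hw₂, map_zero]; exact hz.symm
  obtain ⟨V, hV, htV, y, hy⟩ := exists_local_sectionsMap_eq_of_exact (coneNext_exact φ) w hw t ht
  refine ⟨V, hV, htV, sectionsMap (Limits.biprod.fst : F.X 1 ⊞ K.X 0 ⟶ F.X 1) V y,
    sectionsMap (Limits.biprod.snd : F.X 1 ⊞ K.X 0 ⟶ K.X 0) V y, ?_, ?_⟩
  · have h1 : sectionsMap (Limits.biprod.fst : F.X 2 ⊞ K.X 1 ⟶ F.X 2) V
        (sectionsMap (coneNext φ).f V y) = 0 := by
      refine (congrArg _ hy).trans ?_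
      refine (sectionsRes_sectionsMap (Limits.biprod.fst : F.X 2 ⊞ K.X 1 ⟶ F.X 2) hV w).symm.trans ?_
      exact (congrArg (sectionsRes (F.X 2) hV) hw₁).trans (map_zero _)
    exact (fst_map_coneNext_f (sectionsFunctor V) φ y).symm.trans h1
  · have h1 : sectionsMap (Limits.biprod.snd : F.X 2 ⊞ K.X 1 ⟶ K.X 1) V
        (sectionsMap (coneNext φ).f V y) = sectionsRes (K.X 1) hV z := by
      refine (congrArg _ hy).trans ?_
      refine (sectionsRes_sectionsMap (Limits.biprod.snd : F.X 2 ⊞ K.X 1 ⟶ K.X 1) hV w).symm.trans ?_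
      exact congrArg (sectionsRes (K.X 1) hV) hw₂
    exact h1.symm.trans (snd_map_coneNext_f (sectionsFunctor V) φ y)

end SheafSections

/-! ### Cycles and classes in degree 1 of a complex of abelian groups. -/

section AbCohomology

variable (K : CochainComplex AddCommGrpCat.{u} ℕ)

theorem exists_cycles_eq (x : K.X 1) (hx : (K.d 1 2).hom x = 0) :
    ∃ z : K.cycles 1, (K.iCycles 1).hom z = x := by
  have h : (ShortComplex.mk (K.iCycles 1) (K.d 1 2) (by simp)).Exact :=
    ShortComplex.exact_of_f_is_kernel _ (K.cyclesIsKernel 1 2 (by simp))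
  rw [ShortComplex.ab_exact_iff] at h
  exact h x hx

theorem d_iCycles (z : K.cycles 1) : (K.d 1 2).hom ((K.iCycles 1).hom z) = 0 :=
  congrArg (fun f => f.hom z) (K.iCycles_d 1 2)

theorem homologyπ_surjective : Function.Surjective (K.homologyπ 1).hom :=
  (AddCommGrpCat.epi_iff_surjective _).1 inferInstance

theorem homologyπ_eq_iff (z z' : K.cycles 1) :
    (K.homologyπ 1).hom z = (K.homologyπ 1).hom z' ↔
      ∃ b : K.X 0, (K.iCycles 1).hom z = (K.iCycles 1).hom z' + (K.d 0 1).hom b := by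
  have h : (ShortComplex.mk (K.toCycles 0 1) (K.homologyπ 1) (by simp)).Exact :=
    ShortComplex.exact_of_g_is_cokernel _ (K.homologyIsCokernel 0 1 (by simp))
  rw [ShortComplex.ab_exact_iff] at h
  have hi : Function.Injective (K.iCycles 1).hom :=
    (AddCommGrpCat.mono_iff_injective _).1 inferInstance
  have ht : ∀ b, (K.iCycles 1).hom ((K.toCycles 0 1).hom b) = (K.d 0 1).hom b := fun b =>
    congrArg (fun f => f.hom b) (K.toCycles_i 0 1)
  have h0 : ∀ b, (K.homologyπ 1).hom ((K.toCycles 0 1).hom b) = 0 := fun b =>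
    congrArg (fun f => f.hom b) (K.toCycles_comp_homologyπ 0 1)
  constructor
  · intro hz
    obtain ⟨b, hb⟩ := h (z - z') ((map_sub (K.homologyπ 1).hom z z').trans (sub_eq_zero.2 hz))
    refine ⟨b, ?_⟩
    rw [← ht]
    have : (K.toCycles 0 1).hom b = z - z' := hb
    rw [this, map_sub]; abel
  · rintro ⟨b, hb⟩
    have : z = z' + (K.toCycles 0 1).hom b := hi (by rw [map_add, ht, hb])
    rw [this, map_add, h0, add_zero]

end AbCohomology

/-! ### Vanishing of the first Čech cohomology of an injective sheaf. -/

section CechInjective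

variable {X : TopCat.{u}} (G : TopCat.Sheaf AddCommGrpCat.{u} X) {I : Type u} (U : I → Opens X)

/-- The presheaf `W ↦ ∏ i, G (U i ⊓ W)`. -/
noncomputable def cechPresheaf : TopCat.Presheaf AddCommGrpCat.{u} X where
  obj W := .of (∀ i, G.obj.obj (op (U i ⊓ W.unop)))
  map f := AddCommGrpCat.ofHom
    { toFun := fun x i => sectionsRes G (inf_le_inf_left _ f.unop.le) (x i)
      map_zero' := by funext i; exact map_zero _
      map_add' := by intro x y; funext i; exact map_add _ _ _ }
  map_id W := by
    ext x i; exact sectionsRes_refl _ _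
  map_comp f g := by
    ext x i; exact (sectionsRes_sectionsRes _ _ _).symm

theorem cechPresheaf_isSheaf : (cechPresheaf G U).IsSheaf := by
  rw [TopCat.Presheaf.isSheaf_iff_isSheafUniqueGluing]
  intro ι W (x : ∀ k i, G.obj.obj (op (U i ⊓ W k))) hx
  have hx' : ∀ k l i, sectionsRes G (inf_le_inf_left _ inf_le_left : U i ⊓ (W k ⊓ W l) ≤ _) (x k i) =
      sectionsRes G (inf_le_inf_left _ inf_le_right : U i ⊓ (W k ⊓ W l) ≤ _) (x l i) :=
    fun k l i => congrFun (hx k l) i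
  have hcov : ∀ i, U i ⊓ iSup W ≤ ⨆ k, U i ⊓ W k := fun i => by rw [inf_iSup_eq]
  have hle : ∀ i k, U i ⊓ W k ≤ U i ⊓ iSup W := fun i k => inf_le_inf_left _ (le_iSup W k)
  have hex : ∀ i, ∃ y : G.obj.obj (op (U i ⊓ iSup W)), ∀ k,
      sectionsRes G (hle i k) y = x k i := fun i => by
    refine sections_glue (fun k => U i ⊓ W k) (hle i) (hcov i) (fun k => x k i) fun k l => ?_
    have := congrArg (sectionsRes G (by
      exact le_inf (inf_le_left.trans inf_le_left) (inf_le_inf inf_le_right inf_le_right) :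
        (U i ⊓ W k) ⊓ (U i ⊓ W l) ≤ U i ⊓ (W k ⊓ W l))) (hx' k l i)
    simpa only [sectionsRes_sectionsRes] using this
  choose y hy using hex
  refine ⟨y, fun k => funext fun i => hy i k, ?_⟩
  intro (y' : ∀ i, G.obj.obj (op (U i ⊓ iSup W))) hy'
  funext i
  refine sections_ext (fun k => U i ⊓ W k) (hle i) (hcov i) _ _ fun k => ?_
  rw [hy]
  exact congrFun (hy' k) i

/-- The sheaf `W ↦ ∏ i, G (U i ⊓ W)`. -/
noncomputable def cechSheaf : TopCat.Sheaf AddCommGrpCat.{u} X :=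
  ⟨cechPresheaf G U, cechPresheaf_isSheaf G U⟩

/-- The augmentation `G ⟶ ∏ i, G (U i ⊓ -)`. -/
noncomputable def toCechSheaf : G ⟶ cechSheaf G U :=
  ⟨{ app := fun W => AddCommGrpCat.ofHom
      { toFun := fun x i => sectionsRes G inf_le_right x
        map_zero' := by funext i; exact map_zero _
        map_add' := by intro x y; funext i; exact map_add _ _ _ }
     naturality := fun V W f => by
      ext x; funext i
      exact (sectionsRes_sectionsRes (F := G) f.unop.le _ x).trans
        (sectionsRes_sectionsRes (F := G) _ _ x).symm }⟩

theorem mono_of_sectionsMap_injective {F G : TopCat.Sheaf AddCommGrpCat.{u} X} (φ : F ⟶ G)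
    (h : ∀ W, Function.Injective (sectionsMap φ W)) : Mono φ := by
  have : ∀ W, Mono (φ.hom.app W) := fun W => (AddCommGrpCat.mono_iff_injective _).2 (h W.unop)
  have : Mono φ.hom := NatTrans.mono_of_mono_app _
  exact (sheafToPresheaf _ _).mono_of_mono_map this

theorem toCechSheaf_mono (hU : iSup U = ⊤) : Mono (toCechSheaf G U) := by
  refine mono_of_sectionsMap_injective _ fun W x y h => ?_
  refine sections_ext (fun i => U i ⊓ W) (fun i => inf_le_right) ?_ _ _ fun i => congrFun h i
  rw [← iSup_inf_eq, hU, top_inf_eq]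

variable {G U}

/-- The first Čech cohomology of an injective sheaf vanishes. -/
theorem exists_coboundary_of_injective [Injective G] (hU : iSup U = ⊤)
    (p : ∀ i j, G.obj.obj (op (U i ⊓ U j)))
    (hp : ∀ i j k (W : Opens X) (hij : W ≤ U i ⊓ U j) (hjk : W ≤ U j ⊓ U k) (hik : W ≤ U i ⊓ U k),
      sectionsRes G hik (p i k) = sectionsRes G hij (p i j) + sectionsRes G hjk (p j k)) :
    ∃ a : ∀ i, G.obj.obj (op (U i)), ∀ i j,
      p i j = sectionsRes G inf_le_left (a i) - sectionsRes G inf_le_right (a j) := by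
  have := toCechSheaf_mono G U hU
  -- Injectivity of `G` splits the augmentation, a monomorphism because the `U i` cover `X`.
  let ρ : cechSheaf G U ⟶ G := Injective.factorThru (𝟙 G) (toCechSheaf G U)
  have hρ : ∀ (W : Opens X) (x : G.obj.obj (op W)),
      sectionsMap ρ W (sectionsMap (toCechSheaf G U) W x) = x := fun W x =>
    congrArg (fun f => sectionsMap f W x) (Injective.comp_factorThru (𝟙 G) (toCechSheaf G U))
  -- For fixed `j` the `p i j` form a section of the Čech sheaf over `U j`. By the cocycle condition
  -- the augmentation sends `p j k` to `q k - q j`, so that `p j k = ρ (q k) - ρ (q j)`. This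
  -- explains the sign of the witness.
  let q : ∀ j, (cechSheaf G U).obj.obj (op (U j)) := fun j i => p i j
  refine ⟨fun j => -sectionsMap ρ (U j) (q j), fun j k => ?_⟩
  have h1 : sectionsMap (toCechSheaf G U) (U j ⊓ U k) (p j k) =
      sectionsRes (cechSheaf G U) inf_le_right (q k) -
        sectionsRes (cechSheaf G U) inf_le_left (q j) := by
    refine eq_sub_of_add_eq' (funext fun i => ?_)
    exact (hp i j k (U i ⊓ (U j ⊓ U k)) (inf_le_inf_left _ inf_le_left) inf_le_right
      (inf_le_inf_left _ inf_le_right)).symm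
  have h2 := congrArg (sectionsMap ρ (U j ⊓ U k)) h1
  rw [hρ, map_sub, ← sectionsRes_sectionsMap, ← sectionsRes_sectionsMap] at h2
  rw [h2, map_neg, map_neg]
  abel

end CechInjective

/-! ### Čech cocycles and their classes in hypercohomology. -/

section CechClass

variable {X : TopCat.{u}} {F : CochainComplex (TopCat.Sheaf AddCommGrpCat.{u} X) ℕ}

/-- The cocycle condition for `({p_ij}, {m_i}) ∈ C¹(U, F⁰) ⊕ C⁰(U, F¹)`. -/
structure IsCechCocycle (F : CochainComplex (TopCat.Sheaf AddCommGrpCat.{u} X) ℕ) {I : Type u}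
    (U : I → Opens X) (p : ∀ i j, (F.X 0).obj.obj (op (U i ⊓ U j)))
    (m : ∀ i, (F.X 1).obj.obj (op (U i))) : Prop where
  cocycle : ∀ i j k (W : Opens X) (hij : W ≤ U i ⊓ U j) (hjk : W ≤ U j ⊓ U k)
    (hik : W ≤ U i ⊓ U k),
      sectionsRes (F.X 0) hik (p i k) =
        sectionsRes (F.X 0) hij (p i j) + sectionsRes (F.X 0) hjk (p j k)
  d_fst : ∀ i j, sectionsMap (F.d 0 1) _ (p i j) =
    sectionsRes (F.X 1) inf_le_left (m i) - sectionsRes (F.X 1) inf_le_right (m j)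
  d_snd : ∀ i, sectionsMap (F.d 1 2) _ (m i) = 0

variable {I : Type u} {U : I → Opens X} {p : ∀ i j, (F.X 0).obj.obj (op (U i ⊓ U j))}
  {m : ∀ i, (F.X 1).obj.obj (op (U i))}

instance (n : ℕ) : Injective ((injRes F).cocomplex.X n) := (injRes F).injective n

instance : QuasiIso (injRes F).ι := (injRes F).quasiIso

/-- In the injective sheaf `I⁰` the image of `p` becomes a coboundary `a_i - a_j`. By the mixed
cocycle condition the sections `m_i - d a_i` of `I¹` agree on overlaps, and they glue to a global
cycle. -/
theorem IsCechCocycle.exists_isCechClass (h : IsCechCocycle F U p m) (hU : iSup U = ⊤) :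
    ∃ c, IsCechClass U p m c := by
  obtain ⟨a, ha⟩ := exists_coboundary_of_injective (G := (injRes F).cocomplex.X 0) hU
    (fun i j => sectionsMap ((injRes F).ι.f 0) _ (p i j)) (fun i j k W hij hjk hik => by
      simp only [sectionsRes_sectionsMap, h.cocycle i j k W hij hjk hik, map_add])
  obtain ⟨z, hz⟩ := sections_glue (F := (injRes F).cocomplex.X 1) U (fun i => le_top) hU.ge
    (fun i => sectionsMap ((injRes F).ι.f 1) _ (m i) - sectionsMap ((injRes F).cocomplex.d 0 1) _ (a i)) (fun i j => by
      have h1 := congrArg (sectionsMap ((injRes F).cocomplex.d 0 1) _) (ha i j)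
      rw [sectionsMap_d_f, h.d_fst] at h1
      simp only [map_sub, sectionsRes_sectionsMap] at h1 ⊢
      rw [sub_eq_sub_iff_add_eq_add] at h1 ⊢
      rw [h1, add_comm])
  have hz0 : sectionsMap ((injRes F).cocomplex.d 1 2) ⊤ z = 0 := by
    refine sections_ext U (fun i => le_top) hU.ge _ _ fun i => ?_
    rw [sectionsRes_sectionsMap, hz, map_sub, sectionsMap_d_f, h.d_snd, sectionsMap_d_d,
      map_zero, map_zero, sub_zero]
  obtain ⟨z', hz'⟩ := exists_cycles_eq (globalComplex (injRes F).cocomplex) z hz0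
  exact ⟨_, a, z', ha, fun i => (congrArg _ hz').trans (hz i), rfl⟩

/-- Two choices of `a` have the same differences on overlaps, hence differ by a global section `b`
of `I⁰`, and the two global cycles differ by `d b`. -/
theorem IsCechClass.unique (hU : iSup U = ⊤) {c c' : hypercohomology F 1}
    (h : IsCechClass U p m c) (h' : IsCechClass U p m c') : c = c' := by
  obtain ⟨a, z, ha, hz, rfl⟩ := h
  obtain ⟨a', z', ha', hz', rfl⟩ := h'
  obtain ⟨b, hb⟩ := sections_glue (F := (injRes F).cocomplex.X 0) U (fun i => le_top) hU.ge
    (fun i => a' i - a i) (fun i j => by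
      have := (ha i j).symm.trans (ha' i j)
      simp only [map_sub]
      rw [sub_eq_sub_iff_sub_eq_sub]
      exact this.symm)
  refine (homologyπ_eq_iff _ _ _).2 ⟨b, ?_⟩
  refine sections_ext (F := (injRes F).cocomplex.X 1) U (fun i => le_top) hU.ge _ _ fun i => ?_
  refine (hz i).trans (Eq.trans ?_ (map_add _ _ _).symm)
  refine Eq.trans ?_ (congrArg₂ (· + ·) (hz' i).symm
    (sectionsRes_sectionsMap ((injRes F).cocomplex.d 0 1) le_top b).symm)
  simp only [hb, map_sub]
  abel

theorem IsCechClass.reindex {c : hypercohomology F 1} (h : IsCechClass U p m c) {I' : Type u}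
    (f : I' → I) :
    IsCechClass (fun i => U (f i)) (fun i j => p (f i) (f j)) (fun i => m (f i)) c := by
  obtain ⟨a, z, ha, hz, hc⟩ := h
  exact ⟨fun i => a (f i), z, fun i j => ha _ _, fun i => hz _, hc⟩

/-- If the global cycles satisfy `z' = z + d b`, then over `U_i ∩ U'_j` the differential of `a_i -
(a'_j + b)` is the image of `m_i - m'_j`, so this section comes from a section `q_ij` of `F⁰`. The
`q_ij` exhibit the two cocycles as cohomologous on the common refinement, and no map between the
index sets is needed. -/
theorem IsCechClass.exists_comparison (h : IsCechCocycle F U p m) {I' : Type u}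
    {U' : I' → Opens X} {p' : ∀ i j, (F.X 0).obj.obj (op (U' i ⊓ U' j))}
    {m' : ∀ i, (F.X 1).obj.obj (op (U' i))} (h' : IsCechCocycle F U' p' m')
    {c : hypercohomology F 1} (hc : IsCechClass U p m c) (hc' : IsCechClass U' p' m' c) :
    ∃ q : ∀ i j, (F.X 0).obj.obj (op (U i ⊓ U' j)),
      (∀ i j, sectionsMap (F.d 0 1) _ (q i j) =
        sectionsRes (F.X 1) inf_le_left (m i) - sectionsRes (F.X 1) inf_le_right (m' j)) ∧
      (∀ i j k (W : Opens X) (hij : W ≤ U i ⊓ U j) (hjk : W ≤ U j ⊓ U' k) (hik : W ≤ U i ⊓ U' k),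
        sectionsRes (F.X 0) hik (q i k) =
          sectionsRes (F.X 0) hij (p i j) + sectionsRes (F.X 0) hjk (q j k)) ∧
      (∀ i j k (W : Opens X) (hij : W ≤ U i ⊓ U' j) (hjk : W ≤ U' j ⊓ U' k) (hik : W ≤ U i ⊓ U' k),
        sectionsRes (F.X 0) hik (q i k) =
          sectionsRes (F.X 0) hij (q i j) + sectionsRes (F.X 0) hjk (p' j k)) := by
  obtain ⟨a, z, ha, hz, rfl⟩ := hc
  obtain ⟨a', z', ha', hz', hzz⟩ := hc'
  obtain ⟨(b : ((injRes F).cocomplex.X 0).obj.obj (op ⊤)), hb⟩ := (homologyπ_eq_iff _ _ _).1 hzz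
  -- Replacing `a'` by `a' + b` measures both cocycles against the same global cycle `z`.
  have hzz : ∀ j, sectionsRes ((injRes F).cocomplex.X 1) (le_top : U' j ≤ ⊤) ((globalComplex (injRes F).cocomplex).iCycles 1 z) =
      sectionsMap ((injRes F).ι.f 1) _ (m' j) -
        sectionsMap ((injRes F).cocomplex.d 0 1) _ (a' j + sectionsRes ((injRes F).cocomplex.X 0) le_top b) := fun j => by
    have h1 := (hz' j).symm.trans (congrArg (sectionsRes ((injRes F).cocomplex.X 1) (le_top : U' j ≤ ⊤)) hb)
    have h2 := h1.trans (map_add _ _ _)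
    have h3 : sectionsRes ((injRes F).cocomplex.X 1) (le_top : U' j ≤ ⊤) (((globalComplex (injRes F).cocomplex).d 0 1).hom b) =
      sectionsMap ((injRes F).cocomplex.d 0 1) (U' j) (sectionsRes ((injRes F).cocomplex.X 0) le_top b) := sectionsRes_sectionsMap _ _ _
    rw [h3] at h2
    rw [map_add, ← sub_sub]
    exact (sub_eq_iff_eq_add.2 h2).symm
  have hex : ∀ i j, ∃ q : (F.X 0).obj.obj (op (U i ⊓ U' j)), sectionsMap ((injRes F).ι.f 0) _ q =
      sectionsRes ((injRes F).cocomplex.X 0) inf_le_left (a i) -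
        sectionsRes ((injRes F).cocomplex.X 0) inf_le_right (a' j + sectionsRes ((injRes F).cocomplex.X 0) le_top b) ∧
      sectionsMap (F.d 0 1) _ q =
        sectionsRes (F.X 1) inf_le_left (m i) - sectionsRes (F.X 1) inf_le_right (m' j) :=
    fun i j => by
    refine exists_of_cocycle (injRes F).ι _ _ ?_ ?_
    · rw [map_sub, ← sectionsRes_sectionsMap, ← sectionsRes_sectionsMap, h.d_snd, h'.d_snd,
        map_zero, map_zero, sub_zero]
    · obtain ⟨ζ, hζ⟩ : ∃ ζ : ((injRes F).cocomplex.X 1).obj.obj (op ⊤),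
          ζ = ((globalComplex (injRes F).cocomplex).iCycles 1).hom z := ⟨_, rfl⟩
      have hzi : sectionsRes ((injRes F).cocomplex.X 1) (le_top : U i ≤ ⊤) ζ = _ :=
        (congrArg _ hζ).trans (hz i)
      have hzj : sectionsRes ((injRes F).cocomplex.X 1) (le_top : U' j ≤ ⊤) ζ = _ :=
        (congrArg _ hζ).trans (hzz j)
      have h1 := congrArg (sectionsRes ((injRes F).cocomplex.X 1)
        (inf_le_left : U i ⊓ U' j ≤ U i)) hzi
      have h2 := congrArg (sectionsRes ((injRes F).cocomplex.X 1)
        (inf_le_right : U i ⊓ U' j ≤ U' j)) hzj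
      rw [sectionsRes_sectionsRes, map_sub, sectionsRes_sectionsMap, sectionsRes_sectionsMap]
        at h1 h2
      have h3 := h1.symm.trans h2
      rw [sub_eq_sub_iff_sub_eq_sub] at h3
      simpa only [map_sub] using h3
  choose q hq₀ hq₁ using hex
  refine ⟨q, hq₁, fun i j k W hij hjk hik => ?_, fun i j k W hij hjk hik => ?_⟩
  · refine eq_of_sectionsMap_eq (injRes F).ι _ _ ?_ ?_
    · simp only [map_add, ← sectionsRes_sectionsMap, hq₀, ha, map_sub, sectionsRes_sectionsRes]
      abel
    · simp only [map_add, ← sectionsRes_sectionsMap, hq₁, h.d_fst, map_sub, sectionsRes_sectionsRes]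
      abel
  · refine eq_of_sectionsMap_eq (injRes F).ι _ _ ?_ ?_
    · simp only [map_add, ← sectionsRes_sectionsMap, hq₀, ha', map_sub, sectionsRes_sectionsRes]
      abel
    · simp only [map_add, ← sectionsRes_sectionsMap, hq₁, h'.d_fst, map_sub,
        sectionsRes_sectionsRes]
      abel

/-- Near each point a global cycle of the resolution is `m - d a` with `m` from `F¹`; shrinking to
members of the basis gives a cover indexed by the points of `X`, and the differences `a_i - a_j`
lift to `F⁰`. The cover depends on the class, which is why no vanishing on the basis is required. -/
theorem exists_isCechClass_of_isBasis {B : Set (Opens X)} (hB : Opens.IsBasis B)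
    (c : hypercohomology F 1) :
    ∃ (I : Type u) (U : I → Opens X) (p : ∀ i j, (F.X 0).obj.obj (op (U i ⊓ U j)))
      (m : ∀ i, (F.X 1).obj.obj (op (U i))), (∀ i, U i ∈ B) ∧ iSup U = ⊤ ∧
        IsCechCocycle F U p m ∧ IsCechClass U p m c := by
  obtain ⟨z, rfl⟩ := homologyπ_surjective (globalComplex (injRes F).cocomplex) c
  obtain ⟨ζ, hζ⟩ : ∃ ζ : ((injRes F).cocomplex.X 1).obj.obj (op ⊤),
      ζ = ((globalComplex (injRes F).cocomplex).iCycles 1).hom z := ⟨_, rfl⟩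
  have hz : sectionsMap ((injRes F).cocomplex.d 1 2) ⊤ ζ = 0 := hζ ▸
    d_iCycles (globalComplex (injRes F).cocomplex) z
  have hex : ∀ t : X, ∃ (V : Opens X) (_ : V ∈ B) (_ : t ∈ V) (m : (F.X 1).obj.obj (op V))
      (a : ((injRes F).cocomplex.X 0).obj.obj (op V)), sectionsMap (F.d 1 2) V m = 0 ∧
      sectionsRes ((injRes F).cocomplex.X 1) le_top ζ =
        sectionsMap ((injRes F).ι.f 1) V m - sectionsMap ((injRes F).cocomplex.d 0 1) V a := fun t => by
    obtain ⟨V, hV, ht, m, a, hm, ha⟩ := exists_local_of_cocycle (injRes F).ι _ hz t trivial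
    obtain ⟨W, hWB, htW, hWV⟩ := Opens.isBasis_iff_nbhd.1 hB ht
    refine ⟨W, hWB, htW, sectionsRes _ hWV m, sectionsRes _ hWV a, ?_, ?_⟩
    · rw [← sectionsRes_sectionsMap, hm, map_zero]
    · have := congrArg (sectionsRes ((injRes F).cocomplex.X 1) hWV) ha
      rwa [sectionsRes_sectionsRes, map_sub, sectionsRes_sectionsMap, sectionsRes_sectionsMap]
        at this
  choose U hUB hU m a hm ha using hex
  have hex' : ∀ i j, ∃ q : (F.X 0).obj.obj (op (U i ⊓ U j)), sectionsMap ((injRes F).ι.f 0) _ q =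
      sectionsRes ((injRes F).cocomplex.X 0) inf_le_left (a i) - sectionsRes ((injRes F).cocomplex.X 0) inf_le_right (a j) ∧
      sectionsMap (F.d 0 1) _ q =
        sectionsRes (F.X 1) inf_le_left (m i) - sectionsRes (F.X 1) inf_le_right (m j) :=
    fun i j => by
    refine exists_of_cocycle (injRes F).ι _ _ ?_ ?_
    · rw [map_sub, ← sectionsRes_sectionsMap, ← sectionsRes_sectionsMap, hm, hm,
        map_zero, map_zero, sub_zero]
    · have h1 := congrArg (sectionsRes ((injRes F).cocomplex.X 1) (inf_le_left : U i ⊓ U j ≤ U i)) (ha i)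
      have h2 := congrArg (sectionsRes ((injRes F).cocomplex.X 1) (inf_le_right : U i ⊓ U j ≤ U j)) (ha j)
      rw [sectionsRes_sectionsRes, map_sub, sectionsRes_sectionsMap, sectionsRes_sectionsMap] at h1 h2
      have h3 := h1.symm.trans h2
      rw [sub_eq_sub_iff_sub_eq_sub] at h3
      simpa only [map_sub] using h3
  choose p hp₀ hp₁ using hex'
  refine ⟨X, U, p, m, hUB, ?_, ⟨fun i j k W hij hjk hik => ?_, hp₁, hm⟩, a, z, hp₀, fun i => (congrArg _ hζ.symm).trans (ha i), rfl⟩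
  · exact top_le_iff.1 fun t _ => Opens.mem_iSup.2 ⟨t, hU t⟩
  · refine eq_of_sectionsMap_eq (injRes F).ι _ _ ?_ ?_
    · simp only [map_add, ← sectionsRes_sectionsMap, hp₀, map_sub, sectionsRes_sectionsRes]
      abel
    · simp only [map_add, ← sectionsRes_sectionsMap, hp₁, map_sub, sectionsRes_sectionsRes]
      abel

end CechClass

/-! ### Sections of schemes over an affine base: base functions and flatness. -/

section OverSpec

variable {R R' : Type u} [CommRing R] [CommRing R'] {X Y : Scheme.{u}} [X.Over (Spec (.of R))]
  [Y.Over (Spec (.of R'))]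

theorem appLE_algebraMap (f : X ⟶ Y) (φ : R' →+* R)
    (hf : f ≫ (Y ↘ Spec (.of R')) = (X ↘ Spec (.of R)) ≫ Spec.map (CommRingCat.ofHom φ))
    {V : Y.Opens} {U : X.Opens} (e : U ≤ f ⁻¹ᵁ V) (c : R') :
    (f.appLE V U e).hom (algebraMap R' Γ(Y, V) c) = algebraMap R Γ(X, U) (φ c) := by
  have hle : ∀ {Z : Scheme.{u}} (g : Z ⟶ Spec (.of R')) (W : Z.Opens), W ≤ g ⁻¹ᵁ ⊤ :=
    fun g W => le_top
  have key : (Scheme.ΓSpecIso (.of R')).inv ≫ (Y ↘ Spec (.of R')).appLE ⊤ V (hle _ _) ≫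
      f.appLE V U e = CommRingCat.ofHom φ ≫ (Scheme.ΓSpecIso (.of R)).inv ≫
        (X ↘ Spec (.of R)).appLE ⊤ U le_top := by
    have h2 : ∀ (g g' : X ⟶ Spec (.of R')) (h : g = g'),
        g.appLE ⊤ U (hle _ _) = g'.appLE ⊤ U (hle _ _) := fun g g' h => by subst h; rfl
    rw [Scheme.Hom.appLE_comp_appLE, h2 _ _ hf, Scheme.Hom.comp_appLE,
      Scheme.ΓSpecIso_inv_naturality_assoc]
    rfl
  exact congrArg (fun g => g.hom c) key

theorem fromSpec_comp_over {U : X.Opens} (hU : IsAffineOpen U) :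
    hU.fromSpec ≫ (X ↘ Spec (.of R)) =
      Spec.map (CommRingCat.ofHom (algebraMap R Γ(X, U))) := by
  rw [← IsAffineOpen.SpecMap_appLE_fromSpec (X ↘ Spec (.of R)) (isAffineOpen_top _) hU le_top,
    IsAffineOpen.fromSpec_top, Scheme.isoSpec_Spec_inv, ← Spec.map_comp]
  rfl

theorem fromSpec_appLE_self {U : X.Opens} (hU : IsAffineOpen U) (e : ⊤ ≤ hU.fromSpec ⁻¹ᵁ U) :
    hU.fromSpec.appLE U ⊤ e = (Scheme.ΓSpecIso _).inv := by
  rw [Scheme.Hom.appLE, hU.fromSpec_app_self, Category.assoc, ← Functor.map_comp]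
  exact (congrArg _ ((Spec Γ(X, U)).presheaf.map_id _)).trans (Category.comp_id _)

theorem flat_algebraMap [Flat (X ↘ Spec (.of R))] {U : X.Opens} (hU : IsAffineOpen U) :
    Module.Flat R Γ(X, U) := by
  have : Flat (hU.fromSpec ≫ (X ↘ Spec (.of R))) := inferInstance
  rw [fromSpec_comp_over, Flat.SpecMap_iff] at this
  exact (RingHom.flat_algebraMap_iff).1 this

end OverSpec

/-! ### Flat modules over the dual numbers. -/

section DualNumberAlgebra

variable {k : Type u} [Field k]

/-- The equational criterion of flatness for the single relation `ε x = 0`: `x` is a combination of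
elements with coefficients killed by `ε`, and such coefficients are multiples of `ε`. -/
theorem exists_eq_eps_smul_of_flat {M : Type*} [AddCommGroup M] [Module k[ε] M]
    [Module.Flat k[ε] M] (x : M) (hx : (ε : k[ε]) • x = 0) : ∃ y : M, x = (ε : k[ε]) • y := by
  have h := Module.Flat.isTrivialRelation_of_sum_smul_eq_zero
    (f := fun _ : Fin 1 => (ε : k[ε])) (x := fun _ : Fin 1 => x) (by simpa using hx)
  obtain ⟨_, a, y, h1, h2⟩ := h
  have ha : ∀ j, ∃ c : k[ε], a 0 j = ε * c := fun j => by
    have := h2 j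
    simp only [Fin.isValue, Finset.univ_unique, Fin.default_eq_zero, Finset.sum_singleton] at this
    refine ⟨TrivSqZeroExt.inl (a 0 j).snd, ?_⟩
    have h0 : (a 0 j).fst = 0 := by simpa using congrArg TrivSqZeroExt.snd this
    ext <;> simp [h0]
  choose c hc using ha
  refine ⟨∑ j, c j • y j, ?_⟩
  have h3 : x = ∑ j, a 0 j • y j := h1 0
  rw [Finset.smul_sum, h3]
  exact Finset.sum_congr rfl fun j _ => by rw [hc, mul_smul]

theorem eps_smul_eps_smul {M : Type*} [AddCommGroup M] [Module k[ε] M] (x : M) :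
    (ε : k[ε]) • (ε : k[ε]) • x = 0 := by
  rw [← mul_smul, DualNumber.eps_mul_eps, zero_smul]

end DualNumberAlgebra

/-- A flat thickening of `X` over `k[ε]`: a flat scheme over `Spec k[ε]` with closed fibre `X`. -/
structure FlatThickening (k : Type u) [Field k] (X : Scheme.{u}) [X.Over (Spec (.of k))] where
  total : Scheme.{u}
  [overBase : total.Over (Spec (.of k[ε]))]
  flat : Flat (total ↘ Spec (.of k[ε]))
  incl : X ⟶ total
  isPullback : IsPullback incl (X ↘ Spec (.of k)) (total ↘ Spec (.of k[ε]))
    (Spec.map (CommRingCat.ofHom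
      (TrivSqZeroExt.fstHom k k k : k[ε] →ₐ[k] k).toRingHom))

attribute [instance] FlatThickening.overBase FlatThickening.flat

/-! ### Topology of a flat thickening and reduction modulo `ε`. -/

namespace FlatThickening

variable {k : Type u} [Field k] {X : Scheme.{u}} [X.Over (Spec (.of k))] (t : FlatThickening k X)

instance isClosedImmersion_incl : IsClosedImmersion t.incl :=
  MorphismProperty.of_isPullback (P := @IsClosedImmersion) t.isPullback.flip
    (IsClosedImmersion.spec_of_surjective _ fun c => ⟨TrivSqZeroExt.inl c, rfl⟩)

/-- The map `k[ε] → k` is surjective with square-zero kernel, so it induces a homeomorphism of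
spectra, and surjectivity is stable under base change. Since `t.incl` is also a closed immersion,
`X` and the thickening have the same underlying space. -/
instance surjective_incl : Surjective t.incl := by
  refine MorphismProperty.of_isPullback (P := @Surjective) t.isPullback.flip ⟨?_⟩
  refine (PrimeSpectrum.isHomeomorph_comap
    (TrivSqZeroExt.fstHom k k k : k[ε] →ₐ[k] k).toRingHom (fun c => ⟨1, one_pos, ?_⟩)
    fun x hx => ?_).surjective
  · exact ⟨TrivSqZeroExt.inl c, by simp⟩
  · refine ⟨2, ?_⟩
    have : x.fst = 0 := hx
    ext <;> simp [pow_two, this]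

/-- The homeomorphism underlying the inclusion of the closed fibre. -/
noncomputable def homeo : X ≃ₜ t.total :=
  t.incl.isClosedEmbedding.isEmbedding.toHomeomorphOfSurjective t.incl.surjective

@[simp] theorem homeo_apply (x : X) : t.homeo x = t.incl x := rfl

/-- The open set of the thickening with a given closed fibre. -/
def opn (W : X.Opens) : t.total.Opens :=
  ⟨t.homeo.symm ⁻¹' W, W.2.preimage t.homeo.symm.continuous⟩

@[simp] theorem incl_preimage_opn (W : X.Opens) : t.incl ⁻¹ᵁ t.opn W = W := by
  ext x
  change t.homeo.symm (t.homeo x) ∈ W ↔ _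
  rw [Homeomorph.symm_apply_apply]; rfl

@[simp] theorem opn_incl_preimage (V : t.total.Opens) : t.opn (t.incl ⁻¹ᵁ V) = V := by
  ext x
  change t.homeo (t.homeo.symm x) ∈ V ↔ _
  rw [Homeomorph.apply_symm_apply]; rfl

theorem opn_mono {W W' : X.Opens} (h : W ≤ W') : t.opn W ≤ t.opn W' := fun _ hx => h hx

theorem incl_preimage_le_iff {V V' : t.total.Opens} :
    t.incl ⁻¹ᵁ V ≤ t.incl ⁻¹ᵁ V' ↔ V ≤ V' := by
  refine ⟨fun h => ?_, fun h => Scheme.Hom.preimage_mono _ h⟩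
  rw [← t.opn_incl_preimage V, ← t.opn_incl_preimage V']
  exact t.opn_mono h

/-- Reduction modulo `ε`. -/
noncomputable def red (V : t.total.Opens) : Γ(t.total, V) →+* Γ(X, t.incl ⁻¹ᵁ V) :=
  (t.incl.app V).hom

theorem red_algebraMap (V : t.total.Opens) (c : k[ε]) :
    t.red V (algebraMap k[ε] _ c) = algebraMap k _ c.fst := by
  have h := appLE_algebraMap t.incl _ t.isPullback.w (V := V) (U := t.incl ⁻¹ᵁ V) le_rfl c
  rw [Scheme.Hom.appLE_eq_app] at h
  exact h

theorem red_smul (V : t.total.Opens) (c : k[ε]) (x : Γ(t.total, V)) :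
    t.red V (c • x) = c.fst • t.red V x := by
  rw [Algebra.smul_def, Algebra.smul_def, map_mul, red_algebraMap]

theorem res_red {V V' : t.total.Opens} (h : V' ≤ V) (x : Γ(t.total, V)) :
    resHom k (t.incl.preimage_mono h) (t.red V x) = t.red V' (resHom k[ε] h x) :=
  (ConcreteCategory.congr_hom (t.incl.naturality (homOfLE h).op) x).symm

theorem red_surjective_of_isAffineOpen {V : t.total.Opens} (hV : IsAffineOpen V) :
    Function.Surjective (t.red V) := t.incl.app_surjective V hV

/-- The closed subscheme of `V` cut out by `ε` lies over `Spec k`, so the pullback property factors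
it through `X`. A function that vanishes on `X` therefore vanishes modulo `ε`. -/
theorem exists_eq_eps_smul_of_red_eq_zero {V : t.total.Opens} (hV : IsAffineOpen V)
    (x : Γ(t.total, V)) (hx : t.red V x = 0) : ∃ y, x = (ε : k[ε]) • y := by
  let J : Ideal Γ(t.total, V) := Ideal.span {algebraMap k[ε] _ ε}
  let Q : CommRingCat.{u} := .of (Γ(t.total, V) ⧸ J)
  let q : Γ(t.total, V) ⟶ Q := CommRingCat.ofHom (Ideal.Quotient.mk J)
  let g : Spec Q ⟶ t.total := Spec.map q ≫ hV.fromSpec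
  -- Modulo `ε` a dual number equals its constant term, so the structure morphism of `Spec Q`
  -- factors through `Spec k` by means of `κ`.
  let κ : CommRingCat.of k ⟶ Q := CommRingCat.ofHom
    ((Ideal.Quotient.mk J).comp ((algebraMap k[ε] Γ(t.total, V)).comp
      (TrivSqZeroExt.inlHom k k)))
  have hg : g ≫ (t.total ↘ Spec (.of k[ε])) = Spec.map κ ≫ Spec.map (CommRingCat.ofHom
      (TrivSqZeroExt.fstHom k k k : k[ε] →ₐ[k] k).toRingHom) := by
    rw [Category.assoc, fromSpec_comp_over, ← Spec.map_comp, ← Spec.map_comp]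
    refine congrArg Spec.map (CommRingCat.hom_ext (RingHom.ext fun c : k[ε] => ?_))
    change Ideal.Quotient.mk J (algebraMap k[ε] _ c) =
      Ideal.Quotient.mk J (algebraMap k[ε] _ (TrivSqZeroExt.inl c.fst))
    rw [Ideal.Quotient.eq, ← map_sub]
    have : c - TrivSqZeroExt.inl c.fst = ε * TrivSqZeroExt.inl c.snd := by ext <;> simp
    rw [this, map_mul]
    exact Ideal.mul_mem_right _ _ (Ideal.subset_span rfl)
  let u := t.isPullback.lift g (Spec.map κ) hg
  have hu : u ≫ t.incl = g := t.isPullback.lift_fst _ _ _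
  have htop : (⊤ : (Spec Γ(t.total, V)).Opens) ≤ hV.fromSpec ⁻¹ᵁ V :=
    hV.fromSpec_preimage_self.ge
  have hu' : (⊤ : (Spec Q).Opens) ≤ (u ≫ t.incl) ⁻¹ᵁ V := by
    rw [hu]; exact fun z _ => htop (x := Spec.map q z) trivial
  have h1 : (u ≫ t.incl).appLE V ⊤ hu' = q ≫ (Scheme.ΓSpecIso Q).inv := by
    have : ∀ (g' : Spec Q ⟶ t.total) (e : ⊤ ≤ g' ⁻¹ᵁ V), g' = g →
        g'.appLE V ⊤ e = q ≫ (Scheme.ΓSpecIso Q).inv := by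
      rintro g' e rfl
      rw [← Scheme.Hom.appLE_comp_appLE (Spec.map q) hV.fromSpec V ⊤ ⊤ htop le_top,
        fromSpec_appLE_self, Scheme.ΓSpecIso_inv_naturality]
      exact congrArg _ (Scheme.Hom.appLE_eq_app _)
    exact this _ _ hu
  have h2 : (u ≫ t.incl).appLE V ⊤ hu' x = 0 := by
    rw [Scheme.Hom.comp_appLE]
    exact (congrArg (u.appLE (t.incl ⁻¹ᵁ V) ⊤ hu').hom hx).trans (map_zero _)
  rw [h1] at h2
  have h3 : q.hom x = 0 :=
    (ConcreteCategory.bijective_of_isIso (Scheme.ΓSpecIso Q).inv).1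
      (h2.trans (map_zero (Scheme.ΓSpecIso Q).inv.hom).symm)
  obtain ⟨y, hy⟩ := Ideal.mem_span_singleton.1 (Ideal.Quotient.eq_zero_iff_mem.1 h3)
  exact ⟨y, by rw [Algebra.smul_def, hy]⟩

/-- Affine open subsets of an open set. -/
theorem le_iSup_affine {Y : Scheme.{u}} (V : Y.Opens) :
    V ≤ ⨆ W : {W : Y.affineOpens // W.1 ≤ V}, W.1.1 := fun x hx => by
  obtain ⟨W, hW, hxW, hWV⟩ := Opens.isBasis_iff_nbhd.1 Y.isBasis_affineOpens hx
  exact Opens.mem_iSup.2 ⟨⟨⟨W, hW⟩, hWV⟩, hxW⟩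

/-- Flatness enters here: on an affine open set the annihilator of `ε` consists of multiples of `ε`,
and so does the kernel of reduction. The general case is local. -/
theorem eps_smul_eq_zero_iff {V : t.total.Opens} (x : Γ(t.total, V)) :
    (ε : k[ε]) • x = 0 ↔ t.red V x = 0 := by
  constructor
  · intro h
    refine resHom_ext k (fun W : {W : t.total.affineOpens // W.1 ≤ V} => t.incl ⁻¹ᵁ W.1.1)
      (fun W => t.incl.preimage_mono W.2) ?_ _ _ fun W => ?_
    · rw [← Scheme.Hom.preimage_iSup]
      exact t.incl.preimage_mono (le_iSup_affine V)
    · rw [t.res_red W.2, map_zero]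
      have := flat_algebraMap (R := k[ε]) W.1.2
      obtain ⟨y, hy⟩ := exists_eq_eps_smul_of_flat (k := k) (resHom k[ε] W.2 x)
        (by rw [← map_smul, h, map_zero])
      rw [hy, red_smul, DualNumber.fst_eps, zero_smul]
  · intro h
    refine resHom_ext k[ε] (fun W : {W : t.total.affineOpens // W.1 ≤ V} => W.1.1)
      (fun W => W.2) (le_iSup_affine V) _ _ fun W => ?_
    obtain ⟨y, hy⟩ := t.exists_eq_eps_smul_of_red_eq_zero W.1.2 (resHom k[ε] W.2 x)
      (by rw [← t.res_red W.2, h, map_zero])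
    rw [map_smul, map_zero, hy]
    exact eps_smul_eps_smul (k := k) y

theorem eps_smul_eq_iff {V : t.total.Opens} (x y : Γ(t.total, V)) :
    (ε : k[ε]) • x = (ε : k[ε]) • y ↔ t.red V x = t.red V y := by
  rw [← sub_eq_zero, ← sub_eq_zero (a := t.red V x), ← map_sub, ← eps_smul_eq_zero_iff]
  exact Eq.congr_left (smul_sub (ε : k[ε]) x y).symm

end FlatThickening

/-! ### The ideal `ε 𝒪` of a thickening as a copy of `𝒪_X`, and splittings. -/

namespace FlatThickening

variable {k : Type u} [Field k] {X : Scheme.{u}} [X.Over (Spec (.of k))] (t : FlatThickening k X)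

theorem opn_iSup {ι : Type*} (W : ι → X.Opens) : t.opn (⨆ i, W i) = ⨆ i, t.opn (W i) := by
  refine le_antisymm ?_ (iSup_le fun i => t.opn_mono (le_iSup W i))
  rw [← t.incl_preimage_le_iff, incl_preimage_opn, Scheme.Hom.preimage_iSup]
  exact iSup_mono fun i => (t.incl_preimage_opn _).ge

/-- Sections of the thickening over an open subset of `X` that agree locally are equal. -/
theorem res_ext {ι : Type*} {W : X.Opens} (U : ι → X.Opens) (hU : ∀ i, U i ≤ W)
    (hW : W ≤ iSup U) (x y : Γ(t.total, t.opn W))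
    (h : ∀ i, resHom k[ε] (t.opn_mono (hU i)) x = resHom k[ε] (t.opn_mono (hU i)) y) : x = y :=
  resHom_ext k[ε] (fun i => t.opn (U i)) (fun i => t.opn_mono (hU i))
    ((t.opn_mono hW).trans (t.opn_iSup U).le) x y h

/-- Gluing of sections of the thickening over open subsets of `X`. -/
theorem res_glue {ι : Type*} {W : X.Opens} (U : ι → X.Opens) (hU : ∀ i, U i ≤ W)
    (hW : W ≤ iSup U) (x : ∀ i, Γ(t.total, t.opn (U i)))
    (hx : ∀ i j, resHom k[ε] (t.opn_mono (inf_le_left : U i ⊓ U j ≤ U i)) (x i) =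
      resHom k[ε] (t.opn_mono (inf_le_right : U i ⊓ U j ≤ U j)) (x j)) :
    ∃ y : Γ(t.total, t.opn W), ∀ i, resHom k[ε] (t.opn_mono (hU i)) y = x i :=
  resHom_glue k[ε] (fun i => t.opn (U i)) (fun i => t.opn_mono (hU i))
    ((t.opn_mono hW).trans (t.opn_iSup U).le) x hx

/-- Reduction modulo `ε`, as a map to the sections over an open subset of `X`. -/
noncomputable def proj (W : X.Opens) : Γ(t.total, t.opn W) →+* Γ(X, W) :=
  (t.incl.appLE (t.opn W) W (t.incl_preimage_opn W).ge).hom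

theorem proj_eq (W : X.Opens) (x : Γ(t.total, t.opn W)) :
    t.proj W x = resHom k (t.incl_preimage_opn W).ge (t.red _ x) := rfl

theorem le_of_opn_le {W W' : X.Opens} (h : t.opn W' ≤ t.opn W) : W' ≤ W := by
  rw [← t.incl_preimage_opn W, ← t.incl_preimage_opn W']
  exact t.incl.preimage_mono h

theorem proj_res {W W' : X.Opens} (h : t.opn W' ≤ t.opn W) (x : Γ(t.total, t.opn W)) :
    t.proj W' (resHom k[ε] h x) = resHom k (t.le_of_opn_le h) (t.proj W x) := by
  rw [proj_eq, proj_eq, ← t.res_red, resHom_resHom, resHom_resHom]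

theorem proj_algebraMap (W : X.Opens) (c : k[ε]) :
    t.proj W (algebraMap k[ε] _ c) = algebraMap k _ c.fst := by
  rw [proj_eq, red_algebraMap, AlgHom.commutes]

theorem proj_smul (W : X.Opens) (c : k[ε]) (x : Γ(t.total, t.opn W)) :
    t.proj W (c • x) = c.fst • t.proj W x := by
  rw [Algebra.smul_def, Algebra.smul_def, map_mul, proj_algebraMap]

theorem proj_eq_zero_iff {W : X.Opens} (x : Γ(t.total, t.opn W)) :
    t.proj W x = 0 ↔ t.red _ x = 0 := by
  refine ⟨fun h => ?_, fun h => by rw [proj_eq, h, map_zero]⟩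
  have := congrArg (resHom k (t.incl_preimage_opn W).le) h
  rwa [proj_eq, resHom_resHom, resHom_refl, map_zero] at this

theorem eps_smul_eq_iff_proj {W : X.Opens} (x y : Γ(t.total, t.opn W)) :
    (ε : k[ε]) • x = (ε : k[ε]) • y ↔ t.proj W x = t.proj W y := by
  rw [eps_smul_eq_iff, ← sub_eq_zero, ← map_sub, ← proj_eq_zero_iff, map_sub, sub_eq_zero]

/-- The open subsets of `W` whose thickening is affine. -/
def AffineIn (W : X.Opens) : Type u :=
  {W' : X.Opens // W' ≤ W ∧ IsAffineOpen (t.opn W')}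

theorem le_iSup_affineIn (W : X.Opens) : W ≤ ⨆ i : t.AffineIn W, i.1 := fun x hx => by
  have hx' : t.incl x ∈ t.opn W := by
    have : x ∈ t.incl ⁻¹ᵁ t.opn W := by rwa [incl_preimage_opn]
    exact this
  obtain ⟨V, hV, hxV, hVW⟩ := Opens.isBasis_iff_nbhd.1 t.total.isBasis_affineOpens hx'
  refine Opens.mem_iSup.2 ⟨⟨t.incl ⁻¹ᵁ V, ?_, by rwa [opn_incl_preimage]⟩, hxV⟩
  exact (t.incl.preimage_mono hVW).trans (t.incl_preimage_opn W).le

theorem proj_surjective {W : X.Opens} (hW : IsAffineOpen (t.opn W)) :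
    Function.Surjective (t.proj W) := fun g => by
  obtain ⟨x, hx⟩ := t.red_surjective_of_isAffineOpen hW (resHom k (t.incl_preimage_opn W).le g)
  exact ⟨x, by rw [proj_eq, hx, resHom_resHom, resHom_refl]⟩

/-- A function need not lift over all of `W`, but `ε` times a lift depends only on the function.
These products, formed on open sets with affine thickening, agree on overlaps and glue. -/
theorem exists_infl {W : X.Opens} (g : Γ(X, W)) : ∃ y : Γ(t.total, t.opn W),
    ∀ (W' : X.Opens) (h : W' ≤ W) (x : Γ(t.total, t.opn W')), t.proj W' x = resHom k h g →
      resHom k[ε] (t.opn_mono h) y = (ε : k[ε]) • x := by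
  choose x hx using fun i : t.AffineIn W => t.proj_surjective i.2.2 (resHom k i.2.1 g)
  obtain ⟨y, hy⟩ := t.res_glue (fun i : t.AffineIn W => i.1) (fun i => i.2.1)
    (t.le_iSup_affineIn W) (fun i => (ε : k[ε]) • x i) fun i j => by
      rw [map_smul, map_smul, eps_smul_eq_iff_proj, proj_res, proj_res, hx, hx,
        resHom_resHom, resHom_resHom]
  refine ⟨y, fun W' h z hz => ?_⟩
  -- The thickening of `W'` need not be affine, so the comparison takes place on its intersections
  -- with the cover of `W`.
  refine t.res_ext (fun i : t.AffineIn W => i.1 ⊓ W') (fun i => inf_le_right) ?_ _ _ fun i => ?_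
  · rw [← iSup_inf_eq]
    exact le_inf (h.trans (t.le_iSup_affineIn W)) le_rfl
  · have h1 := congrArg (resHom k[ε] (t.opn_mono (inf_le_left : i.1 ⊓ W' ≤ i.1))) (hy i)
    rw [resHom_resHom] at h1
    rw [resHom_resHom, h1, map_smul, map_smul, eps_smul_eq_iff_proj, proj_res, proj_res, hx,
      hz, resHom_resHom, resHom_resHom]

/-- The isomorphism of `𝒪_X` with the ideal sheaf `ε 𝒪` of the thickening, as a function. -/
noncomputable def inflFun {W : X.Opens} (g : Γ(X, W)) : Γ(t.total, t.opn W) :=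
  (t.exists_infl g).choose

theorem res_inflFun {W W' : X.Opens} (h : W' ≤ W) (g : Γ(X, W)) (x : Γ(t.total, t.opn W'))
    (hx : t.proj W' x = resHom k h g) :
    resHom k[ε] (t.opn_mono h) (t.inflFun g) = (ε : k[ε]) • x :=
  (t.exists_infl g).choose_spec W' h x hx

theorem exists_local_lift {W : X.Opens} (g : Γ(X, W)) (i : t.AffineIn W) :
    ∃ x : Γ(t.total, t.opn i.1), t.proj i.1 x = resHom k i.2.1 g ∧
      resHom k[ε] (t.opn_mono i.2.1) (t.inflFun g) = (ε : k[ε]) • x := by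
  obtain ⟨x, hx⟩ := t.proj_surjective i.2.2 (resHom k i.2.1 g)
  exact ⟨x, hx, t.res_inflFun _ _ _ hx⟩

/-- The isomorphism of `𝒪_X` with the ideal sheaf `ε 𝒪` of the thickening. -/
noncomputable def infl (W : X.Opens) : Γ(X, W) →+ Γ(t.total, t.opn W) :=
  AddMonoidHom.mk' t.inflFun fun f g =>
    t.res_ext (fun i : t.AffineIn W => i.1) (fun i => i.2.1) (t.le_iSup_affineIn W) _ _ fun i => by
      obtain ⟨x, hx, hx'⟩ := t.exists_local_lift f i
      obtain ⟨y, hy, hy'⟩ := t.exists_local_lift g i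
      rw [map_add, hx', hy', t.res_inflFun i.2.1 _ (x + y) (by rw [map_add, map_add, hx, hy])]
      exact smul_add (ε : k[ε]) x y

theorem infl_proj {W : X.Opens} (x : Γ(t.total, t.opn W)) :
    t.infl W (t.proj W x) = (ε : k[ε]) • x := by
  have := t.res_inflFun le_rfl (t.proj W x) x (resHom_refl k _ _).symm
  rwa [resHom_refl] at this

theorem res_infl {W W' : X.Opens} (h : t.opn W' ≤ t.opn W) (g : Γ(X, W)) :
    resHom k[ε] h (t.infl W g) = t.infl W' (resHom k (t.le_of_opn_le h) g) :=
  t.res_ext (fun i : t.AffineIn W' => i.1) (fun i => i.2.1) (t.le_iSup_affineIn W') _ _ fun i => by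
    obtain ⟨x, hx, hx'⟩ := t.exists_local_lift (resHom k (t.le_of_opn_le h) g) i
    rw [resHom_resHom]
    refine (t.res_inflFun (i.2.1.trans (t.le_of_opn_le h)) g x ?_).trans hx'.symm
    rw [hx, resHom_resHom]

/-- Induction principle: an identity of sections that depend on `g` can be checked locally, where `g`
lifts to the thickening. -/
theorem exists_cover_lift {W : X.Opens} (g : Γ(X, W)) : ∃ (ι : Type u) (U : ι → X.Opens)
    (hU : ∀ i, U i ≤ W), W ≤ iSup U ∧
      ∀ i, ∃ x : Γ(t.total, t.opn (U i)), t.proj (U i) x = resHom k (hU i) g := by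
  refine ⟨t.AffineIn W, fun i => i.1, fun i => i.2.1, t.le_iSup_affineIn W, fun i => ?_⟩
  obtain ⟨x, hx, -⟩ := t.exists_local_lift g i
  exact ⟨x, hx⟩

theorem proj_infl {W : X.Opens} (g : Γ(X, W)) : t.proj W (t.infl W g) = 0 := by
  obtain ⟨ι, U, hU, hW, h⟩ := t.exists_cover_lift g
  refine resHom_ext k U hU hW _ _ fun i => ?_
  obtain ⟨x, hx⟩ := h i
  rw [← t.proj_res (t.opn_mono (hU i)), res_infl, ← hx, infl_proj, proj_smul, DualNumber.fst_eps, zero_smul, map_zero]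

theorem infl_injective (W : X.Opens) : Function.Injective (t.infl W) := by
  refine (injective_iff_map_eq_zero _).2 fun g hg => ?_
  obtain ⟨ι, U, hU, hW, h⟩ := t.exists_cover_lift g
  refine resHom_ext k U hU hW _ _ fun i => ?_
  obtain ⟨x, hx⟩ := h i
  have h1 := congrArg (resHom k[ε] (t.opn_mono (hU i))) hg
  rw [res_infl, ← hx, infl_proj, map_zero] at h1
  rw [← hx, map_zero]
  have h2 := (t.eps_smul_eq_iff_proj x 0).1 (h1.trans (smul_zero (A := Γ(t.total, t.opn (U i))) (ε : k[ε])).symm)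
  rwa [map_zero] at h2

/-- Locally `x * (ε y) = ε (x y)`. The ideal is thus a module over `𝒪_X` by way of reduction, and in
particular has square zero. -/
theorem mul_infl {W : X.Opens} (x : Γ(t.total, t.opn W)) (g : Γ(X, W)) :
    x * t.infl W g = t.infl W (t.proj W x * g) := by
  obtain ⟨ι, U, hU, hW, h⟩ := t.exists_cover_lift g
  refine t.res_ext U hU hW _ _ fun i => ?_
  obtain ⟨y, hy⟩ := h i
  rw [map_mul, res_infl, res_infl, map_mul, ← hy, ← proj_res, ← map_mul, infl_proj, infl_proj,
    mul_smul_comm]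

theorem infl_mul_infl {W : X.Opens} (f g : Γ(X, W)) : t.infl W f * t.infl W g = 0 := by
  rw [mul_infl, proj_infl, zero_mul, map_zero]

theorem smul_infl {W : X.Opens} (c : k[ε]) (g : Γ(X, W)) :
    c • t.infl W g = t.infl W (c.fst • g) := by
  rw [Algebra.smul_def, mul_infl, proj_algebraMap, ← Algebra.smul_def]

/-- Exactness of `0 → 𝒪_X → 𝒪 → 𝒪_X` in the middle, on sections over any open set: preimages exist
on a cover, and they glue because `infl` is injective. -/
theorem exists_eq_infl {W : X.Opens} (x : Γ(t.total, t.opn W)) (hx : t.proj W x = 0) :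
    ∃ g, x = t.infl W g := by
  have h1 : ∀ i : t.AffineIn W, ∃ g : Γ(X, i.1), resHom k[ε] (t.opn_mono i.2.1) x =
      t.infl i.1 g := fun i => by
    obtain ⟨y, hy⟩ := t.exists_eq_eps_smul_of_red_eq_zero i.2.2 (resHom k[ε] (t.opn_mono i.2.1) x)
      (by rw [← proj_eq_zero_iff, proj_res, hx, map_zero])
    exact ⟨t.proj _ y, by rw [infl_proj, hy]⟩
  choose g hg using h1
  obtain ⟨G, hG⟩ := resHom_glue k (fun i : t.AffineIn W => i.1) (fun i => i.2.1)
    (t.le_iSup_affineIn W) g fun i j => by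
      refine t.infl_injective _ ?_
      rw [← t.res_infl (t.opn_mono inf_le_left), ← t.res_infl (t.opn_mono inf_le_right), ← hg,
        ← hg, resHom_resHom, resHom_resHom]
  refine ⟨G, t.res_ext (fun i : t.AffineIn W => i.1) (fun i => i.2.1)
    (t.le_iSup_affineIn W) _ _ fun i => ?_⟩
  rw [hg, res_infl, hG]

/-- A splitting over `U ⊆ X` of the reduction map, that is a trivialization of the thickening. -/
structure Splitting (U : X.Opens) where
  s : ∀ W : X.Opens, W ≤ U → (Γ(X, W) →+* Γ(t.total, t.opn W))
  s_algebraMap : ∀ (W : X.Opens) (h : W ≤ U) (c : k),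
    s W h (algebraMap k _ c) = algebraMap k[ε] _ (TrivSqZeroExt.inl c)
  res_s : ∀ (W W' : X.Opens) (h : W ≤ U) (h' : W' ≤ W) (f : Γ(X, W)),
    resHom k[ε] (t.opn_mono h') (s W h f) = s W' (h'.trans h) (resHom k h' f)
  proj_s : ∀ (W : X.Opens) (h : W ≤ U) (f : Γ(X, W)), t.proj W (s W h f) = f

namespace Splitting

variable {t} {U U' : X.Opens} (S : t.Splitting U) (S' : t.Splitting U')

theorem s_smul {W : X.Opens} (h : W ≤ U) (c : k) (f : Γ(X, W)) :
    S.s W h (c • f) = (TrivSqZeroExt.inl c : k[ε]) • S.s W h f := by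
  rw [Algebra.smul_def, map_mul, s_algebraMap, Algebra.smul_def]

theorem infl_eq {W : X.Opens} (h : W ≤ U) (g : Γ(X, W)) :
    t.infl W g = (ε : k[ε]) • S.s W h g := by
  rw [← infl_proj, S.proj_s]

theorem exists_eq_add {W : X.Opens} (h : W ≤ U) (x : Γ(t.total, t.opn W)) :
    ∃ g, x = S.s W h (t.proj W x) + t.infl W g := by
  obtain ⟨g, hg⟩ := t.exists_eq_infl (x - S.s W h (t.proj W x)) (by rw [map_sub, S.proj_s, sub_self])
  exact ⟨g, by rw [← hg, add_sub_cancel]⟩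

end Splitting

end FlatThickening

/-! ### Existence of splittings from smoothness. -/

theorem appLE_congr_hom {X Y : Scheme.{u}} {f g : X ⟶ Y} (h : f = g) {V : Y.Opens} {U : X.Opens}
    (e : U ≤ f ⁻¹ᵁ V) (e' : U ≤ g ⁻¹ᵁ V) : f.appLE V U e = g.appLE V U e' := by
  subst h; rfl

theorem formallySmooth_algebraMap {R : Type u} [CommRing R] {X : Scheme.{u}} [X.Over (Spec (.of R))]
    [Smooth (X ↘ Spec (.of R))] {U : X.Opens} (hU : IsAffineOpen U) :
    Algebra.FormallySmooth R Γ(X, U) := by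
  have h : Smooth (hU.fromSpec ≫ (X ↘ Spec (.of R))) := inferInstance
  rw [fromSpec_comp_over, HasRingHomProperty.Spec_iff (P := @Smooth)] at h
  exact (RingHom.formallySmooth_algebraMap).1 h.formallySmooth

namespace FlatThickening

variable {k : Type u} [Field k] {X : Scheme.{u}} [X.Over (Spec (.of k))] (t : FlatThickening k X)

/-- Formal smoothness lifts the identity of `Γ(X, ·)` through the reduction map, which over an
affine open set is surjective with square-zero kernel. -/
theorem exists_ringHom_section [Smooth (X ↘ Spec (.of k))] {V : t.total.Opens}
    (hV : IsAffineOpen V) : ∃ σ : Γ(X, t.incl ⁻¹ᵁ V) →+* Γ(t.total, V),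
      (∀ f, t.red V (σ f) = f) ∧ ∀ c : k, σ (algebraMap k _ c) =
        algebraMap k[ε] _ (TrivSqZeroExt.inl c) := by
  let _ : Algebra k Γ(t.total, V) :=
    ((algebraMap k[ε] Γ(t.total, V)).comp (TrivSqZeroExt.inlHom k k)).toAlgebra
  have := formallySmooth_algebraMap (R := k) (hV.preimage t.incl)
  let r : Γ(t.total, V) →ₐ[k] Γ(X, t.incl ⁻¹ᵁ V) :=
    { t.red V with commutes' := fun c => t.red_algebraMap V _ }
  have hr : IsNilpotent (RingHom.ker (r : Γ(t.total, V) →+* Γ(X, t.incl ⁻¹ᵁ V))) := by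
    refine ⟨2, ?_⟩
    rw [pow_two, Ideal.zero_eq_bot, eq_bot_iff, Ideal.mul_le]
    intro x hx y hy
    obtain ⟨x', rfl⟩ := t.exists_eq_eps_smul_of_red_eq_zero hV x hx
    rw [Ideal.mem_bot, smul_mul_assoc]
    refine (t.eps_smul_eq_zero_iff _).2 ?_
    rw [map_mul, show t.red V y = 0 from hy, mul_zero]
  let σ := Algebra.FormallySmooth.liftOfSurjective (AlgHom.id k _) r
    (t.red_surjective_of_isAffineOpen hV) hr
  exact ⟨σ, fun f => Algebra.FormallySmooth.liftOfSurjective_apply (AlgHom.id k _) r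
    (t.red_surjective_of_isAffineOpen hV) hr f, fun c => σ.commutes c⟩

/-- A ring section `σ` over the affine `V` is a morphism `r` from `Spec Γ(t.total, V)` to `X` that
retracts the closed fibre. On points it inverts `t.incl`, so pullback of functions along `r` gives
compatible splittings over all open subsets of `U`, not only over `U`. -/
theorem exists_splitting [Smooth (X ↘ Spec (.of k))] {U : X.Opens} (hU : IsAffineOpen (t.opn U)) :
    Nonempty (t.Splitting U) := by
  obtain ⟨V, rfl⟩ : ∃ V, U = t.incl ⁻¹ᵁ V := ⟨_, (t.incl_preimage_opn U).symm⟩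
  rw [opn_incl_preimage] at hU
  obtain ⟨σ, hσ, hσk⟩ := t.exists_ringHom_section hU
  have hU' := hU.preimage t.incl
  let B := Γ(t.total, V)
  let A := Γ(X, t.incl ⁻¹ᵁ V)
  let σ' : A ⟶ B := CommRingCat.ofHom σ
  let r : Spec B ⟶ X := Spec.map σ' ≫ hU'.fromSpec
  have hle : ∀ W : X.Opens, W ≤ t.incl ⁻¹ᵁ V → t.opn W ≤ V := fun W h => by
    rw [← t.opn_incl_preimage V]; exact t.opn_mono h
  have hincl : Spec.map (t.incl.app V) ≫ hU.fromSpec = hU'.fromSpec ≫ t.incl := by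
    rw [← Scheme.Hom.appLE_eq_app]
    exact IsAffineOpen.SpecMap_appLE_fromSpec _ _ _ _
  have hid : Spec.map (t.incl.app V) ≫ r = hU'.fromSpec := by
    have : σ' ≫ t.incl.app V = 𝟙 _ := CommRingCat.hom_ext (RingHom.ext hσ)
    rw [← Category.assoc, ← Spec.map_comp, this, Spec.map_id, Category.id_comp]
  -- Every point of `Spec B` comes from the closed fibre, on which `r` is the inclusion in `X`.
  have hz : ∀ z : Spec B, ∃ x, hU.fromSpec z = t.incl x ∧ r z = x := fun z => by
    have hzV : hU.fromSpec z ∈ V := hU.range_fromSpec.le ⟨z, rfl⟩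
    obtain ⟨x, hx⟩ := t.incl.surjective (hU.fromSpec z)
    have hxU : x ∈ t.incl ⁻¹ᵁ V := by change t.incl x ∈ V; rwa [hx]
    obtain ⟨w, rfl⟩ := hU'.range_fromSpec.ge hxU
    refine ⟨_, hx.symm, ?_⟩
    have hw : Spec.map (t.incl.app V) w = z :=
      hU.fromSpec.injective ((congrArg (fun g => g w) hincl).trans hx)
    rw [← hw]
    exact congrArg (fun g => g w) hid
  have hrW : ∀ W, hU.fromSpec ⁻¹ᵁ t.opn W = r ⁻¹ᵁ W := fun W => by
    ext z
    obtain ⟨x, hx, hx'⟩ := hz z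
    change hU.fromSpec z ∈ t.opn W ↔ r z ∈ W
    rw [hx, hx']
    exact iff_of_eq (congrArg (fun O : X.Opens => x ∈ O) (t.incl_preimage_opn W))
  have iso : ∀ W : X.Opens, W ≤ t.incl ⁻¹ᵁ V → IsIso (hU.fromSpec.app (t.opn W)) := fun W h =>
    Scheme.Hom.isIso_app _ _ ((hle W h).trans hU.opensRange_fromSpec.ge)
  have bij : ∀ W : X.Opens, W ≤ t.incl ⁻¹ᵁ V → Function.Bijective (hU.fromSpec.app (t.opn W)).hom :=
    fun W h => by have := iso W h; exact ConcreteCategory.bijective_of_isIso _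
  let s : ∀ W : X.Opens, W ≤ t.incl ⁻¹ᵁ V → (Γ(X, W) →+* Γ(t.total, t.opn W)) := fun W h =>
    ((RingEquiv.ofBijective _ (bij W h)).symm : _ →+* _).comp
      (r.appLE W (hU.fromSpec ⁻¹ᵁ t.opn W) (hrW W).le).hom
  have hs : ∀ W h f, (hU.fromSpec.app (t.opn W)).hom (s W h f) =
    (r.appLE W (hU.fromSpec ⁻¹ᵁ t.opn W) (hrW W).le).hom f := fun W h f =>
      (RingEquiv.ofBijective _ (bij W h)).apply_symm_apply _
  refine ⟨⟨s, ?_, ?_, ?_⟩⟩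
  · intro W h c
    let _ : (Spec B).Over (Spec (.of k[ε])) := ⟨hU.fromSpec ≫ (t.total ↘ Spec (.of k[ε]))⟩
    refine (bij W h).1 ((hs W h _).trans ?_)
    have h1 := appLE_algebraMap hU.fromSpec (RingHom.id k[ε])
      (by rw [CommRingCat.ofHom_id, Spec.map_id, Category.comp_id]; rfl)
      (le_refl (hU.fromSpec ⁻¹ᵁ t.opn W)) (TrivSqZeroExt.inl c)
    rw [Scheme.Hom.appLE_eq_app] at h1
    refine Eq.trans ?_ h1.symm
    refine appLE_algebraMap r (TrivSqZeroExt.inlHom k k) ?_ (hrW W).le c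
    change (Spec.map σ' ≫ hU'.fromSpec) ≫ _ = (hU.fromSpec ≫ (t.total ↘ Spec (.of k[ε]))) ≫ _
    rw [fromSpec_comp_over, Category.assoc, fromSpec_comp_over, ← Spec.map_comp, ← Spec.map_comp]
    exact congrArg Spec.map (CommRingCat.hom_ext (RingHom.ext hσk))
  · intro W W' h h' f
    refine (bij W' (h'.trans h)).1 ((?_ : _ = _).trans (hs W' (h'.trans h) _).symm)
    refine (ConcreteCategory.congr_hom (hU.fromSpec.naturality (homOfLE (t.opn_mono h')).op)
      (s W h f)).trans ?_
    refine (congrArg ((Spec B).presheaf.map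
      (homOfLE (hU.fromSpec.preimage_mono (t.opn_mono h'))).op).hom (hs W h f)).trans ?_
    have h1 : r.appLE W (hU.fromSpec ⁻¹ᵁ t.opn W) (hrW W).le ≫
        (Spec B).presheaf.map (homOfLE (hU.fromSpec.preimage_mono (t.opn_mono h'))).op =
        X.presheaf.map (homOfLE h').op ≫ r.appLE W' (hU.fromSpec ⁻¹ᵁ t.opn W') (hrW W').le := by
      rw [Scheme.Hom.appLE_map, Scheme.Hom.map_appLE]
    exact ConcreteCategory.congr_hom h1 f
  · intro W h f
    have : IsIso (hU'.fromSpec.app W) :=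
      Scheme.Hom.isIso_app _ _ (h.trans hU'.opensRange_fromSpec.ge)
    refine (ConcreteCategory.bijective_of_isIso (hU'.fromSpec.app W)).1 ?_
    have hle1 : hU'.fromSpec ⁻¹ᵁ W ≤ Spec.map (t.incl.app V) ⁻¹ᵁ (hU.fromSpec ⁻¹ᵁ t.opn W) := by
      rw [hrW]
      exact (congrArg (fun g : Spec A ⟶ X => g ⁻¹ᵁ W) hid).ge
    have h1 : t.incl.appLE (t.opn W) W (t.incl_preimage_opn W).ge ≫ hU'.fromSpec.app W =
        hU.fromSpec.app (t.opn W) ≫ (Spec.map (t.incl.app V)).appLE _ _ hle1 := by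
      rw [← Scheme.Hom.appLE_eq_app, ← Scheme.Hom.appLE_eq_app, Scheme.Hom.appLE_comp_appLE,
        Scheme.Hom.appLE_comp_appLE]
      exact appLE_congr_hom hincl.symm _ _
    have h2 : r.appLE W (hU.fromSpec ⁻¹ᵁ t.opn W) (hrW W).le ≫
        (Spec.map (t.incl.app V)).appLE _ _ hle1 = hU'.fromSpec.app W := by
      rw [Scheme.Hom.appLE_comp_appLE]
      exact (appLE_congr_hom hid _ le_rfl).trans (Scheme.Hom.appLE_eq_app _)
    refine (ConcreteCategory.congr_hom h1 (s W h f)).trans ?_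
    refine (congrArg ((Spec.map (t.incl.app V)).appLE _ _ hle1).hom (hs W h f)).trans ?_
    exact ConcreteCategory.congr_hom h2 f

end FlatThickening

/-! ### Polyvector fields from derivations and biderivations. -/

section Polyvector

variable {R : Type u} [CommRing R]

theorem exists_multiDer_one {A : Type v} [CommRing A] [Algebra R A] (D : A → A)
    (hadd : ∀ f g, D (f + g) = D f + D g) (hsmul : ∀ (c : R) f, D (c • f) = c • D f)
    (hmul : ∀ f g, D (f * g) = f * D g + g * D f) :
    ∃ P : multiDer R A 1, ∀ F, P.1 F = D (F 0) := by
  have h : PoissonBracket.IsAlt R 1 (fun F : Fin 1 → A => D (F 0)) :=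
    ⟨fun x y => funext fun F => hadd x y, fun r x => funext fun F => hsmul r x⟩
  obtain ⟨P, hP⟩ := h.exists_alternatingMap
  refine ⟨⟨P, fun F i x y => ?_⟩, fun F => congrFun hP F⟩
  obtain rfl : i = 0 := Subsingleton.elim _ _
  simp only [hP, Function.update_self]
  exact hmul x y

/-- Skew-symmetry carries linearity and the Leibniz rule from the first argument to the second. -/
theorem exists_multiDer_two {A : Type v} [CommRing A] [Algebra R A] (D : A → A → A)
    (hadd : ∀ f g h, D (f + g) h = D f h + D g h)
    (hsmul : ∀ (c : R) f h, D (c • f) h = c • D f h)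
    (hmul : ∀ f g h, D (f * g) h = f * D g h + g * D f h)
    (hself : ∀ f, D f f = 0) (hskew : ∀ f g, D f g = -D g f) :
    ∃ P : multiDer R A 2, ∀ F, P.1 F = D (F 0) (F 1) := by
  have h : PoissonBracket.IsAlt R 2 (fun F : Fin 2 → A => D (F 0) (F 1)) := by
    refine ⟨fun x => ⟨fun y z => funext fun F => ?_, fun r y => funext fun F => ?_⟩,
      ⟨fun x y => funext fun F => hadd x y _, fun r x => funext fun F => hsmul r x _⟩,
      fun x => funext fun F => hself x⟩
    · change D x (y + z) = D x y + D x z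
      rw [hskew, hadd, hskew x y, hskew x z, neg_add]
    · change D x (r • y) = r • D x y
      rw [hskew, hsmul, hskew x y, smul_neg]
  obtain ⟨P, hP⟩ := h.exists_alternatingMap
  refine ⟨⟨P, fun F i x y => ?_⟩, fun F => congrFun hP F⟩
  rw [PoissonBracket.update_eq_neg_one_pow, PoissonBracket.update_eq_neg_one_pow,
    PoissonBracket.update_eq_neg_one_pow, hP]
  have := hmul x y (i.removeNth F 0)
  change _ * D (x * y) (i.removeNth F 0) =
    x * (_ * D y (i.removeNth F 0)) + y * (_ * D x (i.removeNth F 0))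
  rw [this]; ring

variable {X : Scheme.{u}} [X.Over (Spec (.of R))] {U : X.Opens}

namespace PolyvectorField

theorem exists_of_derivation (D : ∀ W : X.Opens, W ≤ U → Γ(X, W) → Γ(X, W))
    (hadd : ∀ W h f g, D W h (f + g) = D W h f + D W h g)
    (hsmul : ∀ W h (c : R) f, D W h (c • f) = c • D W h f)
    (hmul : ∀ W h f g, D W h (f * g) = f * D W h g + g * D W h f)
    (hres : ∀ W W' (h : W ≤ U) (h' : W' ≤ W) f, resHom R h' (D W h f) =
      D W' (h'.trans h) (resHom R h' f)) :
    ∃ P : PolyvectorField R X 1 U, ∀ W h f, P.eval h ![f] = D W h f := by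
  choose P hP using fun W : {W : X.Opens // W ≤ U} =>
    exists_multiDer_one (R := R) (D W.1 W.2) (hadd _ _) (hsmul _ _) (hmul _ _)
  refine ⟨⟨P, fun V W h F => ?_⟩, fun W h f => hP ⟨W, h⟩ _⟩
  rw [hP, hP, hres _ _ V.2]

theorem exists_of_biderivation (D : ∀ W : X.Opens, W ≤ U → Γ(X, W) → Γ(X, W) → Γ(X, W))
    (hadd : ∀ W h f g e, D W h (f + g) e = D W h f e + D W h g e)
    (hsmul : ∀ W h (c : R) f e, D W h (c • f) e = c • D W h f e)
    (hmul : ∀ W h f g e, D W h (f * g) e = f * D W h g e + g * D W h f e)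
    (hself : ∀ W h f, D W h f f = 0) (hskew : ∀ W h f g, D W h f g = -D W h g f)
    (hres : ∀ W W' (h : W ≤ U) (h' : W' ≤ W) f g, resHom R h' (D W h f g) =
      D W' (h'.trans h) (resHom R h' f) (resHom R h' g)) :
    ∃ P : PolyvectorField R X 2 U, ∀ W h f g, P.eval h ![f, g] = D W h f g := by
  choose P hP using fun W : {W : X.Opens // W ≤ U} =>
    exists_multiDer_two (R := R) (D W.1 W.2) (hadd _ _) (hsmul _ _) (hmul _ _) (hself _ _)
      (hskew _ _)
  refine ⟨⟨P, fun V W h F => ?_⟩, fun W h f g => hP ⟨W, h⟩ _⟩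
  rw [hP, hP, hres _ _ V.2]

theorem ext_one {P Q : PolyvectorField R X 1 U}
    (h : ∀ (V : X.Opens) (hV : V ≤ U) (f : Γ(X, V)), P.eval hV ![f] = Q.eval hV ![f]) : P = Q :=
  PolyvectorField.ext fun V hV F => by
    rw [show F = ![F 0] from funext fun i => by rw [Subsingleton.elim i 0]; rfl]
    exact h V hV _

theorem ext_two {P Q : PolyvectorField R X 2 U}
    (h : ∀ (V : X.Opens) (hV : V ≤ U) (f g : Γ(X, V)), P.eval hV ![f, g] = Q.eval hV ![f, g]) :
    P = Q :=
  PolyvectorField.ext fun V hV F => by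
    rw [show F = ![F 0, F 1] from List.ofFn_inj.1 rfl]
    exact h V hV _ _

end PolyvectorField

end Polyvector

/-! ### The deformed bracket on the ideal `ε 𝒪`. -/

namespace PoissonDeformation

variable {k : Type u} [Field k] {X : Scheme.{u}} [X.Over (Spec (.of k))] {Λ₀ : PoissonStructure k X}
  (ξ : FirstOrderPoissonDeformation Λ₀)

/-- The flat thickening underlying a first-order Poisson deformation. -/
abbrev thickening (ξ : FirstOrderPoissonDeformation Λ₀) : FlatThickening k X :=
  { total := ξ.total, flat := ξ.flat, incl := ξ.incl, isPullback := ξ.isPullback }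

theorem proj_bracket {W : X.Opens} (x y : Γ(ξ.thickening.total, ξ.thickening.opn W)) :
    ξ.thickening.proj W ((ξ.poisson.bracket _).br x y) =
      (Λ₀.bracket W).br (ξ.thickening.proj W x) (ξ.thickening.proj W y) :=
  ξ.incl_poisson.appLE _ x y

/-- Locally `infl f = ε y` with `y` a lift of `f`, and `{ε y, x} = ε {y, x}` by `k[ε]`-bilinearity,
where `{y, x}` reduces to the bracket of the reductions. -/
theorem bracket_infl_left {W : X.Opens} (f : Γ(X, W))
    (x : Γ(ξ.thickening.total, ξ.thickening.opn W)) :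
    (ξ.poisson.bracket _).br (ξ.thickening.infl W f) x =
      ξ.thickening.infl W ((Λ₀.bracket W).br f (ξ.thickening.proj W x)) := by
  obtain ⟨ι, U, hU, hW, h⟩ := ξ.thickening.exists_cover_lift f
  refine ξ.thickening.res_ext U hU hW _ _ fun i => ?_
  obtain ⟨y, hy⟩ := h i
  rw [ξ.poisson.res_bracket]
  rw [ξ.thickening.res_infl, ξ.thickening.res_infl, Λ₀.res_bracket, ← hy,
    ← ξ.thickening.proj_res (ξ.thickening.opn_mono (hU i)), ← proj_bracket,
    ξ.thickening.infl_proj, ξ.thickening.infl_proj]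
  exact LinearMap.map_smul₂ (ξ.poisson.bracket _).br (ε : k[ε]) y _

theorem bracket_infl_right {W : X.Opens} (x : Γ(ξ.thickening.total, ξ.thickening.opn W))
    (f : Γ(X, W)) : (ξ.poisson.bracket _).br x (ξ.thickening.infl W f) =
      ξ.thickening.infl W ((Λ₀.bracket W).br (ξ.thickening.proj W x) f) := by
  rw [PoissonBracket.skew, bracket_infl_left, ← map_neg, ← PoissonBracket.skew]

end PoissonDeformation

/-! ### Vector fields as differences of splittings. -/

namespace FlatThickening.Splitting

variable {k : Type u} [Field k] {X : Scheme.{u}} [X.Over (Spec (.of k))] {t : FlatThickening k X}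
  {U U' U'' : X.Opens} (S : t.Splitting U) (S' : t.Splitting U') (S'' : t.Splitting U'')

/-- The vector field `p` is the difference of two splittings: `S' = S + ε p`. -/
def IsTransition (p : PolyvectorField k X 1 (U ⊓ U')) : Prop :=
  ∀ (W : X.Opens) (h : W ≤ U ⊓ U') (f : Γ(X, W)),
    S'.s W (h.trans inf_le_right) f = S.s W (h.trans inf_le_left) f + t.infl W (p.eval h ![f])

/-- Two sections of the reduction differ by an element of the ideal `ε 𝒪`, and as both are ring
homomorphisms the difference is a derivation. -/
theorem exists_isTransition : ∃ p, S.IsTransition S' p := by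
  have hex : ∀ (W : X.Opens) (h : W ≤ U ⊓ U') (f : Γ(X, W)), ∃ g,
      S'.s W (h.trans inf_le_right) f = S.s W (h.trans inf_le_left) f + t.infl W g := fun W h f => by
    obtain ⟨g, hg⟩ := S.exists_eq_add (h.trans inf_le_left) (S'.s W (h.trans inf_le_right) f)
    exact ⟨g, by rwa [S'.proj_s] at hg⟩
  choose D hD using hex
  have hD' : ∀ W h f, t.infl W (D W h f) =
      S'.s W (h.trans inf_le_right) f - S.s W (h.trans inf_le_left) f := fun W h f => by
    rw [hD, add_sub_cancel_left]
  obtain ⟨p, hp⟩ := PolyvectorField.exists_of_derivation (R := k) D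
    (fun W h f g => t.infl_injective W (by simp only [map_add, hD']; ring))
    (fun W h c f => t.infl_injective W (by
      have : t.infl W (c • D W h f) = (TrivSqZeroExt.inl c : k[ε]) • t.infl W (D W h f) :=
        (t.smul_infl (TrivSqZeroExt.inl c) _).symm
      rw [this, hD', hD', s_smul, s_smul]
      exact (smul_sub (A := Γ(t.total, t.opn W)) (TrivSqZeroExt.inl c : k[ε]) _ _).symm))
    (fun W h f g => t.infl_injective W (by
      -- The identity behind the Leibniz rule is `S'f S'g - Sf Sg = Sf (S'g - Sg) + S'g (S'f - Sf)`:
      -- `S` is used to lift `f`, but `S'` to lift `g`.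
      have h1 : t.infl W (f * D W h g) = S.s W (h.trans inf_le_left) f * t.infl W (D W h g) := by
        rw [t.mul_infl, proj_s]
      have h2 : t.infl W (g * D W h f) = S'.s W (h.trans inf_le_right) g * t.infl W (D W h f) := by
        rw [t.mul_infl, proj_s]
      rw [map_add, h1, h2, hD', hD', hD', map_mul, map_mul]; ring))
    (fun W W' h h' f => t.infl_injective W' (by
      rw [← t.res_infl (t.opn_mono h'), hD', hD', map_sub, S'.res_s, S.res_s]))
  exact ⟨p, fun W h f => by rw [hp, hD', add_sub_cancel]⟩

variable {S S' S''}

theorem IsTransition.unique {p q} (hp : S.IsTransition S' p) (hq : S.IsTransition S' q) : p = q :=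
  PolyvectorField.ext_one fun W h f => t.infl_injective W
    (add_left_cancel ((hp W h f).symm.trans (hq W h f)))

theorem IsTransition.cocycle {p q r} (hp : S.IsTransition S' p) (hq : S'.IsTransition S'' q)
    (hr : S.IsTransition S'' r) {W : X.Opens} (h : W ≤ U) (h' : W ≤ U') (h'' : W ≤ U'')
    (f : Γ(X, W)) :
    r.eval (le_inf h h'') ![f] = p.eval (le_inf h h') ![f] + q.eval (le_inf h' h'') ![f] :=
  t.infl_injective W (by
    rw [map_add]
    have h1 := hp W (le_inf h h') f
    have h2 := hq W (le_inf h' h'') f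
    have h3 := hr W (le_inf h h'') f
    linear_combination h1 + h2 - h3)

end FlatThickening.Splitting

/-! ### The bivector field of a deformation in a trivialization. -/

namespace PoissonDeformation

open FlatThickening

variable {k : Type u} [Field k] {X : Scheme.{u}} [X.Over (Spec (.of k))] {Λ₀ : PoissonStructure k X}
  {ξ : FirstOrderPoissonDeformation Λ₀} {U U' : X.Opens} (S : ξ.thickening.Splitting U)
  (S' : ξ.thickening.Splitting U')

/-- In the trivialization given by `S`, the Poisson structure is `Λ₀ + ε Λ`. -/
def IsBivector (Λ : PolyvectorField k X 2 U) : Prop :=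
  ∀ (W : X.Opens) (h : W ≤ U) (f g : Γ(X, W)),
    (ξ.poisson.bracket _).br (S.s W h f) (S.s W h g) =
      S.s W h ((Λ₀.bracket W).br f g) + ξ.thickening.infl W (Λ.eval h ![f, g])

/-- Since the bracket reduces to `Λ₀`, both `{S f, S g}` and `S {f, g}` reduce to `{f, g}`. Their
difference lies in `ε 𝒪` and inherits the biderivation axioms from the two brackets. -/
theorem exists_isBivector : ∃ Λ, IsBivector S Λ := by
  have hex : ∀ (W : X.Opens) (h : W ≤ U) (f g : Γ(X, W)), ∃ e,
      (ξ.poisson.bracket (ξ.thickening.opn W)).br (S.s W h f) (S.s W h g) =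
        S.s W h ((Λ₀.bracket W).br f g) + ξ.thickening.infl W e := fun W h f g => by
    obtain ⟨e, he⟩ := S.exists_eq_add h ((ξ.poisson.bracket _).br (S.s W h f) (S.s W h g))
    exact ⟨e, by rwa [proj_bracket, S.proj_s, S.proj_s] at he⟩
  choose D hD using hex
  have hD' : ∀ W h f g, ξ.thickening.infl W (D W h f g) =
      (ξ.poisson.bracket (ξ.thickening.opn W)).br (S.s W h f) (S.s W h g) -
        S.s W h ((Λ₀.bracket W).br f g) := fun W h f g => by
    rw [hD, add_sub_cancel_left]
  obtain ⟨p, hp⟩ := PolyvectorField.exists_of_biderivation (R := k) D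
    (fun W h f g e => ξ.thickening.infl_injective W (by
      simp only [map_add, hD', LinearMap.add_apply]; ring))
    (fun W h c f g => ξ.thickening.infl_injective W (by
      have : ξ.thickening.infl W (c • D W h f g) =
          (TrivSqZeroExt.inl c : k[ε]) • ξ.thickening.infl W (D W h f g) :=
        (ξ.thickening.smul_infl (TrivSqZeroExt.inl c) _).symm
      rw [this, hD', hD', Splitting.s_smul, LinearMap.map_smul₂, LinearMap.map_smul₂,
        Splitting.s_smul]
      exact (smul_sub (A := Γ(ξ.thickening.total, ξ.thickening.opn W))
        (TrivSqZeroExt.inl c : k[ε]) _ _).symm))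
    (fun W h f g e => ξ.thickening.infl_injective W (by
      have h1 : ∀ x y, ξ.thickening.infl W (x * y) = S.s W h x * ξ.thickening.infl W y := by
        intro x y
        rw [ξ.thickening.mul_infl, Splitting.proj_s]
      simp only [map_add, h1, hD', map_mul, PoissonBracket.leibniz]
      ring))
    (fun W h f => ξ.thickening.infl_injective W (by
      rw [hD', PoissonBracket.self, PoissonBracket.self, map_zero, map_zero, sub_zero]))
    (fun W h f g => ξ.thickening.infl_injective W (by
      rw [map_neg, hD', hD', PoissonBracket.skew _ (S.s W h f),
        PoissonBracket.skew _ f, map_neg]; ring))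
    (fun W W' h h' f g => ξ.thickening.infl_injective W' (by
      rw [← ξ.thickening.res_infl (ξ.thickening.opn_mono h'), hD', hD', map_sub]
      have h1 := ξ.poisson.res_bracket (ξ.thickening.opn_mono h') (S.s W h f) (S.s W h g)
      refine (congrArg₂ (· - ·) h1 (S.res_s _ _ h h' _)).trans ?_
      rw [S.res_s, S.res_s, Λ₀.res_bracket]))
  exact ⟨p, fun W h f g => by rw [hp, hD', add_sub_cancel]⟩

variable {S S'}

theorem IsBivector.unique {P Q} (hP : IsBivector S P) (hQ : IsBivector S Q) : P = Q :=
  PolyvectorField.ext_two fun W h f g => ξ.thickening.infl_injective W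
    (add_left_cancel ((hP W h f g).symm.trans (hQ W h f g)))

/-- If `S' = S + ε p` then `Λ' - Λ = [Λ₀, p]`. -/
theorem IsBivector.sub_eq {P P' p} (hP : IsBivector S P) (hP' : IsBivector S' P')
    (hp : S.IsTransition S' p) {W : X.Opens} (h : W ≤ U ⊓ U') (f g : Γ(X, W)) :
    P'.eval (h.trans inf_le_right) ![f, g] - P.eval (h.trans inf_le_left) ![f, g] =
      (Λ₀.bracket W).br (p.eval h ![f]) g + (Λ₀.bracket W).br f (p.eval h ![g]) -
        p.eval h ![(Λ₀.bracket W).br f g] :=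
  ξ.thickening.infl_injective W (by
    have h1 := hP' W (h.trans inf_le_right) f g
    have h2 := hP W (h.trans inf_le_left) f g
    rw [hp W h, hp W h, hp W h, map_add, map_add, LinearMap.add_apply, LinearMap.add_apply, h2,
      bracket_infl_left, bracket_infl_right, bracket_infl_left, S.proj_s, S.proj_s,
      ξ.thickening.proj_infl, map_zero, map_zero] at h1
    rw [map_sub, map_sub, map_add]
    linear_combination -h1)

/-- The Jacobi identity of the deformed bracket. -/
theorem IsBivector.jacobi {P} (hP : IsBivector S P) {W : X.Opens} (h : W ≤ U) (f g e : Γ(X, W)) :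
    (P.eval h ![f, (Λ₀.bracket W).br g e] + (Λ₀.bracket W).br f (P.eval h ![g, e])) +
      (P.eval h ![g, (Λ₀.bracket W).br e f] + (Λ₀.bracket W).br g (P.eval h ![e, f])) +
      (P.eval h ![e, (Λ₀.bracket W).br f g] + (Λ₀.bracket W).br e (P.eval h ![f, g])) = 0 :=
  ξ.thickening.infl_injective W (by
    have h1 : ∀ f g e, (ξ.poisson.bracket _).br (S.s W h f)
        ((ξ.poisson.bracket _).br (S.s W h g) (S.s W h e)) =
        S.s W h ((Λ₀.bracket W).br f ((Λ₀.bracket W).br g e)) +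
          ξ.thickening.infl W (P.eval h ![f, (Λ₀.bracket W).br g e] +
            (Λ₀.bracket W).br f (P.eval h ![g, e])) := fun f g e => by
      rw [hP, map_add, hP, bracket_infl_right, S.proj_s, map_add, add_assoc]
    have h2 := (ξ.poisson.bracket _).jacobi (S.s W h f) (S.s W h g) (S.s W h e)
    have h3 := congrArg (S.s W h) ((Λ₀.bracket W).jacobi f g e)
    rw [h1, h1, h1] at h2
    rw [map_add, map_add, map_zero] at h3
    rw [map_add, map_add (ξ.thickening.infl W) (_ + _) (_ + _), map_zero]
    linear_combination h2 - h3)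

end PoissonDeformation

/-! ### Values of vector and bivector fields on functions. -/

namespace PolyvectorField

variable {R : Type u} [CommRing R] {X : Scheme.{u}} [X.Over (Spec (.of R))] {U V : X.Opens}

theorem update_vec_one {A : Type v} (f x : A) : Function.update ![f] 0 x = ![x] := by
  funext i
  obtain rfl : i = 0 := Subsingleton.elim _ _
  rfl

theorem eval_one_add (P : PolyvectorField R X 1 U) (h : V ≤ U) (f g : Γ(X, V)) :
    P.eval h ![f + g] = P.eval h ![f] + P.eval h ![g] := by
  have := (P.1 ⟨V, h⟩).1.map_update_add ![f] 0 f g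
  rwa [update_vec_one, update_vec_one, update_vec_one] at this

theorem eval_one_smul (P : PolyvectorField R X 1 U) (h : V ≤ U) (c : R) (f : Γ(X, V)) :
    P.eval h ![c • f] = c • P.eval h ![f] := by
  have := (P.1 ⟨V, h⟩).1.map_update_smul ![f] 0 c f
  rwa [update_vec_one, update_vec_one] at this

theorem eval_one_mul (P : PolyvectorField R X 1 U) (h : V ≤ U) (f g : Γ(X, V)) :
    P.eval h ![f * g] = f * P.eval h ![g] + g * P.eval h ![f] := by
  have := (P.1 ⟨V, h⟩).2 ![f] 0 f g
  rwa [update_vec_one, update_vec_one, update_vec_one] at this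

theorem eval_one_one (P : PolyvectorField R X 1 U) (h : V ≤ U) :
    P.eval h ![1] = 0 := by
  have := P.eval_one_mul h 1 1
  rwa [one_mul, one_mul, left_eq_add] at this

theorem eval_one_zero (P : PolyvectorField R X 1 U) (h : V ≤ U) :
    P.eval h ![0] = 0 := by
  have := P.eval_one_add h 0 0
  rwa [add_zero, left_eq_add] at this

theorem eval_one_algebraMap (P : PolyvectorField R X 1 U) (h : V ≤ U) (c : R) :
    P.eval h ![algebraMap R _ c] = 0 := by
  rw [Algebra.algebraMap_eq_smul_one, eval_one_smul, eval_one_one, smul_zero]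

theorem res_eval_one (P : PolyvectorField R X 1 U) (h : V ≤ U) {W : X.Opens} (h' : W ≤ V)
    (f : Γ(X, V)) : resHom R h' (P.eval h ![f]) = P.eval (h'.trans h) ![resHom R h' f] := by
  rw [P.res_eval]
  exact congrArg _ (funext fun i => by rw [Subsingleton.elim i 0]; rfl)

theorem update_vec_two {A : Type v} (f g x : A) : Function.update ![f, g] 0 x = ![x, g] := by
  funext i
  fin_cases i <;> rfl

theorem eval_two_add (P : PolyvectorField R X 2 U) (h : V ≤ U) (f g e : Γ(X, V)) :
    P.eval h ![f + g, e] = P.eval h ![f, e] + P.eval h ![g, e] := by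
  have := (P.1 ⟨V, h⟩).1.map_update_add ![f, e] 0 f g
  rwa [update_vec_two, update_vec_two, update_vec_two] at this

theorem eval_two_smul (P : PolyvectorField R X 2 U) (h : V ≤ U) (c : R) (f e : Γ(X, V)) :
    P.eval h ![c • f, e] = c • P.eval h ![f, e] := by
  have := (P.1 ⟨V, h⟩).1.map_update_smul ![f, e] 0 c f
  rwa [update_vec_two, update_vec_two] at this

theorem eval_two_mul (P : PolyvectorField R X 2 U) (h : V ≤ U) (f g e : Γ(X, V)) :
    P.eval h ![f * g, e] = f * P.eval h ![g, e] + g * P.eval h ![f, e] := by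
  have := (P.1 ⟨V, h⟩).2 ![f, e] 0 f g
  rwa [update_vec_two, update_vec_two, update_vec_two] at this

theorem eval_two_self (P : PolyvectorField R X 2 U) (h : V ≤ U) (f : Γ(X, V)) :
    P.eval h ![f, f] = 0 :=
  (P.1 ⟨V, h⟩).1.map_eq_zero_of_eq _ (i := 0) (j := 1) rfl (by simp)

theorem eval_two_skew (P : PolyvectorField R X 2 U) (h : V ≤ U) (f g : Γ(X, V)) :
    P.eval h ![f, g] = -P.eval h ![g, f] := by
  have := congrFun (PoissonBracket.IsAlt.swap (PoissonBracket.isAlt_coe (P.1 ⟨V, h⟩).1) f g) ![]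
  rw [eq_neg_iff_add_eq_zero, add_comm]
  exact this

theorem res_eval_two (P : PolyvectorField R X 2 U) (h : V ≤ U) {W : X.Opens} (h' : W ≤ V)
    (f g : Γ(X, V)) :
    resHom R h' (P.eval h ![f, g]) = P.eval (h'.trans h) ![resHom R h' f, resHom R h' g] := by
  rw [P.res_eval]
  exact congrArg _ (List.ofFn_inj.1 rfl)

end PolyvectorField

/-! ### The Lichnerowicz differential in low degrees and the cocycle condition. -/

namespace PoissonStructure

variable {R : Type u} [CommRing R] {X : Scheme.{u}} [X.Over (Spec (.of R))]
  (Λ : PoissonStructure R X) {U V : X.Opens}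

theorem eval_lichSections_one (P : PolyvectorField R X 1 U) (h : V ≤ U) (f g : Γ(X, V)) :
    (Λ.lichSections 1 U P).eval h ![f, g] =
      (Λ.bracket V).br (P.eval h ![f]) g + (Λ.bracket V).br f (P.eval h ![g]) -
        P.eval h ![(Λ.bracket V).br f g] := by
  have h1 : (Λ.lichSections 1 U P).eval h ![f, g] =
      (Λ.bracket V).lichFun 1 (fun F => P.eval h F) ![f, g] := rfl
  have h2 : ∀ F : Fin 1 → Γ(X, V), P.eval h F = P.eval h ![F 0] := fun F =>
    congrArg _ (funext fun i => by rw [Subsingleton.elim i 0]; rfl)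
  rw [h1, PoissonBracket.lichFun]
  simp only [h2 (Function.update _ _ _), h2 (Fin.removeNth (α := fun _ => Γ(X, V)) _ _)]
  simp [Fin.sum_univ_two, Fin.removeNth]
  have h3 := P.eval_one_add h ((Λ.bracket V).br f g) ((Λ.bracket V).br g f)
  rw [(Λ.bracket V).skew g f, add_neg_cancel, P.eval_one_zero] at h3
  rw [(Λ.bracket V).skew f (P.eval h ![g]), (Λ.bracket V).skew g f]
  linear_combination -h3

/-- Up to sign, the Schouten bracket with a bivector field `P` is the `ε`-coefficient of the Jacobi
sum of `Λ₀ + ε P`. -/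
theorem eval_lichSections_two (P : PolyvectorField R X 2 U) (h : V ≤ U) (f g e : Γ(X, V)) :
    (Λ.lichSections 2 U P).eval h ![f, g, e] =
      -((P.eval h ![f, (Λ.bracket V).br g e] + (Λ.bracket V).br f (P.eval h ![g, e])) +
      (P.eval h ![g, (Λ.bracket V).br e f] + (Λ.bracket V).br g (P.eval h ![e, f])) +
      (P.eval h ![e, (Λ.bracket V).br f g] + (Λ.bracket V).br e (P.eval h ![f, g]))) := by
  have h1 : (Λ.lichSections 2 U P).eval h ![f, g, e] =
      (Λ.bracket V).lichFun 2 (fun F => P.eval h F) ![f, g, e] := rfl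
  have h2 : ∀ F : Fin 2 → Γ(X, V), P.eval h F = P.eval h ![F 0, F 1] := fun F =>
    congrArg _ (List.ofFn_inj.1 rfl)
  rw [h1, PoissonBracket.lichFun]
  simp only [h2 (Function.update _ _ _), h2 (Fin.removeNth (α := fun _ => Γ(X, V)) _ _)]
  simp [Fin.sum_univ_succ, Fin.removeNth]
  have hl : ∀ x y z : Γ(X, V), P.eval h ![(Λ.bracket V).br x y, z] =
      P.eval h ![z, (Λ.bracket V).br y x] := fun x y z => by
    rw [P.eval_two_skew, (Λ.bracket V).skew y x, P.eval_two_skew h z (-_),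
      P.eval_two_skew h z, ← neg_one_smul R ((Λ.bracket V).br x y), P.eval_two_smul,
      neg_one_smul]
  have hr : P.eval h ![f, (Λ.bracket V).br e g] = -P.eval h ![f, (Λ.bracket V).br g e] := by
    rw [← hl, P.eval_two_skew]
  rw [hl, hr, (Λ.bracket V).skew (P.eval h ![g, e]) f, (Λ.bracket V).skew (P.eval h ![f, e]) g,
    (Λ.bracket V).skew (P.eval h ![f, g]) e, P.eval_two_skew h f e, map_neg]
  ring

/-- The cocycle condition for vector fields `p_ij` and bivector fields `Λ_i`, written out. -/
structure IsCocycle {I : Type u} (U : I → X.Opens) (p : ∀ i j, PolyvectorField R X 1 (U i ⊓ U j))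
    (Q : ∀ i, PolyvectorField R X 2 (U i)) : Prop where
  cocycle : ∀ i j k (W : X.Opens) (hi : W ≤ U i) (hj : W ≤ U j) (hk : W ≤ U k) (f : Γ(X, W)),
    (p i k).eval (le_inf hi hk) ![f] =
      (p i j).eval (le_inf hi hj) ![f] + (p j k).eval (le_inf hj hk) ![f]
  sub_eq : ∀ i j (W : X.Opens) (hi : W ≤ U i) (hj : W ≤ U j) (f g : Γ(X, W)),
    (Q j).eval hj ![f, g] - (Q i).eval hi ![f, g] =
      (Λ.bracket W).br ((p i j).eval (le_inf hi hj) ![f]) g +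
        (Λ.bracket W).br f ((p i j).eval (le_inf hi hj) ![g]) -
        (p i j).eval (le_inf hi hj) ![(Λ.bracket W).br f g]
  jacobi : ∀ i (W : X.Opens) (h : W ≤ U i) (f g e : Γ(X, W)),
    ((Q i).eval h ![f, (Λ.bracket W).br g e] + (Λ.bracket W).br f ((Q i).eval h ![g, e])) +
      ((Q i).eval h ![g, (Λ.bracket W).br e f] + (Λ.bracket W).br g ((Q i).eval h ![e, f])) +
      ((Q i).eval h ![e, (Λ.bracket W).br f g] + (Λ.bracket W).br e ((Q i).eval h ![f, g])) = 0

theorem sectionsMap_d_zero_one (P : PolyvectorField R X 1 U) :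
    sectionsMap (Λ.truncatedComplex.d 0 1) U P = Λ.lichSections 1 U P := by
  have : Λ.truncatedComplex.d 0 1 = Λ.lichMap 1 := 
    CochainComplex.of_d (fun n => polyvectorSheaf R X (n + 1)) (fun n => Λ.lichMap (n + 1)) 0
  rw [this]; rfl

theorem sectionsMap_d_one_two (P : PolyvectorField R X 2 U) :
    sectionsMap (Λ.truncatedComplex.d 1 2) U P = Λ.lichSections 2 U P := by
  have : Λ.truncatedComplex.d 1 2 = Λ.lichMap 2 := 
    CochainComplex.of_d (fun n => polyvectorSheaf R X (n + 1)) (fun n => Λ.lichMap (n + 1)) 1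
  rw [this]; rfl

theorem lichSections_one_eq_iff (P : PolyvectorField R X 1 U) (Q : PolyvectorField R X 2 U) :
    Λ.lichSections 1 U P = Q ↔ ∀ (W : X.Opens) (h : W ≤ U) (f g : Γ(X, W)),
      Q.eval h ![f, g] = (Λ.bracket W).br (P.eval h ![f]) g +
        (Λ.bracket W).br f (P.eval h ![g]) - P.eval h ![(Λ.bracket W).br f g] := by
  refine ⟨?_, fun H => PolyvectorField.ext_two fun W h f g => ?_⟩
  · rintro rfl W h f g
    exact Λ.eval_lichSections_one P h f g
  · rw [eval_lichSections_one, H]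

/-- The minus sign is forced: the total differential asks for `[Λ₀, p_ij] = m_i - m_j`, whereas a
change of splitting gives `[Λ₀, p_ij] = Q_j - Q_i`. Closedness of `m_i` is the linearized Jacobi
identity. -/
theorem isCechCocycle_iff {I : Type u} (U : I → X.Opens)
    (p : ∀ i j, PolyvectorField R X 1 (U i ⊓ U j)) (Q : ∀ i, PolyvectorField R X 2 (U i)) :
    IsCechCocycle Λ.truncatedComplex U p (fun i => -Q i) ↔ Λ.IsCocycle U p Q := by
  constructor
  · intro H
    refine ⟨fun i j k W hi hj hk f => ?_, fun i j W hi hj f g => ?_, fun i W h f g e => ?_⟩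
    · exact congrArg (fun P : PolyvectorField R X 1 W => P.eval le_rfl ![f])
        (H.cocycle i j k W (le_inf hi hj) (le_inf hj hk) (le_inf hi hk))
    · have h1 : Λ.lichSections 1 _ (p i j) = PolyvectorField.res inf_le_left (-Q i) -
          PolyvectorField.res inf_le_right (-Q j) :=
        (Λ.sectionsMap_d_zero_one (p i j)).symm.trans (H.d_fst i j)
      rw [lichSections_one_eq_iff] at h1
      rw [← h1 W (le_inf hi hj) f g]
      change _ = -(Q i).eval hi ![f, g] - -(Q j).eval hj ![f, g]
      ring
    · have h1 : Λ.lichSections 2 _ (-Q i) = 0 :=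
        (Λ.sectionsMap_d_one_two (-Q i)).symm.trans (H.d_snd i)
      rw [map_neg, neg_eq_zero] at h1
      have h2 := Λ.eval_lichSections_two (Q i) h f g e
      rw [h1, eq_neg_iff_add_eq_zero] at h2
      exact (zero_add _).symm.trans h2
  · intro H
    refine ⟨fun i j k W hij hjk hik => ?_, fun i j => ?_, fun i => ?_⟩
    · exact PolyvectorField.ext_one fun V hV f => H.cocycle i j k V (hV.trans (hij.trans inf_le_left))
        (hV.trans (hij.trans inf_le_right)) (hV.trans (hjk.trans inf_le_right)) f
    · refine (Λ.sectionsMap_d_zero_one (p i j)).trans ?_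
      refine (Λ.lichSections_one_eq_iff (p i j) (PolyvectorField.res inf_le_left (-Q i) -
        PolyvectorField.res inf_le_right (-Q j))).2 fun W h f g => ?_
      rw [← H.sub_eq i j W (h.trans inf_le_left) (h.trans inf_le_right) f g]
      change -(Q i).eval _ ![f, g] - -(Q j).eval _ ![f, g] = _
      ring
    · refine (Λ.sectionsMap_d_one_two (-Q i)).trans ?_
      change _ = (0 : PolyvectorField R X 3 (U i))
      rw [map_neg, neg_eq_zero]
      refine PolyvectorField.ext fun V hV F => ?_
      rw [show F = ![F 0, F 1, F 2] from List.ofFn_inj.1 rfl, eval_lichSections_two, H.jacobi,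
        neg_zero]
      rfl

end PoissonStructure

/-! ### Čech data of a deformation: construction and independence of choices. -/

namespace CechData

open FlatThickening PoissonDeformation

variable {k : Type u} [Field k] {X : Scheme.{u}} [X.Over (Spec (.of k))] {Λ₀ : PoissonStructure k X}
  {ξ : FirstOrderPoissonDeformation Λ₀}

theorem preimage_opn_le {U W : X.Opens} (h : W ≤ U) : ξ.incl ⁻¹ᵁ ξ.thickening.opn W ≤ U :=
  (ξ.thickening.incl_preimage_opn W).le.trans h

/-- The splittings of a Čech datum, as maps between sections over open subsets of `X`. -/
noncomputable def splitting (D : CechData ξ) (i : D.I) : ξ.thickening.Splitting (D.U i) where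
  s W h := (D.s i (ξ.thickening.opn W) (preimage_opn_le h)).comp
    (resHom k (ξ.thickening.incl_preimage_opn W).le : Γ(X, W) →+* _)
  s_algebraMap W h c := by
    refine (congrArg _ (AlgHom.commutes _ c)).trans ?_
    exact D.s_algebraMap i _ _ c
  res_s W W' h h' f := by
    refine (D.res_s i _ _ (preimage_opn_le h) (ξ.thickening.opn_mono h')
      (ξ.incl.preimage_mono (ξ.thickening.opn_mono h')) _).trans ?_
    refine congrArg (D.s i (ξ.thickening.opn W') (preimage_opn_le (h'.trans h))) ?_
    exact (resHom_resHom k _ _ f).trans (resHom_resHom k _ _ f).symm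
  proj_s W h f := by
    rw [proj_eq]
    refine (congrArg (resHom k (ξ.thickening.incl_preimage_opn W).ge) (D.incl_s i _ _ _)).trans ?_
    exact (resHom_resHom k _ _ f).trans (resHom_refl k _ f)

theorem infl_eq (D : CechData ξ) (i : D.I) {W : X.Opens} (h : W ≤ D.U i)
    (g : Γ(X, ξ.incl ⁻¹ᵁ ξ.thickening.opn W)) :
    ξ.thickening.infl W (resHom k (ξ.thickening.incl_preimage_opn W).ge g) =
      (ε : k[ε]) • D.s i (ξ.thickening.opn W) (preimage_opn_le h) g := by
  rw [(D.splitting i).infl_eq h]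
  refine congrArg (fun x => (ε : k[ε]) • D.s i (ξ.thickening.opn W) (preimage_opn_le h) x) ?_
  exact (resHom_resHom k _ _ g).trans (resHom_refl k _ g)

theorem isBivector (D : CechData ξ) (i : D.I) : IsBivector (D.splitting i) (D.Λ i) :=
  fun W h f g => by
    refine (D.bracket_s i _ (preimage_opn_le h) _ _).trans ?_
    refine congrArg₂ (· + ·) (congrArg _ (Λ₀.res_bracket _ f g).symm) ?_
    refine (D.infl_eq i h _).symm.trans (congrArg _ ?_)
    rw [PolyvectorField.res_eval_two]
    exact congrArg₂ (fun x y => (D.Λ i).eval h ![x, y])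
      ((resHom_resHom k _ _ f).trans (resHom_refl k _ f))
      ((resHom_resHom k _ _ g).trans (resHom_refl k _ g))

theorem isTransition (D : CechData ξ) (i j : D.I) :
    (D.splitting i).IsTransition (D.splitting j) (D.p i j) := fun W h f => by
  refine (D.transition i j _ (preimage_opn_le h) _).trans ?_
  refine congrArg₂ (· + ·) rfl ?_
  refine (D.infl_eq i (h.trans inf_le_left) _).symm.trans (congrArg _ ?_)
  rw [PolyvectorField.res_eval_one]
  exact congrArg (fun x => (D.p i j).eval h ![x]) ((resHom_resHom k _ _ f).trans (resHom_refl k _ f))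

theorem isCocycle (D : CechData ξ) : Λ₀.IsCocycle D.U D.p D.Λ where
  cocycle i j k _ hi hj hk f :=
    (D.isTransition i j).cocycle (D.isTransition j k) (D.isTransition i k) hi hj hk f
  sub_eq i j _ hi hj f g :=
    (D.isBivector i).sub_eq (D.isBivector j) (D.isTransition i j) (le_inf hi hj) f g
  jacobi i _ h f g e := (D.isBivector i).jacobi h f g e

theorem isCechCocycle (D : CechData ξ) :
    IsCechCocycle Λ₀.truncatedComplex D.U D.p (fun i => -D.Λ i) :=
  (Λ₀.isCechCocycle_iff D.U D.p D.Λ).2 D.isCocycle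

theorem le_opn (V : ξ.total.Opens) : V ≤ ξ.thickening.opn (ξ.incl ⁻¹ᵁ V) :=
  (ξ.thickening.opn_incl_preimage V).ge

/-- The Čech datum given by splittings over an affine open cover. -/
noncomputable def ofSplittings {I : Type u} (U : I → X.Opens) (hU : ∀ i, IsAffineOpen (U i))
    (hU' : ⨆ i, U i = ⊤) (S : ∀ i, ξ.thickening.Splitting (U i))
    (Λ : ∀ i, PolyvectorField k X 2 (U i)) (hΛ : ∀ i, IsBivector (S i) (Λ i))
    (p : ∀ i j, PolyvectorField k X 1 (U i ⊓ U j)) (hp : ∀ i j, (S i).IsTransition (S j) (p i j)) :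
    CechData ξ where
  I := I
  U := U
  isAffineOpen := hU
  iSup_eq_top := hU'
  s i V h := (resHom k[ε] (le_opn V) : _ →+* Γ(ξ.total, V)).comp ((S i).s (ξ.incl ⁻¹ᵁ V) h)
  s_algebraMap i V h c :=
    (congrArg (resHom k[ε] (le_opn V)) ((S i).s_algebraMap _ h c)).trans (AlgHom.commutes _ _)
  res_s i V W h hW hW' f := by
    have h1 := (S i).res_s _ _ h hW' f
    refine Eq.trans ?_ (congrArg (resHom k[ε] (le_opn W)) h1)
    exact (resHom_resHom k[ε] _ _ _).trans (resHom_resHom k[ε] _ _ _).symm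
  incl_s i V h f := by
    refine (ξ.thickening.res_red (le_opn V) _).symm.trans ?_
    refine Eq.trans ?_ ((S i).proj_s _ h f)
    rw [proj_eq]
  Λ := Λ
  bracket_s i V h f g := by
    have h1 := congrArg (resHom k[ε] (le_opn V)) (hΛ i _ h f g)
    rw [(S i).infl_eq h, map_add, map_smul] at h1
    exact (ξ.poisson.res_bracket (le_opn V) _ _).symm.trans h1
  p := p
  transition i j V h f := by
    have h1 := congrArg (resHom k[ε] (le_opn V)) (hp i j _ h f)
    rw [(S i).infl_eq (h.trans inf_le_left), map_add, map_smul] at h1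
    exact h1

/-- Splittings over an affine open cover can be completed to a Čech datum. -/
theorem exists_ofSplittings {I : Type u} (U : I → X.Opens) (hU : ∀ i, IsAffineOpen (U i))
    (hU' : ⨆ i, U i = ⊤) (S : ∀ i, ξ.thickening.Splitting (U i)) :
    ∃ (Λ : ∀ i, PolyvectorField k X 2 (U i)) (p : ∀ i j, PolyvectorField k X 1 (U i ⊓ U j)),
      (∀ i, IsBivector (S i) (Λ i)) ∧ (∀ i j, (S i).IsTransition (S j) (p i j)) ∧
      ∃ c, IsCechClass (F := Λ₀.truncatedComplex) U p (fun i => -Λ i) c := by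
  choose Λ hΛ using fun i => exists_isBivector (S i)
  choose p hp using fun i j => (S i).exists_isTransition (S j)
  exact ⟨Λ, p, hΛ, hp, (ofSplittings U hU hU' S Λ hΛ p hp).isCechCocycle.exists_isCechClass hU'⟩

/-- The cover consists of the open sets whose thickening is affine, since splittings exist there.
These sets are affine themselves because the inclusion of `X` is a closed immersion. -/
instance nonempty [Smooth (X ↘ Spec (.of k))] : Nonempty (CechData ξ) := by
  let I : Type u := ξ.thickening.AffineIn ⊤
  have S : ∀ i : I, ξ.thickening.Splitting i.1 := fun i =>
    (ξ.thickening.exists_splitting i.2.2).some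
  have hU : ∀ i : I, IsAffineOpen i.1 := fun i => by
    have := isClosedImmersion_incl ξ.thickening
    have := i.2.2.preimage ξ.thickening.incl
    rwa [incl_preimage_opn] at this
  have hU' : ⨆ i : I, i.1 = ⊤ := top_le_iff.1 (ξ.thickening.le_iSup_affineIn ⊤)
  obtain ⟨Λ, p, hΛ, hp, -⟩ := exists_ofSplittings (fun i : I => i.1) hU hU' S
  exact ⟨ofSplittings (fun i : I => i.1) hU hU' S Λ hΛ p hp⟩

/-- The class of a Čech datum does not depend on the choices. -/
theorem isCechClass_unique (D D' : CechData ξ) {c c' : hypercohomology Λ₀.truncatedComplex 1}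
    (hc : IsCechClass (F := Λ₀.truncatedComplex) D.U D.p (fun i => -D.Λ i) c)
    (hc' : IsCechClass (F := Λ₀.truncatedComplex) D'.U D'.p (fun i => -D'.Λ i) c') : c = c' := by
  -- The union of the two covers, with both families of splittings, has one class `e`. Each of the
  -- given cocycles is the part of its cocycle indexed by one summand, so each has class `e`.
  let U : D.I ⊕ D'.I → X.Opens := Sum.elim D.U D'.U
  let S : ∀ i, ξ.thickening.Splitting (U i) := fun i => match i with
    | .inl i => D.splitting i
    | .inr i => D'.splitting i
  obtain ⟨Λ, p, hΛ, hp, e, he⟩ := exists_ofSplittings U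
    (by rintro (i | i); exacts [D.isAffineOpen i, D'.isAffineOpen i])
    (top_le_iff.1 (D.iSup_eq_top.ge.trans (iSup_le fun i => le_iSup U (.inl i)))) S
  have h1 : IsCechClass (F := Λ₀.truncatedComplex) D.U D.p (fun i => -D.Λ i) e := by
    have h2 := he.reindex (Sum.inl : D.I → D.I ⊕ D'.I)
    -- Transition and bivector fields are determined by the splittings, so on the first summand they
    -- are those of `D`.
    rwa [show (fun i j => p (.inl i) (.inl j)) = D.p from funext fun i => funext fun j =>
        (hp (.inl i) (.inl j)).unique (D.isTransition i j),
      show (fun i => -Λ (.inl i)) = fun i => -D.Λ i from funext fun i =>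
        congrArg _ ((hΛ (.inl i)).unique (D.isBivector i))] at h2
  have h1' : IsCechClass (F := Λ₀.truncatedComplex) D'.U D'.p (fun i => -D'.Λ i) e := by
    have h2 := he.reindex (Sum.inr : D'.I → D.I ⊕ D'.I)
    rwa [show (fun i j => p (.inr i) (.inr j)) = D'.p from funext fun i => funext fun j =>
        (hp (.inr i) (.inr j)).unique (D'.isTransition i j),
      show (fun i => -Λ (.inr i)) = fun i => -D'.Λ i from funext fun i =>
        congrArg _ ((hΛ (.inr i)).unique (D'.isBivector i))] at h2
  exact (hc.unique D.iSup_eq_top h1).trans (h1'.unique D'.iSup_eq_top hc')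

end CechData

/-! ### Transport of Čech data along an isomorphism of deformations. -/

namespace PoissonDeformation

open FlatThickening

variable {k : Type u} [Field k] {X : Scheme.{u}} [X.Over (Spec (.of k))] {Λ₀ : PoissonStructure k X}
  {ξ η : FirstOrderPoissonDeformation Λ₀}

theorem preimage_opn_of_incl_comp (φ : ξ.total ≅ η.total) (h : ξ.incl ≫ φ.hom = η.incl)
    (W : X.Opens) : φ.hom ⁻¹ᵁ η.thickening.opn W = ξ.thickening.opn W := by
  rw [← ξ.thickening.opn_incl_preimage (φ.hom ⁻¹ᵁ _)]
  refine congrArg _ (Eq.trans ?_ (η.thickening.incl_preimage_opn W))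
  exact congrArg (fun g : X ⟶ η.total => g ⁻¹ᵁ η.thickening.opn W) h

/-- Isomorphic deformations have the same Čech data. -/
theorem Isomorphic.exists_cechData (h : Isomorphic ξ η) (D : CechData η) :
    ∃ D' : CechData ξ, ∀ c, IsCechClass (F := Λ₀.truncatedComplex) D.U D.p (fun i => -D.Λ i) c ↔
      IsCechClass (F := Λ₀.truncatedComplex) D'.U D'.p (fun i => -D'.Λ i) c := by
  obtain ⟨φ, hover, hincl, hpois⟩ := h
  have hopn := preimage_opn_of_incl_comp φ hincl
  let Φ : ∀ W : X.Opens, Γ(η.total, η.thickening.opn W) →+* Γ(ξ.total, ξ.thickening.opn W) :=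
    fun W => (φ.hom.appLE _ _ (hopn W).ge).hom
  have hΦalg : ∀ W (c : k[ε]), Φ W (algebraMap k[ε] _ c) = algebraMap k[ε] _ c := fun W c =>
    appLE_algebraMap φ.hom (RingHom.id k[ε])
      (by rw [hover, CommRingCat.ofHom_id, Spec.map_id, Category.comp_id]) _ c
  have hΦproj : ∀ W x, ξ.thickening.proj W (Φ W x) = η.thickening.proj W x := fun W x => by
    have : φ.hom.appLE _ _ (hopn W).ge ≫ ξ.incl.appLE (ξ.thickening.opn W) W
        (ξ.thickening.incl_preimage_opn W).ge = η.incl.appLE (η.thickening.opn W) W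
        (η.thickening.incl_preimage_opn W).ge := by
      rw [Scheme.Hom.appLE_comp_appLE]
      exact appLE_congr_hom hincl _ _
    exact ConcreteCategory.congr_hom this x
  have hΦres : ∀ (W W' : X.Opens) (h : W' ≤ W) x, resHom k[ε] (ξ.thickening.opn_mono h) (Φ W x) =
      Φ W' (resHom k[ε] (η.thickening.opn_mono h) x) := fun W W' h x => by
    have : φ.hom.appLE _ _ (hopn W).ge ≫ ξ.total.presheaf.map
        (homOfLE (ξ.thickening.opn_mono h)).op = η.total.presheaf.map
        (homOfLE (η.thickening.opn_mono h)).op ≫ φ.hom.appLE _ _ (hopn W').ge := by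
      rw [Scheme.Hom.appLE_map, Scheme.Hom.map_appLE]
    exact ConcreteCategory.congr_hom this x
  let S : ∀ i, ξ.thickening.Splitting (D.U i) := fun i =>
    { s := fun W h => (Φ W).comp ((D.splitting i).s W h)
      s_algebraMap := fun W h c =>
        (congrArg (Φ W) ((D.splitting i).s_algebraMap W h c)).trans (hΦalg W _)
      res_s := fun W W' h h' f =>
        (hΦres W W' h' _).trans (congrArg (Φ W') ((D.splitting i).res_s W W' h h' f))
      proj_s := fun W h f => (hΦproj W _).trans ((D.splitting i).proj_s W h f) }
  have hΦinfl : ∀ i W (h : W ≤ D.U i) g, Φ W (η.thickening.infl W g) = ξ.thickening.infl W g :=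
    fun i W h g => by
      rw [(D.splitting i).infl_eq h, (S i).infl_eq h, Algebra.smul_def, Algebra.smul_def, map_mul,
        hΦalg]
      rfl
  have hΛ : ∀ i, IsBivector (S i) (D.Λ i) := fun i W h f g => by
    refine (hpois.appLE (hopn W).ge _ _).symm.trans ?_
    refine (congrArg (Φ W) (D.isBivector i W h f g)).trans ?_
    rw [map_add, hΦinfl i W h]
    rfl
  have hp : ∀ i j, (S i).IsTransition (S j) (D.p i j) := fun i j W h f => by
    refine (congrArg (Φ W) (D.isTransition i j W h f)).trans ?_
    rw [map_add, hΦinfl i W (h.trans inf_le_left)]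
    rfl
  exact ⟨CechData.ofSplittings D.U D.isAffineOpen D.iSup_eq_top S D.Λ hΛ D.p hp, fun c => Iff.rfl⟩

end PoissonDeformation

/-! ### Coordinates of a section: its reduction and its local `ε`-coefficients. -/

namespace FlatThickening

variable {k : Type u} [Field k] {X : Scheme.{u}} [X.Over (Spec (.of k))] {t : FlatThickening k X}

namespace Splitting

variable {U : X.Opens} (S : t.Splitting U)

/-- The coefficient of `ε` in a trivialization. -/
noncomputable def coeff {W : X.Opens} (h : W ≤ U) (x : Γ(t.total, t.opn W)) : Γ(X, W) :=
  (S.exists_eq_add h x).choose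

theorem eq_add {W : X.Opens} (h : W ≤ U) (x : Γ(t.total, t.opn W)) :
    x = S.s W h (t.proj W x) + t.infl W (S.coeff h x) :=
  (S.exists_eq_add h x).choose_spec

theorem coeff_eq {W : X.Opens} (h : W ≤ U) {x : Γ(t.total, t.opn W)} {f g : Γ(X, W)}
    (hx : x = S.s W h f + t.infl W g) : S.coeff h x = g := by
  have h1 : t.proj W x = f := by rw [hx, map_add, S.proj_s, t.proj_infl, add_zero]
  have h2 := S.eq_add h x
  rw [h1] at h2
  exact t.infl_injective W (add_left_cancel (h2.symm.trans hx))

theorem ext {W : X.Opens} (h : W ≤ U) {x y : Γ(t.total, t.opn W)} (h1 : t.proj W x = t.proj W y)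
    (h2 : S.coeff h x = S.coeff h y) : x = y := by
  rw [S.eq_add h x, S.eq_add h y, h1, h2]

theorem coeff_res {W W' : X.Opens} (h : W ≤ U) (h' : t.opn W' ≤ t.opn W)
    (x : Γ(t.total, t.opn W)) :
    S.coeff ((t.le_of_opn_le h').trans h) (resHom k[ε] h' x) =
      resHom k (t.le_of_opn_le h') (S.coeff h x) := by
  refine S.coeff_eq _ (f := resHom k (t.le_of_opn_le h') (t.proj W x)) ?_
  rw [← t.res_infl h', ← S.res_s W W' h (t.le_of_opn_le h'), ← map_add, ← S.eq_add]

theorem coeff_add {W : X.Opens} (h : W ≤ U) (x y : Γ(t.total, t.opn W)) :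
    S.coeff h (x + y) = S.coeff h x + S.coeff h y := by
  refine S.coeff_eq h (f := t.proj W x + t.proj W y) ?_
  rw [map_add, map_add]
  linear_combination S.eq_add h x + S.eq_add h y

/-- Since `ε² = 0`, the `ε`-coefficient of a product obeys the Leibniz rule along reduction. -/
theorem coeff_mul {W : X.Opens} (h : W ≤ U) (x y : Γ(t.total, t.opn W)) :
    S.coeff h (x * y) = t.proj W x * S.coeff h y + t.proj W y * S.coeff h x := by
  refine S.coeff_eq h (f := t.proj W x * t.proj W y) ?_
  rw [map_mul, map_add, ← t.mul_infl, ← t.mul_infl]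
  linear_combination (x - t.infl W (S.coeff h x)) * S.eq_add h y +
    S.s W h (t.proj W y) * S.eq_add h x - t.infl_mul_infl (S.coeff h x) (S.coeff h y)

theorem coeff_s {W : X.Opens} (h : W ≤ U) (f : Γ(X, W)) : S.coeff h (S.s W h f) = 0 :=
  S.coeff_eq h (f := f) (by rw [map_zero, add_zero])

theorem coeff_algebraMap {W : X.Opens} (h : W ≤ U) (c : k[ε]) :
    S.coeff h (algebraMap k[ε] _ c) = algebraMap k _ c.snd := by
  refine S.coeff_eq h (f := algebraMap k _ c.fst) ?_
  rw [S.s_algebraMap, S.infl_eq h, S.s_algebraMap, Algebra.smul_def, ← map_mul, ← map_add]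
  congr 1
  ext <;> simp

/-- Restriction of a splitting to a smaller open set. -/
def restrict {U' : X.Opens} (h : U' ≤ U) : t.Splitting U' where
  s W hW := S.s W (hW.trans h)
  s_algebraMap W hW := S.s_algebraMap W (hW.trans h)
  res_s W W' hW hW' := S.res_s W W' (hW.trans h) hW'
  proj_s W hW := S.proj_s W (hW.trans h)

/-- The splitting `S + ε q`. -/
noncomputable def twist (q : PolyvectorField k X 1 U) : t.Splitting U where
  s W h :=
    { toFun := fun f => S.s W h f + t.infl W (q.eval h ![f])
      map_one' := by rw [map_one, q.eval_one_one, map_zero, add_zero]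
      map_zero' := by rw [map_zero, q.eval_one_zero, map_zero, add_zero]
      map_add' := fun f g => by rw [map_add, q.eval_one_add, map_add]; ring
      map_mul' := fun f g => by
        have h1 : t.infl W (f * q.eval h ![g]) = S.s W h f * t.infl W (q.eval h ![g]) := by
          rw [t.mul_infl, S.proj_s]
        have h2 : t.infl W (g * q.eval h ![f]) = S.s W h g * t.infl W (q.eval h ![f]) := by
          rw [t.mul_infl, S.proj_s]
        rw [map_mul, q.eval_one_mul, map_add, h1, h2]
        linear_combination -(t.infl_mul_infl (q.eval h ![f]) (q.eval h ![g])) }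
  s_algebraMap W h c := by
    change S.s W h _ + t.infl W (q.eval h _) = _
    rw [q.eval_one_algebraMap, map_zero, add_zero, S.s_algebraMap]
  res_s W W' h h' f := by
    change resHom k[ε] _ (S.s W h _ + t.infl W (q.eval h _)) = S.s W' _ _ + t.infl W' (q.eval _ _)
    rw [map_add, S.res_s, t.res_infl, q.res_eval_one]
  proj_s W h f := by
    change t.proj W (S.s W h _ + t.infl W (q.eval h _)) = _
    rw [map_add, S.proj_s, t.proj_infl, add_zero]

theorem twist_s (q : PolyvectorField k X 1 U) {W : X.Opens} (h : W ≤ U) (f : Γ(X, W)) :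
    (S.twist q).s W h f = S.s W h f + t.infl W (q.eval h ![f]) := rfl

end Splitting

section Coord

variable {I : Type u} {U : I → X.Opens} (S : ∀ i, t.Splitting (U i))

/-- The local coefficients of `ε` of a section of the thickening. -/
noncomputable def coord {W : X.Opens} (x : Γ(t.total, t.opn W)) (i : I) : Γ(X, W ⊓ U i) :=
  (S i).coeff inf_le_right (resHom k[ε] (t.opn_mono inf_le_left) x)

theorem ext_of_coord (hU : iSup U = ⊤) {W : X.Opens} {x y : Γ(t.total, t.opn W)}
    (h : t.proj W x = t.proj W y) (h' : ∀ i, coord S x i = coord S y i) : x = y := by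
  refine t.res_ext (fun i => W ⊓ U i) (fun i => inf_le_left) ?_ _ _ fun i => ?_
  · rw [← inf_iSup_eq, hU, inf_top_eq]
  · exact (S i).ext inf_le_right (by rw [t.proj_res, t.proj_res, h]) (h' i)

theorem coord_res {W W' : X.Opens} (h : W' ≤ W) (x : Γ(t.total, t.opn W)) (i : I) :
    coord S (resHom k[ε] (t.opn_mono h) x) i = resHom k (inf_le_inf_right _ h) (coord S x i) := by
  rw [coord, coord, ← (S i).coeff_res inf_le_right (t.opn_mono (inf_le_inf_right _ h)),
    resHom_resHom, resHom_resHom]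

theorem coord_add {W : X.Opens} (x y : Γ(t.total, t.opn W)) (i : I) :
    coord S (x + y) i = coord S x i + coord S y i := by
  rw [coord, map_add, Splitting.coeff_add]; rfl

theorem coord_mul {W : X.Opens} (x y : Γ(t.total, t.opn W)) (i : I) :
    coord S (x * y) i = resHom k inf_le_left (t.proj W x) * coord S y i +
      resHom k inf_le_left (t.proj W y) * coord S x i := by
  rw [coord, map_mul, Splitting.coeff_mul, t.proj_res, t.proj_res]; rfl

theorem coord_algebraMap (W : X.Opens) (c : k[ε]) (i : I) :
    coord S (algebraMap k[ε] Γ(t.total, t.opn W) c) i = algebraMap k _ c.snd := by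
  rw [coord, AlgHom.commutes, Splitting.coeff_algebraMap]

variable {S} {p : ∀ i j, PolyvectorField k X 1 (U i ⊓ U j)}

/-- Compare `x = S_i f + ε g_i` with `x = S_j f + ε g_j`, using `S_j = S_i + ε p_ij`: this gives
`g_i = g_j + p_ij f`. -/
theorem coord_compat (hp : ∀ i j, (S i).IsTransition (S j) (p i j)) {W : X.Opens}
    (x : Γ(t.total, t.opn W)) (i j : I) {W' : X.Opens} (h : W' ≤ W) (hi : W' ≤ U i) (hj : W' ≤ U j) :
    resHom k (le_inf h hi) (coord S x i) = resHom k (le_inf h hj) (coord S x j) +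
      (p i j).eval (le_inf hi hj) ![resHom k h (t.proj W x)] := by
  have hc : ∀ l (hl : W' ≤ U l), resHom k (le_inf h hl) (coord S x l) =
      (S l).coeff hl (resHom k[ε] (t.opn_mono h) x) := fun l hl => by
    rw [coord, ← (S l).coeff_res inf_le_right (t.opn_mono (le_inf h hl)), resHom_resHom]
  rw [hc i hi, hc j hj]
  refine (S i).coeff_eq hi (f := resHom k h (t.proj W x)) ?_
  have h1 := (S j).eq_add hj (resHom k[ε] (t.opn_mono h) x)
  rw [t.proj_res, hp i j W' (le_inf hi hj)] at h1
  rw [map_add]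
  linear_combination h1

/-- The converse of `coord_compat`: under the compatibility condition the local sections `S_i f + ε
g_i` agree on overlaps. Together with `ext_of_coord` this describes sections of the thickening by
data depending on `p` alone. -/
theorem exists_coord (hU : iSup U = ⊤) (hp : ∀ i j, (S i).IsTransition (S j) (p i j)) {W : X.Opens}
    (f : Γ(X, W)) (g : ∀ i, Γ(X, W ⊓ U i))
    (hg : ∀ i j (W' : X.Opens) (h : W' ≤ W) (hi : W' ≤ U i) (hj : W' ≤ U j),
      resHom k (le_inf h hi) (g i) = resHom k (le_inf h hj) (g j) +
        (p i j).eval (le_inf hi hj) ![resHom k h f]) :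
    ∃ x : Γ(t.total, t.opn W), t.proj W x = f ∧ ∀ i, coord S x i = g i := by
  have hcov : W ≤ ⨆ i, W ⊓ U i := by rw [← inf_iSup_eq, hU, inf_top_eq]
  obtain ⟨x, hx⟩ := t.res_glue (fun i => W ⊓ U i) (fun i => inf_le_left) hcov
    (fun i => (S i).s _ inf_le_right (resHom k inf_le_left f) + t.infl _ (g i)) fun i j => by
      have hi : W ⊓ U i ⊓ (W ⊓ U j) ≤ U i := inf_le_left.trans inf_le_right
      have hj : W ⊓ U i ⊓ (W ⊓ U j) ≤ U j := inf_le_right.trans inf_le_right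
      rw [map_add, map_add, t.res_infl, t.res_infl, (S i).res_s _ _ _ inf_le_left,
        (S j).res_s _ _ _ inf_le_right, resHom_resHom, resHom_resHom,
        hp i j _ (le_inf hi hj), hg i j _ (inf_le_left.trans inf_le_left) hi hj, map_add]
      ring
  refine ⟨x, resHom_ext k (fun i => W ⊓ U i) (fun i => inf_le_left) hcov _ _ fun i => ?_,
    fun i => (S i).coeff_eq inf_le_right (hx i)⟩
  rw [← t.proj_res (t.opn_mono inf_le_left), hx, map_add, (S i).proj_s, t.proj_infl, add_zero]

/-- Two thickenings with the same transition vector fields have isomorphic structure sheaves. -/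
theorem exists_ringEquiv {t' : FlatThickening k X} {S' : ∀ i, t'.Splitting (U i)} (hU : iSup U = ⊤)
    (hp : ∀ i j, (S i).IsTransition (S j) (p i j))
    (hp' : ∀ i j, (S' i).IsTransition (S' j) (p i j)) (W : X.Opens) :
    ∃ Φ : Γ(t'.total, t'.opn W) ≃+* Γ(t.total, t.opn W),
      (∀ x, t.proj W (Φ x) = t'.proj W x) ∧ ∀ x i, coord S (Φ x) i = coord S' x i := by
  -- Both rings consist of the same families `(f, g_i)`, and sums and products are given by the same
  -- formulas in these coordinates.
  choose Φ hΦ hΦ' using fun x : Γ(t'.total, t'.opn W) => exists_coord hU hp (t'.proj W x)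
    (coord S' x) fun i j W' h hi hj => coord_compat hp' x i j h hi hj
  choose Ψ hΨ hΨ' using fun x : Γ(t.total, t.opn W) => exists_coord hU hp' (t.proj W x)
    (coord S x) fun i j W' h hi hj => coord_compat hp x i j h hi hj
  refine ⟨⟨⟨Φ, Ψ, fun x => ?_, fun x => ?_⟩, fun x y => ?_, fun x y => ?_⟩, hΦ, hΦ'⟩
  · exact ext_of_coord S' hU (by rw [hΨ, hΦ]) fun i => by rw [hΨ', hΦ']
  · exact ext_of_coord S hU (by rw [hΦ, hΨ]) fun i => by rw [hΦ', hΨ']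
  · exact ext_of_coord S hU (by rw [map_mul, hΦ, hΦ, hΦ, map_mul]) fun i => by
      rw [coord_mul, hΦ', hΦ', hΦ', hΦ, hΦ, coord_mul]
  · exact ext_of_coord S hU (by rw [map_add, hΦ, hΦ, hΦ, map_add]) fun i => by
      rw [coord_add, hΦ', hΦ', hΦ', coord_add]

end Coord

end FlatThickening

/-- Ring isomorphisms between sections that are compatible with restriction and lie over a
homeomorphism define an isomorphism of schemes. -/
theorem exists_schemeIso {Y Z : Scheme.{u}} (h : Y ≃ₜ Z)
    (ψ : ∀ V : Z.Opens, Γ(Z, V) ≃+* Γ(Y, (⟨h ⁻¹' V, V.2.preimage h.continuous⟩ : Y.Opens)))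
    (hψ : ∀ (V V' : Z.Opens) (i : V' ≤ V) (x : Γ(Z, V)),
      (Y.presheaf.map (homOfLE (fun _ hy => i hy :
        (⟨h ⁻¹' V', V'.2.preimage h.continuous⟩ : Y.Opens) ≤
          ⟨h ⁻¹' V, V.2.preimage h.continuous⟩)).op).hom (ψ V x) =
        ψ V' ((Z.presheaf.map (homOfLE i).op).hom x)) :
    ∃ φ : Y ≅ Z, (∀ y, φ.hom y = h y) ∧ ∀ (V : Z.Opens) (W : Y.Opens) (e : W ≤ φ.hom ⁻¹ᵁ V)
      (e' : W ≤ ⟨h ⁻¹' V, V.2.preimage h.continuous⟩) (x : Γ(Z, V)),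
      (φ.hom.appLE V W e).hom x = (Y.presheaf.map (homOfLE e').op).hom (ψ V x) := by
  let H : Y.toTopCat ≅ Z.toTopCat := TopCat.isoOfHomeo h
  let α : Z.presheaf ≅ (TopCat.Presheaf.pushforward CommRingCat.{u} H.hom).obj Y.presheaf :=
    NatIso.ofComponents (fun V => (ψ V.unop).toCommRingCatIso) fun {V V'} i =>
      CommRingCat.hom_ext (RingHom.ext fun x => (hψ V.unop V'.unop i.unop.le x).symm)
  let P : Y.toPresheafedSpace ≅ Z.toPresheafedSpace := PresheafedSpace.isoOfComponents H α.symm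
  let Q : Y.toSheafedSpace ≅ Z.toSheafedSpace := SheafedSpace.isoMk P
  let φ : Y ≅ Z := Scheme.fullyFaithfulForgetToLocallyRingedSpace.preimageIso
    (LocallyRingedSpace.isoOfSheafedSpaceIso Q)
  exact ⟨φ, fun y => rfl, fun V W e e' x => rfl⟩

/-! ### From isomorphisms of structure sheaves to isomorphisms of thickenings. -/

namespace FlatThickening

variable {k : Type u} [Field k] {X : Scheme.{u}} [X.Over (Spec (.of k))] {t t' : FlatThickening k X}

theorem homeo_symm_incl (x : X) : t.homeo.symm (t.incl x) = x := t.homeo.symm_apply_apply x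

/-- An isomorphism of structure sheaves of thickenings, compatible with the reduction maps, comes
from an isomorphism of schemes. -/
theorem exists_iso (Φ : ∀ W : X.Opens, Γ(t'.total, t'.opn W) ≃+* Γ(t.total, t.opn W))
    (hres : ∀ (W W' : X.Opens) (h : W' ≤ W) x, resHom k[ε] (t.opn_mono h) (Φ W x) =
      Φ W' (resHom k[ε] (t'.opn_mono h) x))
    (halg : ∀ W c, Φ W (algebraMap k[ε] _ c) = algebraMap k[ε] _ c)
    (hproj : ∀ W x, t.proj W (Φ W x) = t'.proj W x) :
    ∃ φ : t.total ≅ t'.total, φ.hom ≫ (t'.total ↘ Spec (.of k[ε])) = t.total ↘ Spec (.of k[ε]) ∧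
      t.incl ≫ φ.hom = t'.incl ∧ ∀ (W : X.Opens) (e : t.opn W ≤ φ.hom ⁻¹ᵁ t'.opn W) x,
        (φ.hom.appLE _ _ e).hom x = Φ W x := by
  let h : t.total ≃ₜ t'.total := t.homeo.symm.trans t'.homeo
  have hcast : ∀ V : t'.total.Opens, t'.opn (t'.incl ⁻¹ᵁ V) = V := t'.opn_incl_preimage
  -- An open set and `opn` of its closed fibre are equal, though not by definition. The map `r`
  -- identifies their sections.
  let r : ∀ V : t'.total.Opens, Γ(t'.total, V) ≃+* Γ(t'.total, t'.opn (t'.incl ⁻¹ᵁ V)) := fun V =>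
    { (resHom k[ε] (hcast V).le : Γ(t'.total, V) →+* _) with
      invFun := resHom k[ε] (hcast V).ge
      left_inv := fun x => (resHom_resHom k[ε] _ _ x).trans (resHom_refl k[ε] _ x)
      right_inv := fun x => (resHom_resHom k[ε] _ _ x).trans (resHom_refl k[ε] _ x) }
  have hr : ∀ V x, r V x = resHom k[ε] (hcast V).le x := fun V x => rfl
  obtain ⟨φ, hφ, hφ'⟩ := exists_schemeIso h (fun V => (r V).trans (Φ (t'.incl ⁻¹ᵁ V)))
    (fun V V' i x => by
      refine (hres _ _ (t'.incl.preimage_mono i) _).trans (congrArg (Φ (t'.incl ⁻¹ᵁ V')) ?_)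
      exact (resHom_resHom k[ε] _ _ x).trans (resHom_resHom k[ε] _ _ x).symm)
  have key : ∀ (V : t'.total.Opens) (W : X.Opens) (hW : W ≤ t'.incl ⁻¹ᵁ V)
      (e : t.opn W ≤ φ.hom ⁻¹ᵁ V) (x : Γ(t'.total, V)), (φ.hom.appLE V (t.opn W) e).hom x =
        Φ W (resHom k[ε] ((t'.opn_mono hW).trans (hcast V).le) x) := fun V W hW e x => by
    refine (hφ' V (t.opn W) e (t.opn_mono hW) x).trans ?_
    refine (hres _ _ hW _).trans (congrArg (Φ W) ?_)
    exact resHom_resHom k[ε] _ _ x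
  have hpt : ∀ x : X, φ.hom (t.incl x) = t'.incl x := fun x => by
    rw [hφ]
    change t'.incl (t.homeo.symm (t.incl x)) = _
    rw [homeo_symm_incl]
  have hle : ∀ (V : t'.total.Opens), t.opn (t'.incl ⁻¹ᵁ V) ≤ φ.hom ⁻¹ᵁ V := fun V => by
    rw [← t.incl_preimage_le_iff, incl_preimage_opn]
    intro x hx
    change φ.hom (t.incl x) ∈ V
    rw [hpt]; exact hx
  refine ⟨φ, ?_, ?_, fun W e x => ?_⟩
  -- The target `Spec k[ε]` is affine, so the two morphisms are compared on global functions, where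
  -- `halg` applies.
  · refine ext_of_isAffine ?_
    rw [← cancel_epi (Scheme.ΓSpecIso (.of k[ε])).inv]
    refine CommRingCat.hom_ext (RingHom.ext fun (c : k[ε]) => ?_)
    have h1 : (φ.hom.appLE ⊤ ⊤ le_top).hom (algebraMap k[ε] Γ(t'.total, ⊤) c) =
        algebraMap k[ε] Γ(t.total, ⊤) c :=
      (key ⊤ ⊤ le_top le_top _).trans ((congrArg (Φ ⊤) (AlgHom.commutes _ c)).trans (halg ⊤ c))
    have h2 : ∀ (Y : Scheme.{u}) [Y.Over (Spec (.of k[ε]))], algebraMap k[ε] Γ(Y, ⊤) c =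
        ((Scheme.ΓSpecIso (.of k[ε])).inv ≫ (Y ↘ Spec (.of k[ε])).appTop).hom c := fun Y _ =>
      congrArg (fun g => ((Scheme.ΓSpecIso (.of k[ε])).inv ≫ g).hom c) (Scheme.Hom.appLE_eq_app _)
    refine Eq.trans ?_ ((h1.trans (h2 t.total)))
    rw [h2 t'.total]
    exact congrArg (fun g : Γ(t'.total, ⊤) ⟶ Γ(t.total, ⊤) => g.hom
      (((Scheme.ΓSpecIso (.of k[ε])).inv ≫ (t'.total ↘ Spec (.of k[ε])).appTop).hom c))
      (Scheme.Hom.appLE_eq_app φ.hom (U := ⊤)).symm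
  · refine Scheme.Hom.ext (TopCat.ext fun x => hpt x) fun V => ?_
    refine CommRingCat.hom_ext (RingHom.ext fun x => ?_)
    have h1 : (t.incl ≫ φ.hom).appLE V (t'.incl ⁻¹ᵁ V) (le_trans (t.incl_preimage_opn _).ge
          (t.incl.preimage_mono (hle V))) =
        φ.hom.appLE V (t.opn (t'.incl ⁻¹ᵁ V)) (hle V) ≫ t.incl.appLE (t.opn (t'.incl ⁻¹ᵁ V))
          (t'.incl ⁻¹ᵁ V) (t.incl_preimage_opn _).ge := (Scheme.Hom.appLE_comp_appLE ..).symm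
    refine (ConcreteCategory.congr_hom h1 x).trans ?_
    refine (congrArg (t.proj _) (key V _ le_rfl (hle V) x)).trans ?_
    rw [hproj, proj_eq, ← t'.res_red (hcast V).le, resHom_resHom]
    exact resHom_refl k _ _
  · rw [key _ W (t'.incl_preimage_opn W).ge, resHom_refl]

end FlatThickening

theorem resHom_injective {R : Type u} [CommRing R] {X : Scheme.{u}} [X.Over (Spec (.of R))]
    {U V : X.Opens} (h : V = U) : Function.Injective (resHom R h.le : Γ(X, U) →ₐ[R] Γ(X, V)) := by
  subst h
  intro x y hxy
  rwa [resHom_refl, resHom_refl] at hxy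

/-! ### Injectivity: deformations with the same class are isomorphic. -/

namespace PoissonDeformation

open FlatThickening

variable {k : Type u} [Field k] {X : Scheme.{u}} [X.Over (Spec (.of k))] {Λ₀ : PoissonStructure k X}
  {ξ η : FirstOrderPoissonDeformation Λ₀}

/-- Expand `{f + ε g, f' + ε g'}` for the bracket `Λ₀ + ε Q`; the bracket of two elements of `ε 𝒪`
vanishes. -/
theorem IsBivector.coeff_bracket {U : X.Opens} {S : ξ.thickening.Splitting U}
    {Q : PolyvectorField k X 2 U} (hQ : IsBivector S Q) {W : X.Opens} (h : W ≤ U)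
    (x y : Γ(ξ.thickening.total, ξ.thickening.opn W)) :
    S.coeff h ((ξ.poisson.bracket _).br x y) =
      (Λ₀.bracket W).br (ξ.thickening.proj W x) (S.coeff h y) +
        (Λ₀.bracket W).br (S.coeff h x) (ξ.thickening.proj W y) +
        Q.eval h ![ξ.thickening.proj W x, ξ.thickening.proj W y] := by
  refine S.coeff_eq h (f := (Λ₀.bracket W).br (ξ.thickening.proj W x) (ξ.thickening.proj W y)) ?_
  have h1 := hQ W h (ξ.thickening.proj W x) (ξ.thickening.proj W y)
  have h2 : (ξ.poisson.bracket _).br x y = (ξ.poisson.bracket _).br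
      (S.s W h (ξ.thickening.proj W x) + ξ.thickening.infl W (S.coeff h x))
      (S.s W h (ξ.thickening.proj W y) + ξ.thickening.infl W (S.coeff h y)) := by
    rw [← S.eq_add, ← S.eq_add]
  rw [h2, map_add, map_add, LinearMap.add_apply, LinearMap.add_apply, h1, bracket_infl_left,
    bracket_infl_right, bracket_infl_left, S.proj_s, S.proj_s, ξ.thickening.proj_infl, map_zero,
    map_zero, map_add, map_add]
  ring

theorem IsBivector.restrict {U U' : X.Opens} {S : ξ.thickening.Splitting U}
    {Q : PolyvectorField k X 2 U} (hQ : IsBivector S Q) (h : U' ≤ U) :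
    IsBivector (S.restrict h) (PolyvectorField.res h Q) :=
  fun W hW f g => hQ W (hW.trans h) f g

/-- Replacing `S` by `S + ε q` adds `[Λ₀, q]` to the bivector field. This is why a coboundary does
not change the deformation. -/
theorem IsBivector.twist {U : X.Opens} {S : ξ.thickening.Splitting U}
    {Q Q' : PolyvectorField k X 2 U} (hQ : IsBivector S Q) (q : PolyvectorField k X 1 U)
    (h : Λ₀.lichSections 1 U q = Q' - Q) : IsBivector (S.twist q) Q' := fun W hW f g => by
  have h1 := (Λ₀.lichSections_one_eq_iff q (Q' - Q)).1 h W hW f g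
  have h2 : (Q' - Q).eval hW ![f, g] = Q'.eval hW ![f, g] - Q.eval hW ![f, g] := rfl
  have h3 : Q'.eval hW ![f, g] = Q.eval hW ![f, g] + (Λ₀.bracket W).br (q.eval hW ![f]) g +
      (Λ₀.bracket W).br f (q.eval hW ![g]) - q.eval hW ![(Λ₀.bracket W).br f g] := by
    linear_combination h1 - h2
  rw [S.twist_s, S.twist_s, S.twist_s, map_add, map_add, LinearMap.add_apply, LinearMap.add_apply,
    hQ W hW f g, bracket_infl_left, bracket_infl_right, bracket_infl_left, S.proj_s, S.proj_s,
    ξ.thickening.proj_infl, map_zero, map_zero, h3, map_sub, map_add, map_add]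
  ring

variable {I : Type u} {U : I → X.Opens}

theorem coord_bracket {S : ∀ i, ξ.thickening.Splitting (U i)}
    {Q : ∀ i, PolyvectorField k X 2 (U i)} (hQ : ∀ i, IsBivector (S i) (Q i)) {W : X.Opens}
    (x y : Γ(ξ.thickening.total, ξ.thickening.opn W)) (i : I) :
    coord S ((ξ.poisson.bracket _).br x y) i =
      (Λ₀.bracket _).br (resHom k inf_le_left (ξ.thickening.proj W x)) (coord S y i) +
        (Λ₀.bracket _).br (coord S x i) (resHom k inf_le_left (ξ.thickening.proj W y)) +
        (Q i).eval inf_le_right ![resHom k inf_le_left (ξ.thickening.proj W x),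
          resHom k inf_le_left (ξ.thickening.proj W y)] := by
  have h1 := (hQ i).coeff_bracket (inf_le_right : W ⊓ U i ≤ U i)
    (resHom k[ε] (ξ.thickening.opn_mono inf_le_left) x)
    (resHom k[ε] (ξ.thickening.opn_mono inf_le_left) y)
  rw [ξ.thickening.proj_res, ξ.thickening.proj_res] at h1
  refine Eq.trans ?_ h1
  exact congrArg ((S i).coeff inf_le_right) (ξ.poisson.res_bracket _ x y)

/-- Two deformations given by the same vector fields and bivector fields are isomorphic. -/
theorem isomorphic_of_isTransition (hU : iSup U = ⊤) {S : ∀ i, ξ.thickening.Splitting (U i)}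
    {S' : ∀ i, η.thickening.Splitting (U i)} {p : ∀ i j, PolyvectorField k X 1 (U i ⊓ U j)}
    (hp : ∀ i j, (S i).IsTransition (S j) (p i j)) (hp' : ∀ i j, (S' i).IsTransition (S' j) (p i j))
    {Q : ∀ i, PolyvectorField k X 2 (U i)} (hQ : ∀ i, IsBivector (S i) (Q i))
    (hQ' : ∀ i, IsBivector (S' i) (Q i)) : Isomorphic ξ η := by
  choose Φ hΦ hΦ' using exists_ringEquiv hU hp hp'
  obtain ⟨φ, h1, h2, h3⟩ := FlatThickening.exists_iso (t := ξ.thickening) (t' := η.thickening) Φ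
    (fun W W' h x => ext_of_coord S hU
      (by rw [ξ.thickening.proj_res, hΦ, hΦ, η.thickening.proj_res])
      fun i => by rw [coord_res S h, hΦ', hΦ', coord_res S' h])
    (fun W c => ext_of_coord S hU
      (by rw [hΦ, η.thickening.proj_algebraMap, ξ.thickening.proj_algebraMap])
      fun i => by rw [hΦ', coord_algebraMap, coord_algebraMap]) hΦ
  refine ⟨φ, h1, h2, fun V a b => ?_⟩
  obtain ⟨W, rfl⟩ : ∃ W, V = η.thickening.opn W := ⟨_, (η.thickening.opn_incl_preimage V).symm⟩
  have hW := preimage_opn_of_incl_comp φ h2 W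
  refine resHom_injective (R := k[ε]) hW.symm ?_
  rw [ξ.poisson.res_bracket]
  refine (h3 W hW.ge _).trans (Eq.trans ?_
    (congrArg₂ (fun x y => (ξ.poisson.bracket _).br x y) (h3 W hW.ge a) (h3 W hW.ge b)).symm)
  refine ext_of_coord S hU ?_ fun i => ?_
  · rw [hΦ, proj_bracket, proj_bracket, hΦ, hΦ]
  · rw [hΦ', coord_bracket hQ, coord_bracket hQ', hΦ', hΦ', hΦ, hΦ]

/-- Deformations whose Čech cocycles have the same class are isomorphic. -/
theorem isomorphic_of_isCechClass (D : CechData ξ) (D' : CechData η)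
    {c : hypercohomology Λ₀.truncatedComplex 1}
    (hc : IsCechClass (F := Λ₀.truncatedComplex) D.U D.p (fun i => -D.Λ i) c)
    (hc' : IsCechClass (F := Λ₀.truncatedComplex) D'.U D'.p (fun i => -D'.Λ i) c) :
    Isomorphic ξ η := by
  obtain ⟨(q : ∀ i j, PolyvectorField k X 1 (D.U i ⊓ D'.U j)), hq, hq1, hq2⟩ :=
    hc.exists_comparison D.isCechCocycle D'.isCechCocycle hc'
  have hq : ∀ i j, Λ₀.lichSections 1 _ (q i j) = PolyvectorField.res inf_le_left (-D.Λ i) -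
      PolyvectorField.res inf_le_right (-D'.Λ j) := fun i j =>
    (Λ₀.sectionsMap_d_zero_one _).symm.trans (hq i j)
  let V : D.I × D'.I → X.Opens := fun l => D.U l.1 ⊓ D'.U l.2
  -- On the common refinement the splittings of `ξ` are twisted by `q`. The data of `ξ` then equal
  -- those of `η`, and not merely up to a coboundary.
  let S : ∀ l, ξ.thickening.Splitting (V l) := fun l =>
    ((D.splitting l.1).restrict inf_le_left).twist (q l.1 l.2)
  let S' : ∀ l, η.thickening.Splitting (V l) := fun l => (D'.splitting l.2).restrict inf_le_right
  have hV : iSup V = ⊤ := by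
    rw [iSup_prod]
    change ⨆ i, ⨆ j, D.U i ⊓ D'.U j = ⊤
    simp only [← inf_iSup_eq, D'.iSup_eq_top, inf_top_eq, D.iSup_eq_top]
  refine isomorphic_of_isTransition hV (S := S) (S' := S')
    (p := fun l m => PolyvectorField.res (inf_le_inf inf_le_right inf_le_right) (D'.p l.2 m.2))
    (Q := fun l => PolyvectorField.res inf_le_right (D'.Λ l.2)) ?_ ?_ ?_ ?_
  · intro l m W h f
    have hl1 : W ≤ D.U l.1 := h.trans (inf_le_left.trans inf_le_left)
    have hl2 : W ≤ D'.U l.2 := h.trans (inf_le_left.trans inf_le_right)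
    have hm1 : W ≤ D.U m.1 := h.trans (inf_le_right.trans inf_le_left)
    have hm2 : W ≤ D'.U m.2 := h.trans (inf_le_right.trans inf_le_right)
    -- Both relations compute `q` at the mixed index `(l.1, m.2)`. Equating them shows that the
    -- twisted transition `p + q_m - q_l` is the transition `p'` of `η`.
    have h1 : (q l.1 m.2).eval (le_inf hl1 hm2) ![f] =
        (D.p l.1 m.1).eval (le_inf hl1 hm1) ![f] + (q m.1 m.2).eval (le_inf hm1 hm2) ![f] :=
      congrArg (fun P : PolyvectorField k X 1 W => P.eval le_rfl ![f])
        (hq1 l.1 m.1 m.2 W (le_inf hl1 hm1) (le_inf hm1 hm2) (le_inf hl1 hm2))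
    have h2 : (q l.1 m.2).eval (le_inf hl1 hm2) ![f] =
        (q l.1 l.2).eval (le_inf hl1 hl2) ![f] + (D'.p l.2 m.2).eval (le_inf hl2 hm2) ![f] :=
      congrArg (fun P : PolyvectorField k X 1 W => P.eval le_rfl ![f])
        (hq2 l.1 l.2 m.2 W (le_inf hl1 hl2) (le_inf hl2 hm2) (le_inf hl1 hm2))
    have h3 := D.isTransition l.1 m.1 W (le_inf hl1 hm1) f
    have h4 := congrArg (ξ.thickening.infl W) (h1.symm.trans h2)
    rw [map_add, map_add] at h4
    change (D.splitting m.1).s W hm1 f + ξ.thickening.infl W ((q m.1 m.2).eval _ ![f]) =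
      ((D.splitting l.1).s W hl1 f + ξ.thickening.infl W ((q l.1 l.2).eval _ ![f])) +
        ξ.thickening.infl W ((D'.p l.2 m.2).eval _ ![f])
    linear_combination h3 + h4
  · intro l m W h f
    exact D'.isTransition l.2 m.2 W (h.trans (inf_le_inf inf_le_right inf_le_right)) f
  · intro l
    refine ((D.isBivector l.1).restrict inf_le_left).twist (q l.1 l.2) ?_
    refine (hq l.1 l.2).trans ?_
    rw [map_neg, map_neg]
    abel
  · intro l W h f g
    exact D'.isBivector l.2 W (h.trans inf_le_right) f g

end PoissonDeformation

/-! ### Construction of the bracket `Λ₀ + ε Q` on a thickening. -/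

theorem PolyvectorField.eval_two_algebraMap {R : Type u} [CommRing R] {X : Scheme.{u}}
    [X.Over (Spec (.of R))] {U V : X.Opens} (P : PolyvectorField R X 2 U) (h : V ≤ U) (c : R)
    (f : Γ(X, V)) : P.eval h ![algebraMap R _ c, f] = 0 := by
  have h1 := P.eval_two_mul h 1 1 f
  rw [one_mul, one_mul] at h1
  rw [Algebra.algebraMap_eq_smul_one, eval_two_smul, left_eq_add.1 h1]
  exact smul_zero (A := Γ(X, V)) c

namespace FlatThickening

variable {k : Type u} [Field k] {X : Scheme.{u}} [X.Over (Spec (.of k))] {t : FlatThickening k X}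
  {I : Type u} {U : I → X.Opens} {S : ∀ i, t.Splitting (U i)}
  {p : ∀ i j, PolyvectorField k X 1 (U i ⊓ U j)} {Λ₀ : PoissonStructure k X}
  {Q : ∀ i, PolyvectorField k X 2 (U i)}

theorem coord_zero (W : X.Opens) (i : I) : coord S (0 : Γ(t.total, t.opn W)) i = 0 := by
  have := coord_add S (0 : Γ(t.total, t.opn W)) 0 i
  rwa [add_zero, left_eq_add] at this

/-- The local coefficient of `ε` in the bracket `Λ₀ + ε Q`. -/
noncomputable def coordBracket (S : ∀ i, t.Splitting (U i)) (Λ₀ : PoissonStructure k X)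
    (Q : ∀ i, PolyvectorField k X 2 (U i)) {W : X.Opens} (x y : Γ(t.total, t.opn W)) (i : I) :
    Γ(X, W ⊓ U i) :=
  (Λ₀.bracket _).br (resHom k inf_le_left (t.proj W x)) (coord S y i) +
    (Λ₀.bracket _).br (coord S x i) (resHom k inf_le_left (t.proj W y)) +
    (Q i).eval inf_le_right ![resHom k inf_le_left (t.proj W x), resHom k inf_le_left (t.proj W y)]

theorem res_coordBracket {W : X.Opens} (x y : Γ(t.total, t.opn W)) (i : I) {W' : X.Opens}
    (h : W' ≤ W ⊓ U i) : resHom k h (coordBracket S Λ₀ Q x y i) =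
      (Λ₀.bracket _).br (resHom k (h.trans inf_le_left) (t.proj W x)) (resHom k h (coord S y i)) +
      (Λ₀.bracket _).br (resHom k h (coord S x i)) (resHom k (h.trans inf_le_left) (t.proj W y)) +
      (Q i).eval (h.trans inf_le_right) ![resHom k (h.trans inf_le_left) (t.proj W x),
        resHom k (h.trans inf_le_left) (t.proj W y)] := by
  rw [coordBracket, map_add, map_add, Λ₀.res_bracket, Λ₀.res_bracket,
    PolyvectorField.res_eval_two, resHom_resHom, resHom_resHom]

/-- The local brackets `Λ₀ + ε Q_i` agree on overlaps: a change of coordinates from `j` to `i`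
produces the terms of `[Λ₀, p_ij]`, which `Q_j - Q_i` cancels. -/
theorem exists_br (hU : iSup U = ⊤) (hp : ∀ i j, (S i).IsTransition (S j) (p i j))
    (hQ : Λ₀.IsCocycle U p Q) {W : X.Opens} (x y : Γ(t.total, t.opn W)) :
    ∃ z : Γ(t.total, t.opn W), t.proj W z = (Λ₀.bracket W).br (t.proj W x) (t.proj W y) ∧
      ∀ i, coord S z i = coordBracket S Λ₀ Q x y i := by
  refine exists_coord hU hp _ _ fun i j W' h hi hj => ?_
  rw [res_coordBracket, res_coordBracket, Λ₀.res_bracket, coord_compat hp x i j h hi hj,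
    coord_compat hp y i j h hi hj, map_add, map_add, LinearMap.add_apply]
  linear_combination -(hQ.sub_eq i j W' hi hj (resHom k h (t.proj W x)) (resHom k h (t.proj W y)))

/-- Each axiom is checked on reductions, where it holds for `Λ₀`, and on `ε`-coefficients. Linearity
over `k[ε]` follows from the Leibniz rule once the bracket is known to vanish on constants. -/
theorem exists_poissonBracket (hU : iSup U = ⊤) (hp : ∀ i j, (S i).IsTransition (S j) (p i j))
    (hQ : Λ₀.IsCocycle U p Q) (W : X.Opens) :
    ∃ B : PoissonBracket k[ε] Γ(t.total, t.opn W),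
      (∀ x y, t.proj W (B.br x y) = (Λ₀.bracket W).br (t.proj W x) (t.proj W y)) ∧
      ∀ x y i, coord S (B.br x y) i = coordBracket S Λ₀ Q x y i := by
  choose b hb hb' using fun x y : Γ(t.total, t.opn W) => exists_br hU hp hQ x y
  have hskew : ∀ x y, b x y = -b y x := fun x y => by
    rw [eq_neg_iff_add_eq_zero]
    refine ext_of_coord S hU ?_ fun i => ?_
    · rw [map_add, hb, hb, PoissonBracket.skew, map_zero, neg_add_cancel]
    · rw [coord_add, hb', hb', coord_zero, coordBracket, coordBracket, PoissonBracket.skew _ _ (coord S y i),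
        PoissonBracket.skew _ (coord S x i), PolyvectorField.eval_two_skew]
      ring
  have hadd : ∀ x y z, b (x + y) z = b x z + b y z := fun x y z => by
    refine ext_of_coord S hU ?_ fun i => ?_
    · rw [map_add, hb, hb, hb, map_add, map_add, LinearMap.add_apply]
    · rw [coord_add, hb', hb', hb', coordBracket, coordBracket, coordBracket, map_add, map_add,
        coord_add, PolyvectorField.eval_two_add, map_add, map_add, LinearMap.add_apply,
        LinearMap.add_apply]
      ring
  have hmul : ∀ x y z, b (x * y) z = x * b y z + y * b x z := fun x y z => by
    refine ext_of_coord S hU ?_ fun i => ?_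
    · rw [map_add, map_mul, map_mul, hb, hb, hb, map_mul, PoissonBracket.leibniz]
    · rw [coord_add, coord_mul, coord_mul, hb', hb', hb', hb, hb, coordBracket, coordBracket,
        coordBracket, map_mul, map_mul, coord_mul, PolyvectorField.eval_two_mul,
        PoissonBracket.leibniz, map_add, LinearMap.add_apply, PoissonBracket.leibniz,
        PoissonBracket.leibniz, Λ₀.res_bracket, Λ₀.res_bracket]
      ring
  have hconst : ∀ (c : k[ε]) z, b (algebraMap k[ε] _ c) z = 0 := fun c z => by
    have hc : ∀ (V : X.Opens) (a : k) (f : Γ(X, V)), (Λ₀.bracket V).br (algebraMap k _ a) f = 0 :=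
      fun V a f => by
        have h1 := (Λ₀.bracket V).leibniz 1 1 f
        have h2 : (Λ₀.bracket V).br 1 f = 0 := by
          rw [one_mul, one_mul] at h1
          exact left_eq_add.1 h1
        rw [Algebra.algebraMap_eq_smul_one]
        exact (LinearMap.map_smul₂ _ _ _ _).trans (by rw [h2]; exact smul_zero (A := Γ(X, V)) a)
    refine ext_of_coord S hU ?_ fun i => ?_
    · rw [hb, t.proj_algebraMap, hc, map_zero]
    · rw [hb', coordBracket, t.proj_algebraMap, AlgHom.commutes, coord_algebraMap, hc, hc,
        PolyvectorField.eval_two_algebraMap, add_zero, add_zero, coord_zero]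
  have hsmul : ∀ (c : k[ε]) x z, b (c • x) z = c • b x z := fun c x z => by
    rw [Algebra.smul_def, hmul, hconst, mul_zero, add_zero, Algebra.smul_def]
  refine ⟨⟨LinearMap.mk₂ k[ε] b hadd hsmul (fun x y z => ?_) (fun c x y => ?_), fun x => ?_, hmul,
    fun x y z => ?_⟩, hb, hb'⟩
  · rw [hskew, hadd, hskew y x, hskew z x]
    ring
  · rw [hskew, hsmul, hskew y x]
    exact (congrArg Neg.neg (smul_neg (A := Γ(t.total, t.opn W)) c _)).trans (neg_neg _)
  · refine ext_of_coord S hU ?_ fun i => ?_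
    · change t.proj W (b x x) = _
      rw [hb, PoissonBracket.self, map_zero]
    · change coord S (b x x) i = _
      rw [hb', coordBracket, PoissonBracket.skew, PolyvectorField.eval_two_self, coord_zero]
      ring
  · change b x (b y z) + b y (b z x) + b z (b x y) = 0
    refine ext_of_coord S hU ?_ fun i => ?_
    · rw [map_add, map_add, hb, hb, hb, hb, hb, hb, PoissonBracket.jacobi, map_zero]
    · rw [coord_add, coord_add, hb', hb', hb', coord_zero]
      simp only [coordBracket, hb, hb', Λ₀.res_bracket, map_add]
      -- The `ε`-coefficient of the Jacobi sum consists of three Jacobi sums of `Λ₀`, each with one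
      -- argument replaced by its `ε`-coefficient, and the linearized Jacobi identity of `Q i`.
      have h1 := (Λ₀.bracket _).jacobi (coord S x i) (resHom k inf_le_left (t.proj W y))
        (resHom k inf_le_left (t.proj W z))
      have h2 := (Λ₀.bracket _).jacobi (resHom k inf_le_left (t.proj W x)) (coord S y i)
        (resHom k inf_le_left (t.proj W z))
      have h3 := (Λ₀.bracket _).jacobi (resHom k inf_le_left (t.proj W x))
        (resHom k inf_le_left (t.proj W y)) (coord S z i)
      have h4 := hQ.jacobi i _ inf_le_right (resHom k inf_le_left (t.proj W x))
        (resHom k inf_le_left (t.proj W y)) (resHom k inf_le_left (t.proj W z))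
      linear_combination h1 + h2 + h3 + h4

/-- A Poisson bracket on the sections over the open sets `t.opn W`. -/
theorem exists_poissonStructure
    (B : ∀ W : X.Opens, PoissonBracket k[ε] Γ(t.total, t.opn W))
    (hB : ∀ (W W' : X.Opens) (h : W' ≤ W) x y, resHom k[ε] (t.opn_mono h) ((B W).br x y) =
      (B W').br (resHom k[ε] (t.opn_mono h) x) (resHom k[ε] (t.opn_mono h) y)) :
    ∃ P : PoissonStructure k[ε] t.total, ∀ W, P.bracket (t.opn W) = B W := by
  have key : ∀ (W W' : X.Opens) (e : t.opn W' = t.opn W), e ▸ B W' = B W := fun W W' e => by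
    obtain rfl : W' = W := by
      rw [← t.incl_preimage_opn W, ← t.incl_preimage_opn W', e]
    rfl
  have hV : ∀ V : t.total.Opens, ∃ W, V = t.opn W := fun V => ⟨_, (t.opn_incl_preimage V).symm⟩
  -- Each open set is `opn` of its closed fibre, and the bracket is transported along that equality.
  -- By `key` the transport is harmless on the sets `t.opn W`.
  let P : ∀ V : t.total.Opens, PoissonBracket k[ε] Γ(t.total, V) := fun V =>
    t.opn_incl_preimage V ▸ B (t.incl ⁻¹ᵁ V)
  have hP : ∀ W, P (t.opn W) = B W := fun W => key _ _ _
  refine ⟨⟨P, fun {V V'} h f g => ?_⟩, hP⟩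
  obtain ⟨W, rfl⟩ := hV V
  obtain ⟨W', rfl⟩ := hV V'
  rw [hP, hP]
  exact hB W W' (t.le_of_opn_le h) f g

variable (t) in
/-- A flat thickening with a Poisson structure lifting `Λ₀` is a Poisson deformation. -/
def withPoisson (P : PoissonStructure k[ε] t.total) (h : IsPoissonHom t.incl Λ₀ P) :
    FirstOrderPoissonDeformation Λ₀ :=
  { total := t.total, flat := t.flat, poisson := P, incl := t.incl, isPullback := t.isPullback,
    incl_poisson := h }

/-- The Poisson deformation determined by a cocycle of bivector fields on a thickening. -/
theorem exists_poisson_isBivector (hU : iSup U = ⊤)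
    (hp : ∀ i j, (S i).IsTransition (S j) (p i j)) (hQ : Λ₀.IsCocycle U p Q) :
    ∃ (P : PoissonStructure k[ε] t.total) (h : IsPoissonHom t.incl Λ₀ P),
      ∀ i, PoissonDeformation.IsBivector (ξ := t.withPoisson P h) (S i) (Q i) := by
  choose B hB hB' using exists_poissonBracket hU hp hQ
  obtain ⟨P, hP⟩ := exists_poissonStructure B fun W W' h x y => by
    refine ext_of_coord S hU ?_ fun i => ?_
    · rw [t.proj_res, hB, hB, t.proj_res, t.proj_res, Λ₀.res_bracket]
    · rw [coord_res S h, hB', hB', res_coordBracket, coordBracket, coord_res S h, coord_res S h,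
        t.proj_res, t.proj_res, resHom_resHom, resHom_resHom]
  refine ⟨P, fun V x y => ?_, fun i W h f g => ?_⟩
  · obtain ⟨W, rfl⟩ : ∃ W, V = t.opn W := ⟨_, (t.opn_incl_preimage V).symm⟩
    refine resHom_injective (R := k) (t.incl_preimage_opn W).symm ?_
    rw [Λ₀.res_bracket, hP]
    exact hB W x y
  · refine (congrArg (fun C : PoissonBracket k[ε] Γ(t.total, t.opn W) =>
      C.br ((S i).s W h f) ((S i).s W h g)) (hP W)).trans ?_
    change (B W).br ((S i).s W h f) ((S i).s W h g) =
      (S i).s W h ((Λ₀.bracket W).br f g) + t.infl W ((Q i).eval h ![f, g])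
    refine (S i).ext h ?_ ?_
    · rw [hB, (S i).proj_s, (S i).proj_s]
      have h1 : t.proj W ((S i).s W h ((Λ₀.bracket W).br f g) +
          t.infl W ((Q i).eval h ![f, g])) = (Λ₀.bracket W).br f g := by
        rw [map_add, (S i).proj_s, t.proj_infl, add_zero]
      exact h1.symm
    · refine Eq.trans ?_ ((S i).coeff_eq h (x := (S i).s W h ((Λ₀.bracket W).br f g) +
          t.infl W ((Q i).eval h ![f, g])) rfl).symm
      -- As `W ≤ U i`, the set `W ⊓ U i` is `W`, and the coefficient may be read as the coordinate
      -- with index `i`.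
      refine resHom_injective (R := k) (inf_eq_left.2 h) ?_
      have h1 : ∀ x : Γ(t.total, t.opn W), resHom k (inf_le_left : W ⊓ U i ≤ W) ((S i).coeff h x) =
        coord S x i := fun x => ((S i).coeff_res h (t.opn_mono inf_le_left) x).symm
      have h2 : ∀ f : Γ(X, W), coord S ((S i).s W h f) i = 0 := fun f => by
        rw [← h1, (S i).coeff_s, map_zero]
      rw [h1, hB', coordBracket, h2, h2, map_zero, map_zero, LinearMap.zero_apply,
        (S i).proj_s, (S i).proj_s, PolyvectorField.res_eval_two, add_zero, zero_add]

end FlatThickening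

/-! ### The trivial deformation and its class. -/

theorem isCechClass_zero {X : TopCat.{u}} {F : CochainComplex (TopCat.Sheaf AddCommGrpCat.{u} X) ℕ}
    {I : Type u} (U : I → Opens X) : IsCechClass (F := F) U (fun _ _ => 0) (fun _ => 0) 0 := by
  refine ⟨fun _ => 0, 0, fun i j => ?_, fun i => ?_, map_zero _⟩
  · simp only [map_zero, sub_zero]
  · simp only [map_zero, sub_zero]
    exact map_zero _

theorem PoissonStructure.isCocycle_zero {R : Type u} [CommRing R] {X : Scheme.{u}}
    [X.Over (Spec (.of R))] (Λ : PoissonStructure R X) {I : Type u} {U : I → X.Opens} :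
    Λ.IsCocycle U (fun _ _ => 0) (fun _ => 0) where
  cocycle _ _ _ _ _ _ _ _ := (add_zero _).symm
  sub_eq i j W hi hj f g := by
    change (0 : Γ(X, W)) - 0 = (Λ.bracket W).br 0 g + (Λ.bracket W).br f 0 - 0
    rw [map_zero, map_zero, LinearMap.zero_apply, add_zero]
  jacobi i W h f g e := by
    change ((0 : Γ(X, W)) + (Λ.bracket W).br f 0) + (0 + (Λ.bracket W).br g 0) +
      (0 + (Λ.bracket W).br e 0) = 0
    simp only [map_zero, add_zero]

namespace FlatThickening

variable {k : Type u} [Field k] {X : Scheme.{u}} [X.Over (Spec (.of k))]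

theorem Splitting.isTransition_zero {t : FlatThickening k X} {U U' V : X.Opens} (S : t.Splitting V)
    (h : U ≤ V) (h' : U' ≤ V) : (S.restrict h).IsTransition (S.restrict h') 0 :=
  fun W hW f => by
    change S.s W _ f = S.s W _ f + t.infl W 0
    rw [map_zero, add_zero]

section Retraction

variable (t : FlatThickening k X) (r : t.total ⟶ X)

theorem retraction_preimage (hr : t.incl ≫ r = 𝟙 X) (W : X.Opens) : r ⁻¹ᵁ W = t.opn W := by
  rw [← t.opn_incl_preimage (r ⁻¹ᵁ W)]
  congr 1
  change (t.incl ≫ r) ⁻¹ᵁ W = W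
  rw [hr]
  rfl

/-- The splitting given by a retraction of a thickening. -/
noncomputable def splittingOfRetraction (hr : t.incl ≫ r = 𝟙 X)
    (hr' : r ≫ (X ↘ Spec (.of k)) = (t.total ↘ Spec (.of k[ε])) ≫
      Spec.map (CommRingCat.ofHom (algebraMap k k[ε]))) : t.Splitting ⊤ where
  s W _ := (r.appLE W (t.opn W) (t.retraction_preimage r hr W).ge).hom
  s_algebraMap W _ c := appLE_algebraMap r _ hr' _ c
  res_s W W' _ h' f := by
    have : r.appLE W (t.opn W) (t.retraction_preimage r hr W).ge ≫
        t.total.presheaf.map (homOfLE (t.opn_mono h')).op = X.presheaf.map (homOfLE h').op ≫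
          r.appLE W' (t.opn W') (t.retraction_preimage r hr W').ge := by
      rw [Scheme.Hom.appLE_map, Scheme.Hom.map_appLE]
    exact ConcreteCategory.congr_hom this f
  proj_s W _ f := by
    have : r.appLE W (t.opn W) (t.retraction_preimage r hr W).ge ≫
        t.incl.appLE (t.opn W) W (t.incl_preimage_opn W).ge = 𝟙 _ := by
      rw [Scheme.Hom.appLE_comp_appLE]
      exact (appLE_congr_hom hr _ le_rfl).trans
        ((Scheme.Hom.appLE_eq_app _).trans (Scheme.Hom.id_app W))
    exact ConcreteCategory.congr_hom this f

end Retraction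

variable (k X) in
/-- The product of `X` with `Spec k[ε]`. -/
noncomputable def trivial [Smooth (X ↘ Spec (.of k))] : FlatThickening k X :=
  letI π := Spec.map (CommRingCat.ofHom (algebraMap k k[ε]))
  letI σ := Spec.map (CommRingCat.ofHom
    (TrivSqZeroExt.fstHom k k k : k[ε] →ₐ[k] k).toRingHom)
  haveI hσ : σ ≫ π = 𝟙 _ := by
    rw [← Spec.map_comp, ← Spec.map_id]
    rfl
  letI : (Limits.pullback (X ↘ Spec (.of k)) π).Over (Spec (.of k[ε])) := ⟨Limits.pullback.snd _ _⟩
  { total := Limits.pullback (X ↘ Spec (.of k)) π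
    flat := by
      change Flat (Limits.pullback.snd (X ↘ Spec (.of k)) π)
      infer_instance
    incl := Limits.pullback.lift (𝟙 X) ((X ↘ Spec (.of k)) ≫ σ) (by
      rw [Category.assoc, hσ, Category.id_comp, Category.comp_id])
    isPullback := by
      refine IsPullback.of_right (h₁₂ := Limits.pullback.fst (X ↘ Spec (.of k)) π)
        (h₂₂ := π) (v₁₃ := X ↘ Spec (.of k)) ?_ (Limits.pullback.lift_snd _ _ _)
        (IsPullback.of_hasPullback _ _)
      rw [Limits.pullback.lift_fst]
      change IsPullback _ _ _ (σ ≫ π)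
      rw [hσ]
      exact IsPullback.of_horiz_isIso ⟨by simp⟩ }

variable [Smooth (X ↘ Spec (.of k))]

variable (k X) in
/-- The projection of `X × Spec k[ε]` to `X`. -/
noncomputable def trivialRetraction : (trivial k X).total ⟶ X := Limits.pullback.fst _ _

theorem incl_trivialRetraction : (trivial k X).incl ≫ trivialRetraction k X = 𝟙 X :=
  Limits.pullback.lift_fst _ _ _

theorem isPullback_trivialRetraction : IsPullback (trivialRetraction k X)
    ((trivial k X).total ↘ Spec (.of k[ε])) (X ↘ Spec (.of k))
    (Spec.map (CommRingCat.ofHom (algebraMap k k[ε]))) :=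
  IsPullback.of_hasPullback _ _

variable (k X) in
/-- The canonical splitting of `X × Spec k[ε]`. -/
noncomputable def trivialSplitting : (trivial k X).Splitting ⊤ :=
  (trivial k X).splittingOfRetraction (trivialRetraction k X) incl_trivialRetraction
    isPullback_trivialRetraction.w

end FlatThickening

namespace PoissonDeformation

open FlatThickening

variable {k : Type u} [Field k] {X : Scheme.{u}} [X.Over (Spec (.of k))] {Λ₀ : PoissonStructure k X}
  {ξ η : FirstOrderPoissonDeformation Λ₀}

theorem IsTrivial.of_isomorphic (h : Isomorphic ξ η) (hη : η.IsTrivial) : ξ.IsTrivial := by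
  obtain ⟨φ, h1, h2, h3⟩ := h
  obtain ⟨r, hr, hr', hr''⟩ := hη
  refine ⟨φ.hom ≫ r, ?_, by rw [← Category.assoc, h2, hr'], h3.comp hr''⟩
  exact IsPullback.of_iso hr φ.symm (Iso.refl _) (Iso.refl _) (Iso.refl _)
    (by simp) ((Category.comp_id _).trans (by rw [← h1]; exact (φ.inv_hom_id_assoc _).symm))
    (by simp) (by simp)

/-- A splitting on all of `X` for which the Poisson structure is constant gives a Čech datum with
vanishing vector fields and bivector fields. -/
theorem exists_cechData_of_splitting (S : ξ.thickening.Splitting ⊤) (hS : IsBivector S 0) :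
    ∃ D : CechData ξ, IsCechClass (F := Λ₀.truncatedComplex) D.U D.p (fun i => -D.Λ i) 0 := by
  refine ⟨CechData.ofSplittings (fun V : X.affineOpens => V.1) (fun V => V.2)
    (iSup_affineOpens_eq_top X) (fun V => S.restrict le_top) (fun V => 0)
    (fun V => ?_) (fun V V' => 0) (fun V V' => S.isTransition_zero _ _), ?_⟩
  · exact hS.restrict le_top
  · have := isCechClass_zero (F := Λ₀.truncatedComplex) (fun V : X.affineOpens => V.1)
    have h : (fun V : X.affineOpens => -(0 : PolyvectorField k X 2 V.1)) = fun _ => 0 :=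
      funext fun _ => neg_zero
    exact (congrArg (fun m => IsCechClass (F := Λ₀.truncatedComplex)
      (fun V : X.affineOpens => V.1) (fun _ _ => 0) m 0) h).mpr this

theorem IsTrivial.exists_cechData (h : ξ.IsTrivial) :
    ∃ D : CechData ξ, IsCechClass (F := Λ₀.truncatedComplex) D.U D.p (fun i => -D.Λ i) 0 := by
  obtain ⟨r, hr, hr', hr''⟩ := h
  refine exists_cechData_of_splitting (ξ.thickening.splittingOfRetraction r hr' hr.w)
    fun W h f g => ?_
  refine (hr''.appLE (ξ.thickening.retraction_preimage r hr' W).ge f g).symm.trans ?_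
  refine (add_zero _).symm.trans (congrArg₂ (· + ·) rfl (map_zero (ξ.thickening.infl W)).symm)

/-- The zero cocycle on the one-element cover defines a bracket on `X × Spec k[ε]` for which the
canonical splitting, hence the projection to `X`, preserves brackets. -/
theorem exists_isTrivial [Smooth (X ↘ Spec (.of k))] (Λ₀ : PoissonStructure k X) :
    ∃ ξ : FirstOrderPoissonDeformation Λ₀, ξ.IsTrivial := by
  obtain ⟨P, hP, hP'⟩ := exists_poisson_isBivector (Λ₀ := Λ₀) (I := PUnit.{u + 1}) (U := fun _ => ⊤)
    (S := fun _ => trivialSplitting k X) (p := fun _ _ => 0) (Q := fun _ => 0)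
    (iSup_const) (fun _ _ => (trivialSplitting k X).isTransition_zero le_rfl le_rfl)
    Λ₀.isCocycle_zero
  refine ⟨(trivial k X).withPoisson P hP, trivialRetraction k X, isPullback_trivialRetraction,
    incl_trivialRetraction, fun V a b => ?_⟩
  have hV := (trivial k X).retraction_preimage (trivialRetraction k X) incl_trivialRetraction V
  refine resHom_injective (R := k[ε]) hV.symm ?_
  refine Eq.trans ?_ (P.res_bracket hV.ge _ _).symm
  refine Eq.trans ?_ (hP' PUnit.unit V le_top a b).symm
  refine (add_zero _).symm.trans (congrArg₂ (· + ·) rfl (map_zero ((trivial k X).infl V)).symm)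

end PoissonDeformation

/-! ### Regluing the structure sheaf of a thickening along `Id + ε p_ij`. -/

namespace FlatThickening

variable {k : Type u} [Field k] {X : Scheme.{u}} [X.Over (Spec (.of k))] (t : FlatThickening k X)
  {I : Type u} {U : I → X.Opens} (p : ∀ i j, PolyvectorField k X 1 (U i ⊓ U j))

/-- The sections over `W` of the structure sheaf obtained by regluing the restrictions of the
thickening `t` to the open sets `U i` along the automorphisms `Id + ε p_ij`. -/
noncomputable def reglued (W : X.Opens) :
    Subring (Γ(X, W) × ∀ i, Γ(t.total, t.opn (W ⊓ U i))) where
  -- The common reduction is kept as a separate component so that `p_ij` can be applied to it. The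
  -- second condition says that on overlaps the component at `i` is the image of the component at
  -- `j` under `Id + ε p_ij`.
  carrier := {x | (∀ i, t.proj _ (x.2 i) = resHom k inf_le_left x.1) ∧
    ∀ i j (W' : X.Opens) (h : W' ≤ W) (hi : W' ≤ U i) (hj : W' ≤ U j),
      resHom k[ε] (t.opn_mono (le_inf h hi)) (x.2 i) =
        resHom k[ε] (t.opn_mono (le_inf h hj)) (x.2 j) +
          t.infl W' ((p i j).eval (le_inf hi hj) ![resHom k h x.1])}
  mul_mem' {x y} hx hy := by
    refine ⟨fun i => ?_, fun i j W' h hi hj => ?_⟩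
    · rw [Prod.snd_mul, Prod.fst_mul, Pi.mul_apply, map_mul, map_mul, hx.1, hy.1]
    · rw [Prod.snd_mul, Prod.fst_mul, Pi.mul_apply, Pi.mul_apply, map_mul, map_mul, map_mul,
        hx.2 i j W' h hi hj, hy.2 i j W' h hi hj, PolyvectorField.eval_one_mul, map_add]
      have h1 : ∀ z ∈ {x : Γ(X, W) × ∀ i, Γ(t.total, t.opn (W ⊓ U i)) |
          ∀ i, t.proj _ (x.2 i) = resHom k inf_le_left x.1}, ∀ f : Γ(X, W'),
          t.infl W' (resHom k h z.1 * f) = resHom k[ε] (t.opn_mono (le_inf h hj)) (z.2 j) *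
            t.infl W' f := fun z hz f => by
        rw [t.mul_infl, t.proj_res, hz j, resHom_resHom]
      rw [h1 x hx.1, h1 y hy.1]
      linear_combination t.infl_mul_infl ((p i j).eval (le_inf hi hj) ![resHom k h x.1])
        ((p i j).eval (le_inf hi hj) ![resHom k h y.1])
  one_mem' := by
    refine ⟨fun i => ?_, fun i j W' h hi hj => ?_⟩
    · rw [Prod.snd_one, Prod.fst_one, Pi.one_apply, map_one, map_one]
    · rw [Prod.snd_one, Prod.fst_one, Pi.one_apply, Pi.one_apply, map_one, map_one, map_one,
        PolyvectorField.eval_one_one, map_zero, add_zero]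
  add_mem' {x y} hx hy := by
    refine ⟨fun i => ?_, fun i j W' h hi hj => ?_⟩
    · rw [Prod.snd_add, Prod.fst_add, Pi.add_apply, map_add, map_add, hx.1, hy.1]
    · rw [Prod.snd_add, Prod.fst_add, Pi.add_apply, Pi.add_apply, map_add, map_add, map_add,
        hx.2 i j W' h hi hj, hy.2 i j W' h hi hj, PolyvectorField.eval_one_add, map_add]
      ring
  zero_mem' := by
    refine ⟨fun i => ?_, fun i j W' h hi hj => ?_⟩
    · rw [Prod.snd_zero, Prod.fst_zero, Pi.zero_apply, map_zero, map_zero]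
    · rw [Prod.snd_zero, Prod.fst_zero, Pi.zero_apply, Pi.zero_apply, map_zero, map_zero, map_zero,
        PolyvectorField.eval_one_zero, map_zero, add_zero]
  neg_mem' {x} hx := by
    refine ⟨fun i => ?_, fun i j W' h hi hj => ?_⟩
    · rw [Prod.snd_neg, Prod.fst_neg, Pi.neg_apply, map_neg, map_neg, hx.1]
    · have h1 := (p i j).eval_one_add (le_inf hi hj) (resHom k h x.1) (-resHom k h x.1)
      rw [add_neg_cancel, PolyvectorField.eval_one_zero] at h1
      rw [Prod.snd_neg, Prod.fst_neg, Pi.neg_apply, Pi.neg_apply, map_neg, map_neg, map_neg,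
        hx.2 i j W' h hi hj, eq_neg_of_add_eq_zero_right h1.symm, map_neg]
      ring

variable {t p}

theorem reglued_proj {W : X.Opens} (x : t.reglued p W) (i : I) :
    t.proj _ (x.1.2 i) = resHom k inf_le_left x.1.1 := x.2.1 i

theorem reglued_compat {W : X.Opens} (x : t.reglued p W) (i j : I) {W' : X.Opens} (h : W' ≤ W)
    (hi : W' ≤ U i) (hj : W' ≤ U j) : resHom k[ε] (t.opn_mono (le_inf h hi)) (x.1.2 i) =
      resHom k[ε] (t.opn_mono (le_inf h hj)) (x.1.2 j) +
        t.infl W' ((p i j).eval (le_inf hi hj) ![resHom k h x.1.1]) := x.2.2 i j W' h hi hj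

/-- Restriction of sections of the reglued structure sheaf. -/
noncomputable def regluedRes {W W' : X.Opens} (h : W' ≤ W) : t.reglued p W →+* t.reglued p W' :=
  RingHom.codRestrict (((resHom k h : Γ(X, W) →+* Γ(X, W')).prodMap
    (RingHom.pi fun i => (resHom k[ε] (t.opn_mono (inf_le_inf_right (U i) h)) :
      Γ(t.total, t.opn (W ⊓ U i)) →+* Γ(t.total, t.opn (W' ⊓ U i))).comp
        (Pi.evalRingHom _ i))).comp (t.reglued p W).subtype) (t.reglued p W') fun x => by
    refine ⟨fun i => ?_, fun i j W'' h' hi hj => ?_⟩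
    · change t.proj _ (resHom k[ε] (t.opn_mono (inf_le_inf_right (U i) h)) (x.1.2 i)) =
        resHom k _ (resHom k h x.1.1)
      rw [t.proj_res, reglued_proj, resHom_resHom, resHom_resHom]
    · change resHom k[ε] _ (resHom k[ε] (t.opn_mono (inf_le_inf_right (U i) h)) (x.1.2 i)) =
        resHom k[ε] _ (resHom k[ε] (t.opn_mono (inf_le_inf_right (U j) h)) (x.1.2 j)) +
          t.infl W'' ((p i j).eval _ ![resHom k _ (resHom k h x.1.1)])
      rw [resHom_resHom, resHom_resHom, resHom_resHom, reglued_compat x i j (h'.trans h) hi hj]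

theorem regluedRes_snd {W W' : X.Opens} (h : W' ≤ W) (x : t.reglued p W) (i : I) :
    (regluedRes h x).1.2 i = resHom k[ε] (t.opn_mono (inf_le_inf_right (U i) h)) (x.1.2 i) := rfl

theorem reglued_ext {W : X.Opens} {x y : t.reglued p W} (h : x.1.1 = y.1.1)
    (h' : ∀ i, x.1.2 i = y.1.2 i) : x = y := Subtype.ext (Prod.ext h (funext h'))

variable (t p) in
/-- The reglued structure sheaf. -/
noncomputable def regluedPresheaf : TopCat.Presheaf CommRingCat.{u} X where
  obj W := .of (t.reglued p W.unop)
  map f := CommRingCat.ofHom (regluedRes f.unop.le)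
  map_id W := CommRingCat.hom_ext (RingHom.ext fun (x : t.reglued p W.unop) =>
    reglued_ext (x := regluedRes le_rfl x) (resHom_refl k _ _) fun _ => resHom_refl k[ε] _ _)
  map_comp {W _ _} f g := CommRingCat.hom_ext (RingHom.ext fun (x : t.reglued p W.unop) =>
    reglued_ext (x := regluedRes (g.unop.le.trans f.unop.le) x)
      (y := regluedRes g.unop.le (regluedRes f.unop.le x)) (resHom_resHom k _ _ _).symm
        fun _ => (resHom_resHom k[ε] _ _ _).symm)

/-- The reductions and the components over each `U i` glue separately, and the two membership
conditions are local. -/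
theorem isSheaf_regluedPresheaf : (t.regluedPresheaf p).IsSheaf := by
  rw [TopCat.Presheaf.isSheaf_iff_isSheafUniqueGluing]
  intro ι V x hx
  change ∀ a, t.reglued p (V a) at x
  have hx' : ∀ a b, regluedRes inf_le_left (x a) = regluedRes inf_le_right (x b) := hx
  have hcov : ∀ i, iSup V ⊓ U i ≤ ⨆ a, V a ⊓ U i := fun i => (iSup_inf_eq _ _).le
  obtain ⟨f, hf⟩ := resHom_glue k V (le_iSup V) le_rfl (fun a => (x a).1.1) fun a b =>
    congrArg (fun z => z.1.1) (hx' a b)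
  have hle : ∀ a i, V a ⊓ U i ≤ iSup V ⊓ U i := fun a i => inf_le_inf_right _ (le_iSup V a)
  have hex : ∀ i, ∃ y : Γ(t.total, t.opn (iSup V ⊓ U i)), ∀ a,
      resHom k[ε] (t.opn_mono (hle a i)) y = (x a).1.2 i := fun i =>
    t.res_glue (fun a => V a ⊓ U i) (fun a => hle a i) (hcov i) (fun a => (x a).1.2 i) fun a b => by
      have h1 := congrArg (fun z => resHom k[ε] (t.opn_mono (le_inf (inf_le_inf inf_le_left
        inf_le_left) (inf_le_left.trans inf_le_right) : V a ⊓ U i ⊓ (V b ⊓ U i) ≤ V a ⊓ V b ⊓ U i))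
          (z.1.2 i)) (hx' a b)
      simp only [regluedRes_snd, resHom_resHom] at h1
      exact h1
  choose y hy using hex
  refine ⟨⟨(f, y), fun i => ?_, fun i j W' h hi hj => ?_⟩, fun a => ?_, fun z hz => ?_⟩
  · refine resHom_ext k (fun a => V a ⊓ U i) (fun a => hle a i) (hcov i) _ _ fun a => ?_
    rw [← t.proj_res (t.opn_mono (hle a i)), hy, reglued_proj, resHom_resHom, ← hf a, resHom_resHom]
  · refine t.res_ext (fun a => W' ⊓ V a) (fun a => inf_le_left)
      (by rw [← inf_iSup_eq]; exact le_inf le_rfl h) _ _ fun a => ?_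
    have h1 := reglued_compat (x a) i j (inf_le_right : W' ⊓ V a ≤ V a) (inf_le_left.trans hi)
      (inf_le_left.trans hj)
    rw [← hy, ← hy, ← hf, resHom_resHom, resHom_resHom, resHom_resHom] at h1
    rw [map_add, t.res_infl, PolyvectorField.res_eval_one, resHom_resHom, resHom_resHom,
      resHom_resHom]
    exact h1
  · exact reglued_ext (hf a) fun i => hy i a
  · have hz' : ∀ a, regluedRes (le_iSup V a) z = x a := hz
    refine reglued_ext ?_ fun i => ?_
    · refine resHom_ext k V (le_iSup V) le_rfl _ _ fun a => ?_
      exact (congrArg (fun z => z.1.1) (hz' a)).trans (hf a).symm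
    · refine t.res_ext (fun a => V a ⊓ U i) (fun a => hle a i) (hcov i) _ _ fun a => ?_
      exact (congrArg (fun z => z.1.2 i) (hz' a)).trans (hy i a).symm

end FlatThickening

theorem isIso_appLE {X Y : Scheme.{u}} (f : X ⟶ Y) [IsOpenImmersion f] {V : Y.Opens} {W : X.Opens}
    (e : W ≤ f ⁻¹ᵁ V) (h : W = f ⁻¹ᵁ V) (hV : V ≤ f.opensRange) : IsIso (f.appLE V W e) := by
  subst h
  rw [Scheme.Hom.appLE_eq_app]
  exact f.isIso_app V hV

/-! ### Charts of the reglued space and the reglued scheme. -/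

namespace FlatThickening

variable {k : Type u} [Field k] {X : Scheme.{u}} [X.Over (Spec (.of k))] {t : FlatThickening k X}
  {I : Type u} {U : I → X.Opens} {p : ∀ i j, PolyvectorField k X 1 (U i ⊓ U j)}

/-- The cocycle condition for vector fields. -/
def IsVectorCocycle (p : ∀ i j, PolyvectorField k X 1 (U i ⊓ U j)) : Prop :=
  ∀ i j l (W : X.Opens) (hi : W ≤ U i) (hj : W ≤ U j) (hl : W ≤ U l) (f : Γ(X, W)),
    (p i l).eval (le_inf hi hl) ![f] =
      (p i j).eval (le_inf hi hj) ![f] + (p j l).eval (le_inf hj hl) ![f]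

/-- The component over `U i` of a section of the reglued structure sheaf. -/
noncomputable def regluedEval (p : ∀ i j, PolyvectorField k X 1 (U i ⊓ U j)) (i : I) (W : X.Opens) :
    t.reglued p W →+* Γ(t.total, t.opn (W ⊓ U i)) :=
  (Pi.evalRingHom _ i).comp ((RingHom.snd _ _).comp (t.reglued p W).subtype)

/-- Over `W ≤ U i` the component at `i` determines the reduction, and then the gluing relation
determines every other component. -/
theorem regluedEval_injective (i : I) {W : X.Opens} (h : W ≤ U i) :
    Function.Injective (regluedEval (t := t) p i W) := fun x y hxy => by
  have hxy : x.1.2 i = y.1.2 i := hxy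
  have h1 : x.1.1 = y.1.1 := by
    refine resHom_injective (R := k) (inf_eq_left.2 h) ?_
    exact (reglued_proj x i).symm.trans ((congrArg _ hxy).trans (reglued_proj y i))
  refine reglued_ext h1 fun j => ?_
  have h2 := reglued_compat x i j (inf_le_left : W ⊓ U j ≤ W) (inf_le_left.trans h) inf_le_right
  rw [hxy, reglued_compat y i j (inf_le_left : W ⊓ U j ≤ W) (inf_le_left.trans h) inf_le_right, h1,
    resHom_refl, resHom_refl] at h2
  exact (add_right_cancel h2).symm

/-- A section `y` in the part over `U i`, with reduction `f`, is completed by the components `y - ε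
p_ij f`. The cocycle condition for `i, a, b` is their compatibility. -/
theorem regluedEval_surjective (hp : IsVectorCocycle p) (i : I) {W : X.Opens} (h : W ≤ U i) :
    Function.Surjective (regluedEval (t := t) p i W) := fun y => by
  obtain ⟨f, hf⟩ : ∃ f : Γ(X, W), f = resHom k (le_inf le_rfl h) (t.proj _ y) := ⟨_, rfl⟩
  have hle : ∀ j, W ⊓ U j ≤ W ⊓ U i := fun j => inf_le_left.trans (le_inf le_rfl h)
  refine ⟨⟨(f, fun j => resHom k[ε] (t.opn_mono (hle j)) y - t.infl _
    ((p i j).eval (le_inf (inf_le_left.trans h) inf_le_right) ![resHom k inf_le_left f])),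
      fun j => ?_, fun a b W' h' ha hb => ?_⟩, ?_⟩
  · change t.proj _ (_ - _) = resHom k _ f
    rw [hf, map_sub, t.proj_infl, sub_zero, t.proj_res, resHom_resHom]
  · change resHom k[ε] _ (_ - _) = resHom k[ε] _ (_ - _) + _
    have h1 := hp i a b W' (h'.trans h) ha hb (resHom k h' f)
    rw [map_sub, map_sub, t.res_infl, t.res_infl, PolyvectorField.res_eval_one,
      PolyvectorField.res_eval_one, resHom_resHom, resHom_resHom, resHom_resHom, resHom_resHom, h1,
      map_add]
    ring
  · change resHom k[ε] _ y - _ = y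
    -- The cocycle condition with three equal indices gives `p_ii = 0`, so the component at `i` is
    -- `y` itself.
    have h1 := hp i i i (W ⊓ U i) inf_le_right inf_le_right inf_le_right (resHom k inf_le_left f)
    rw [resHom_refl, left_eq_add.1 h1, map_zero, sub_zero]

theorem regluedEval_bijective (hp : IsVectorCocycle p) (i : I) {W : X.Opens} (h : W ≤ U i) :
    Function.Bijective (regluedEval (t := t) p i W) :=
  ⟨regluedEval_injective i h, regluedEval_surjective hp i h⟩

variable (t p) in
/-- The reglued ringed space. -/
noncomputable def regluedSpace : SheafedSpace CommRingCat.{u} where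
  carrier := X.toTopCat
  presheaf := t.regluedPresheaf p
  IsSheaf := isSheaf_regluedPresheaf

section Chart

variable {Y : Scheme.{u}} (g : Y ⟶ t.total) (i : I)

theorem preimage_opn_le_inf (hg : ⊤ ≤ g ⁻¹ᵁ t.opn (U i)) (W : X.Opens) :
    g ⁻¹ᵁ t.opn W ≤ g ⁻¹ᵁ t.opn (W ⊓ U i) := fun y hy => ⟨hy, hg (Set.mem_univ y)⟩

theorem map_appLE_opn (hg : ⊤ ≤ g ⁻¹ᵁ t.opn (U i)) {W W' : X.Opens} (h : W' ≤ W) :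
    t.total.presheaf.map (homOfLE (t.opn_mono (inf_le_inf_right (U i) h))).op ≫
      g.appLE (t.opn (W' ⊓ U i)) (g ⁻¹ᵁ t.opn W') (preimage_opn_le_inf g i hg _) =
    g.appLE (t.opn (W ⊓ U i)) (g ⁻¹ᵁ t.opn W) (preimage_opn_le_inf g i hg _) ≫
      Y.presheaf.map (homOfLE (g.preimage_mono (t.opn_mono h))).op := by
  rw [Scheme.Hom.appLE_map, Scheme.Hom.map_appLE]

/-- An open immersion into the thickening with image in the part over `U i` gives a chart of the
reglued ringed space. -/
noncomputable def regluedChart (p : ∀ i j, PolyvectorField k X 1 (U i ⊓ U j))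
    (hg : ⊤ ≤ g ⁻¹ᵁ t.opn (U i)) :
    Y.toPresheafedSpace ⟶ (t.regluedSpace p).toPresheafedSpace where
  base := g.base ≫ TopCat.ofHom ⟨t.homeo.symm, t.homeo.symm.continuous⟩
  c :=
    { app := fun W => CommRingCat.ofHom (regluedEval p i W.unop) ≫
        g.appLE (t.opn (W.unop ⊓ U i)) (g ⁻¹ᵁ t.opn W.unop) (preimage_opn_le_inf g i hg _)
      naturality := fun W W' f => by
        refine CommRingCat.hom_ext (RingHom.ext fun (x : t.reglued p W.unop) => ?_)
        exact ConcreteCategory.congr_hom (map_appLE_opn g i hg f.unop.le) (x.1.2 i) }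

/-- Over subsets of `U i` the reglued sheaf is that of `t`, by `regluedEval_bijective`, and `g` is
an open immersion into `t`. -/
theorem isOpenImmersion_regluedChart [IsOpenImmersion g] (hp : IsVectorCocycle p)
    (hg : ⊤ ≤ g ⁻¹ᵁ t.opn (U i)) :
    PresheafedSpace.IsOpenImmersion (regluedChart g i p hg) where
  base_open := t.homeo.symm.isOpenEmbedding.comp g.isOpenEmbedding
  c_iso V := by
    have h0 : Topology.IsOpenEmbedding (regluedChart g i p hg).base :=
      t.homeo.symm.isOpenEmbedding.comp g.isOpenEmbedding
    let W : X.Opens := h0.functor.obj V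
    have hW : W ≤ U i := by
      rintro _ ⟨y, -, rfl⟩
      exact hg (Set.mem_univ y)
    have hWg : t.opn W ≤ g.opensRange := by
      rintro z ⟨y, -, hy⟩
      exact ⟨y, t.homeo.symm.injective hy⟩
    have h1 : IsIso (CommRingCat.ofHom (regluedEval (t := t) p i W)) :=
      (ConcreteCategory.isIso_iff_bijective _).2 (regluedEval_bijective hp i hW)
    have h2 : IsIso (g.appLE (t.opn (W ⊓ U i)) (g ⁻¹ᵁ t.opn W) (preimage_opn_le_inf g i hg _)) := by
      refine isIso_appLE g _ ?_ ((t.opn_mono inf_le_left).trans hWg)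
      rw [inf_eq_left.2 hW]
    exact (inferInstance : IsIso (CommRingCat.ofHom (regluedEval (t := t) p i W) ≫
      g.appLE (t.opn (W ⊓ U i)) (g ⁻¹ᵁ t.opn W) (preimage_opn_le_inf g i hg _)))

end Chart

theorem exists_affine_le (hU : iSup U = ⊤) (x : X) :
    ∃ (i : I) (V : t.total.Opens) (hV : IsAffineOpen V), t.homeo x ∈ V ∧
      ⊤ ≤ hV.fromSpec ⁻¹ᵁ t.opn (U i) := by
  obtain ⟨i, hi⟩ : ∃ i, x ∈ U i := Opens.mem_iSup.1 (hU ▸ Opens.mem_top x)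
  have hx : t.homeo x ∈ t.opn (U i) := by
    change t.homeo.symm (t.homeo x) ∈ U i
    rwa [Homeomorph.symm_apply_apply]
  obtain ⟨V, hV, hxV, hVU⟩ := Opens.isBasis_iff_nbhd.1 t.total.isBasis_affineOpens hx
  refine ⟨i, V, hV, hxV, fun y _ => hVU ?_⟩
  have : hV.fromSpec y ∈ Set.range hV.fromSpec := ⟨y, rfl⟩
  rwa [hV.range_fromSpec] at this

/-- A chart identifies the stalk with a stalk of an affine scheme. -/
theorem isLocalRing_stalk_regluedSpace (hp : IsVectorCocycle p) (hU : iSup U = ⊤) (x : X) :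
    IsLocalRing ((t.regluedSpace p).presheaf.stalk x) := by
  obtain ⟨i, V, hV, hx, hi⟩ := exists_affine_le (t := t) hU x
  obtain ⟨y, hy⟩ : t.homeo x ∈ Set.range hV.fromSpec := by rwa [hV.range_fromSpec]
  have := isOpenImmersion_regluedChart hV.fromSpec i hp hi
  have hyx : (regluedChart hV.fromSpec i p hi).base y = x :=
    (congrArg t.homeo.symm hy).trans (t.homeo.symm_apply_apply x)
  subst hyx
  exact (asIso ((regluedChart hV.fromSpec i p hi).stalkMap y)).commRingCatIsoToRingEquiv.symm.isLocalRing

/-- The reglued scheme. -/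
noncomputable def regluedScheme (t : FlatThickening k X) (hp : IsVectorCocycle p)
    (hU : iSup U = ⊤) : Scheme.{u} :=
  LocallyRingedSpace.IsOpenImmersion.scheme
    { toSheafedSpace := t.regluedSpace p
      isLocalRing := isLocalRing_stalk_regluedSpace hp hU } fun x => by
    obtain ⟨i, V, hV, hx, hi⟩ := exists_affine_le (t := t) hU x
    obtain ⟨y, hy⟩ : t.homeo x ∈ Set.range hV.fromSpec := by rwa [hV.range_fromSpec]
    have := isOpenImmersion_regluedChart hV.fromSpec i hp hi
    refine ⟨Γ(t.total, V), ⟨regluedChart hV.fromSpec i p hi, fun y => ?_⟩, ⟨y, ?_⟩, this⟩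
    · have := PresheafedSpace.IsOpenImmersion.stalk_iso (regluedChart hV.fromSpec i p hi) y
      exact isLocalHom_of_isIso ((regluedChart hV.fromSpec i p hi).stalkMap y)
    · exact (congrArg t.homeo.symm hy).trans (t.homeo.symm_apply_apply x)

end FlatThickening

/-! ### Structure morphisms and closed fibres over `Spec k[ε]`. -/

section Over

variable {R : Type u} [CommRing R] {Y Z : Scheme.{u}}

theorem algebraMap_of_over [Z.Over (Spec (.of R))] (φ : R →+* Γ(Z, ⊤))
    (h : (Z ↘ Spec (.of R)) = Z.toSpecΓ ≫ Spec.map (CommRingCat.ofHom φ)) (W : Z.Opens) (c : R) :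
    algebraMap R Γ(Z, W) c = (Z.presheaf.map (homOfLE (le_top : W ≤ ⊤)).op).hom (φ c) := by
  have h1 : (Scheme.ΓSpecIso (.of R)).inv ≫ (Z ↘ Spec (.of R)).appTop = CommRingCat.ofHom φ := by
    rw [h, Scheme.Hom.comp_appTop, Scheme.toSpecΓ_appTop, Scheme.ΓSpecIso_naturality,
      Iso.inv_hom_id_assoc]
  have h2 := congrArg (fun g => (Z.presheaf.map (homOfLE (le_top : W ≤ ⊤)).op).hom (g.hom c)) h1
  exact h2

theorem comp_over_of_algebraMap [Y.Over (Spec (.of R))] [Z.Over (Spec (.of R))] (f : Y ⟶ Z)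
    (h : ∀ c : R, f.appTop.hom (algebraMap R Γ(Z, ⊤) c) = algebraMap R Γ(Y, ⊤) c) :
    f ≫ (Z ↘ Spec (.of R)) = Y ↘ Spec (.of R) := by
  refine ext_of_isAffine ?_
  rw [← cancel_epi (Scheme.ΓSpecIso (.of R)).inv, Scheme.Hom.comp_appTop]
  have h2 : ∀ (Y : Scheme.{u}) [Y.Over (Spec (.of R))] (c : R), algebraMap R Γ(Y, ⊤) c =
      ((Scheme.ΓSpecIso (.of R)).inv ≫ (Y ↘ Spec (.of R)).appTop).hom c := fun Y _ c =>
    congrArg (fun g => ((Scheme.ΓSpecIso (.of R)).inv ≫ g).hom c) (Scheme.Hom.appLE_eq_app _)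
  refine CommRingCat.hom_ext (RingHom.ext fun c => ?_)
  refine Eq.trans ?_ (((congrArg f.appTop.hom (h2 Z c)).symm.trans (h c)).trans (h2 Y c))
  rfl

end Over

/-- A closed subscheme cut out by `ε` is the closed fibre. -/
theorem isPullback_of_ker {k : Type u} [Field k] {X Y : Scheme.{u}} [X.Over (Spec (.of k))]
    [Y.Over (Spec (.of k[ε]))] (f : X ⟶ Y) [IsClosedImmersion f]
    (w : f ≫ (Y ↘ Spec (.of k[ε])) = (X ↘ Spec (.of k)) ≫ Spec.map (CommRingCat.ofHom
      (TrivSqZeroExt.fstHom k k k : k[ε] →ₐ[k] k).toRingHom))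
    (hf : ∀ (V : Y.Opens), IsAffineOpen V → ∀ x : Γ(Y, V), (f.app V).hom x = 0 →
      ∃ y : Γ(Y, V), x = (ε : k[ε]) • y) :
    IsPullback f (X ↘ Spec (.of k)) (Y ↘ Spec (.of k[ε])) (Spec.map (CommRingCat.ofHom
      (TrivSqZeroExt.fstHom k k k : k[ε] →ₐ[k] k).toRingHom)) := by
  have : IsClosedImmersion (Spec.map (CommRingCat.ofHom
      (TrivSqZeroExt.fstHom k k k : k[ε] →ₐ[k] k).toRingHom)) :=
    IsClosedImmersion.spec_of_surjective _ fun c => ⟨TrivSqZeroExt.inl c, rfl⟩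
  -- A morphism whose source lies over `Spec k` kills `ε`, hence the kernel of `f`, and so factors
  -- through the closed immersion `f`.
  have hker : ∀ (Z : Scheme.{u}) (a : Z ⟶ Y) (b : Z ⟶ Spec (.of k)),
      a ≫ (Y ↘ Spec (.of k[ε])) = b ≫ Spec.map (CommRingCat.ofHom
      (TrivSqZeroExt.fstHom k k k : k[ε] →ₐ[k] k).toRingHom) → f.ker ≤ a.ker := by
    intro Z a b hab
    let _ : Z.Over (Spec (.of k)) := ⟨b⟩
    refine Scheme.IdealSheafData.le_ofIdeals_iff.2 fun V x hx => ?_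
    obtain ⟨y, rfl⟩ := hf V.1 V.2 x ((f.ker_apply V).le hx)
    have h1 : (a.app V.1).hom (algebraMap k[ε] Γ(Y, V.1) ε) = algebraMap k _ (ε : k[ε]).fst := by
      rw [← Scheme.Hom.appLE_eq_app]
      exact appLE_algebraMap a _ hab _ _
    change (a.app V.1).hom (ε • y) = 0
    rw [Algebra.smul_def, map_mul, h1, DualNumber.fst_eps, map_zero, zero_mul]
  refine ⟨⟨w⟩, ⟨Limits.PullbackCone.IsLimit.mk w
    (fun s => IsClosedImmersion.lift f s.fst (hker _ s.fst s.snd s.condition))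
    (fun s => IsClosedImmersion.lift_fac _ _ _) (fun s => ?_) fun s m hm _ => ?_⟩⟩
  · rw [← cancel_mono (Spec.map (CommRingCat.ofHom
      (TrivSqZeroExt.fstHom k k k : k[ε] →ₐ[k] k).toRingHom)), Category.assoc, ← w,
      IsClosedImmersion.lift_fac_assoc]
    exact s.condition
  · rw [← cancel_mono f, hm, IsClosedImmersion.lift_fac]

/-! ### The reglued scheme over `Spec k[ε]` and its flatness. -/

namespace FlatThickening

variable {k : Type u} [Field k] {X : Scheme.{u}} [X.Over (Spec (.of k))] {t : FlatThickening k X}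
  {I : Type u} {U : I → X.Opens} {p : ∀ i j, PolyvectorField k X 1 (U i ⊓ U j)}

variable (t p) in
/-- The structure of a `k[ε]`-algebra on the reglued structure sheaf. -/
noncomputable def regluedAlgebraMap (W : X.Opens) : k[ε] →+* t.reglued p W :=
  RingHom.codRestrict (((algebraMap k Γ(X, W)).comp (TrivSqZeroExt.fstHom k k k).toRingHom).prod
    (RingHom.pi fun i => algebraMap k[ε] Γ(t.total, t.opn (W ⊓ U i)))) (t.reglued p W) fun c => by
    refine ⟨fun i => ?_, fun i j W' h hi hj => ?_⟩
    · change t.proj _ (algebraMap k[ε] _ c) = resHom k _ (algebraMap k _ c.fst)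
      rw [t.proj_algebraMap, AlgHom.commutes]
    · change resHom k[ε] _ (algebraMap k[ε] _ c) = resHom k[ε] _ (algebraMap k[ε] _ c) +
        t.infl W' ((p i j).eval _ ![resHom k _ (algebraMap k _ c.fst)])
      rw [AlgHom.commutes, AlgHom.commutes, AlgHom.commutes, PolyvectorField.eval_one_algebraMap,
        map_zero, add_zero]

theorem regluedRes_algebraMap {W W' : X.Opens} (h : W' ≤ W) (c : k[ε]) :
    regluedRes h (t.regluedAlgebraMap p W c) = t.regluedAlgebraMap p W' c :=
  reglued_ext (AlgHom.commutes _ _) fun _ => AlgHom.commutes _ _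

/-- A lift of the inverse of the reduction is an inverse up to a factor `1 + ε e`, and `(1 + ε e) (1
- ε e) = 1`. This makes the inclusion of `X` local on stalks. -/
theorem reglued_isUnit (hp : IsVectorCocycle p) (S : t.Splitting ⊤) (i : I) {W : X.Opens}
    (h : W ≤ U i) (x : t.reglued p W) (hx : IsUnit x.1.1) : IsUnit x := by
  obtain ⟨g, hg⟩ := hx.exists_right_inv
  obtain ⟨y, hy⟩ := regluedEval_surjective (t := t) hp i h (S.s _ le_top (resHom k inf_le_left g))
  obtain ⟨e, he⟩ := t.exists_eq_infl (regluedEval p i W (x * y) - 1) (by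
    rw [map_sub, map_mul, map_mul, hy, S.proj_s, map_one]
    change t.proj _ (x.1.2 i) * _ - _ = _
    rw [reglued_proj, ← map_mul, hg, map_one, sub_self])
  obtain ⟨z, hz⟩ := regluedEval_surjective hp i h (1 - t.infl _ e)
  refine IsUnit.of_mul_eq_one (y * z) (regluedEval_injective i h ?_)
  rw [← mul_assoc, map_mul, hz, map_one]
  linear_combination (1 - t.infl _ e) * he - t.infl_mul_infl e e

theorem exists_reglued_fst (hp : IsVectorCocycle p) (S : t.Splitting ⊤) (i : I) {W : X.Opens}
    (h : W ≤ U i) (f : Γ(X, W)) : ∃ x : t.reglued p W, x.1.1 = f := by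
  obtain ⟨x, hx⟩ := regluedEval_surjective (t := t) hp i h (S.s _ le_top (resHom k inf_le_left f))
  refine ⟨x, resHom_injective (R := k) (inf_eq_left.2 h) ?_⟩
  refine (reglued_proj x i).symm.trans ((congrArg _ hx).trans ?_)
  rw [S.proj_s]

section Scheme

variable (t) (hp : IsVectorCocycle p) (hU : iSup U = ⊤)

noncomputable instance regluedOver : (t.regluedScheme hp hU).Over (Spec (.of k[ε])) :=
  ⟨(t.regluedScheme hp hU).toSpecΓ ≫ Spec.map (CommRingCat.ofHom (t.regluedAlgebraMap p ⊤))⟩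

theorem algebraMap_regluedScheme (W : (t.regluedScheme hp hU).Opens) (c : k[ε]) :
    algebraMap k[ε] Γ(t.regluedScheme hp hU, W) c = t.regluedAlgebraMap p W c :=
  (algebraMap_of_over (Z := t.regluedScheme hp hU) (t.regluedAlgebraMap p ⊤) rfl W c).trans
    (regluedRes_algebraMap le_top c)

/-- The charts of the reglued scheme. -/
noncomputable def regluedChartHom {Y : Scheme.{u}} (g : Y ⟶ t.total) [IsOpenImmersion g] (i : I)
    (hg : ⊤ ≤ g ⁻¹ᵁ t.opn (U i)) : Y ⟶ t.regluedScheme hp hU :=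
  ⟨⟨regluedChart g i p hg, fun y => by
    have := isOpenImmersion_regluedChart g i hp hg
    have := PresheafedSpace.IsOpenImmersion.stalk_iso (regluedChart g i p hg) y
    exact isLocalHom_of_isIso ((regluedChart g i p hg).stalkMap y)⟩⟩

instance isOpenImmersion_regluedChartHom {Y : Scheme.{u}} (g : Y ⟶ t.total) [IsOpenImmersion g]
    (i : I) (hg : ⊤ ≤ g ⁻¹ᵁ t.opn (U i)) : IsOpenImmersion (t.regluedChartHom hp hU g i hg) :=
  isOpenImmersion_regluedChart g i hp hg

theorem regluedChartHom_over {Y : Scheme.{u}} (g : Y ⟶ t.total) [IsOpenImmersion g] (i : I)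
    (hg : ⊤ ≤ g ⁻¹ᵁ t.opn (U i)) : t.regluedChartHom hp hU g i hg ≫
      (t.regluedScheme hp hU ↘ Spec (.of k[ε])) = g ≫ (t.total ↘ Spec (.of k[ε])) := by
  let _ : Y.Over (Spec (.of k[ε])) := ⟨g ≫ (t.total ↘ Spec (.of k[ε]))⟩
  refine comp_over_of_algebraMap (t.regluedChartHom hp hU g i hg) fun c => ?_
  refine (congrArg (t.regluedChartHom hp hU g i hg).appTop.hom
    (t.algebraMap_regluedScheme hp hU ⊤ c)).trans ?_
  refine (appLE_algebraMap g (RingHom.id k[ε]) ?_ (preimage_opn_le_inf g i hg ⊤) c).trans rfl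
  rw [CommRingCat.ofHom_id, Spec.map_id, Category.comp_id]
  rfl

/-- Flatness is local on the source, and each chart is an affine open subset of `t` with its own
structure morphism. -/
theorem flat_regluedScheme : Flat (t.regluedScheme hp hU ↘ Spec (.of k[ε])) := by
  choose i V hV hx hi using exists_affine_le (t := t) hU
  have := t.flat
  let 𝒰 : (t.regluedScheme hp hU).OpenCover := Scheme.Cover.mkOfCovers X _
    (fun x => t.regluedChartHom hp hU (hV x).fromSpec (i x) (hi x)) (fun x => by
      obtain ⟨y, hy⟩ : t.homeo x ∈ Set.range (hV x).fromSpec := by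
        rw [(hV x).range_fromSpec]; exact hx x
      exact ⟨x, y, (congrArg t.homeo.symm hy).trans (t.homeo.symm_apply_apply x)⟩) inferInstance
  have hloc : IsZariskiLocalAtSource @Flat.{u} :=
    HasRingHomProperty.instIsZariskiLocalAtSource (Q := RingHom.Flat)
  refine (@IsZariskiLocalAtSource.iff_of_openCover @Flat.{u} hloc _ _
    (t.regluedScheme hp hU ↘ Spec (.of k[ε])) 𝒰).mpr fun (x : X) => ?_
  change Flat (t.regluedChartHom hp hU (hV x).fromSpec (i x) (hi x) ≫ _)
  rw [regluedChartHom_over]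
  infer_instance

end Scheme

end FlatThickening

/-! ### The reglued thickening, its splittings, and realization of cocycles. -/

namespace FlatThickening

variable {k : Type u} [Field k] {X : Scheme.{u}} [X.Over (Spec (.of k))] {t : FlatThickening k X}
  {I : Type u} {U : I → X.Opens} {p : ∀ i j, PolyvectorField k X 1 (U i ⊓ U j)}

/-- The projection to `𝒪_X` of the reglued structure sheaf. -/
noncomputable def regluedFst (p : ∀ i j, PolyvectorField k X 1 (U i ⊓ U j)) (W : X.Opens) :
    t.reglued p W →+* Γ(X, W) :=
  (RingHom.fst _ _).comp (t.reglued p W).subtype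

variable (t p) in
/-- The inclusion of `X` in the reglued ringed space. -/
noncomputable def regluedInclPresheafed :
    X.toPresheafedSpace ⟶ (t.regluedSpace p).toPresheafedSpace where
  base := 𝟙 X.toTopCat
  c :=
    { app := fun W => CommRingCat.ofHom (regluedFst p W.unop)
      naturality := fun _ _ _ => rfl }

theorem regluedIncl_germ {W : X.Opens} {x : X} (hx : x ∈ W) (a : t.reglued p W) :
    (t.regluedInclPresheafed p).stalkMap x
      ((t.regluedSpace p).presheaf.germ (U := (W : Opens X.toTopCat)) x hx a) =
        X.presheaf.germ W x hx a.1.1 :=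
  PresheafedSpace.stalkMap_germ_apply (t.regluedInclPresheafed p) W x hx a

theorem surjective_stalkMap_regluedIncl (hp : IsVectorCocycle p) (hU : iSup U = ⊤)
    (S : t.Splitting ⊤) (x : X) :
    Function.Surjective ((t.regluedInclPresheafed p).stalkMap x) := fun b => by
  obtain ⟨W, hx, f, rfl⟩ := X.presheaf.exists_germ_eq b
  obtain ⟨i, hi⟩ : ∃ i, x ∈ U i := Opens.mem_iSup.1 (hU ▸ Opens.mem_top x)
  obtain ⟨a, ha⟩ := exists_reglued_fst hp S i (inf_le_right : W ⊓ U i ≤ U i) (resHom k inf_le_left f)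
  refine ⟨(t.regluedSpace p).presheaf.germ (U := (W ⊓ U i : Opens X.toTopCat)) x ⟨hx, hi⟩ a, ?_⟩
  refine (regluedIncl_germ (W := W ⊓ U i) ⟨hx, hi⟩ a).trans ?_
  rw [ha]
  exact X.presheaf.germ_res_apply (homOfLE (inf_le_left : W ⊓ U i ≤ W)) x ⟨hx, hi⟩ f

theorem isLocalHom_stalkMap_regluedIncl (hp : IsVectorCocycle p) (hU : iSup U = ⊤)
    (S : t.Splitting ⊤) (x : X) :
    IsLocalHom ((t.regluedInclPresheafed p).stalkMap x).hom := ⟨fun b hb => by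
  obtain ⟨(W : X.Opens), hx, (a : t.reglued p W), rfl⟩ := (t.regluedSpace p).presheaf.exists_germ_eq b
  have h1 : IsUnit (X.presheaf.germ W x hx a.1.1) :=
    (congrArg IsUnit (regluedIncl_germ hx a)).mp hb
  obtain ⟨V, j, hxV, hV⟩ := X.toRingedSpace.isUnit_res_of_isUnit_germ W a.1.1 x hx h1
  obtain ⟨i, hi⟩ : ∃ i, x ∈ U i := Opens.mem_iSup.1 (hU ▸ Opens.mem_top x)
  have hle : V ⊓ U i ≤ W := inf_le_left.trans j.le
  have h2 : IsUnit (regluedRes hle a) := by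
    refine reglued_isUnit hp S i inf_le_right _ ?_
    have h3 : IsUnit (resHom k j.le a.1.1) := hV
    have h4 := h3.map (resHom k (inf_le_left : V ⊓ U i ≤ V))
    rwa [resHom_resHom] at h4
  have h5 : (t.regluedSpace p).presheaf.germ (U := (V ⊓ U i : Opens X.toTopCat)) x ⟨hxV, hi⟩
      (regluedRes hle a) = (t.regluedSpace p).presheaf.germ W x hx a :=
    (t.regluedSpace p).presheaf.germ_res_apply (homOfLE hle) x ⟨hxV, hi⟩ a
  refine (congrArg IsUnit h5).mp ?_
  exact h2.map ((t.regluedSpace p).presheaf.germ (U := (V ⊓ U i : Opens X.toTopCat)) x ⟨hxV, hi⟩).hom⟩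

/-- When the reduction is zero all components have the form `ε g_i`, and the gluing relation, with
`p_ij 0 = 0`, says that the `g_i` agree on overlaps. A lift `y` of the resulting function satisfies
`x = ε y`. -/
theorem exists_eq_eps_mul_reglued (hU : iSup U = ⊤) {V : X.Opens}
    (hV : Function.Surjective (regluedFst (t := t) p V)) (x : t.reglued p V) (hx : x.1.1 = 0) :
    ∃ y : t.reglued p V, x = t.regluedAlgebraMap p V ε * y := by
  have h1 : ∀ i, ∃ g, x.1.2 i = t.infl _ g := fun i =>
    t.exists_eq_infl _ (by rw [reglued_proj, hx, map_zero])
  choose g hg using h1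
  obtain ⟨f, hf⟩ := resHom_glue k (fun i => V ⊓ U i) (fun i => (inf_le_left : V ⊓ U i ≤ V))
    (by rw [← inf_iSup_eq, hU, inf_top_eq]) g fun i j => t.infl_injective _ (by
      have h2 := reglued_compat x i j (inf_le_left.trans inf_le_left : V ⊓ U i ⊓ (V ⊓ U j) ≤ V)
        (inf_le_left.trans inf_le_right) (inf_le_right.trans inf_le_right)
      rw [hg, hg, t.res_infl, t.res_infl, hx, map_zero, PolyvectorField.eval_one_zero, map_zero,
        add_zero] at h2
      exact h2)
  obtain ⟨y, hy⟩ := hV f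
  have hy : y.1.1 = f := hy
  refine ⟨y, reglued_ext ?_ fun i => ?_⟩
  · change x.1.1 = algebraMap k _ (ε : k[ε]).fst * y.1.1
    rw [hx, DualNumber.fst_eps, map_zero, zero_mul]
  · change x.1.2 i = algebraMap k[ε] _ ε * y.1.2 i
    rw [hg, ← Algebra.smul_def, ← t.infl_proj, reglued_proj, hy, hf]

section Scheme

variable (hp : IsVectorCocycle p) (hU : iSup U = ⊤) (S : t.Splitting ⊤)

/-- The inclusion of `X` in the reglued scheme. -/
noncomputable def regluedIncl : X ⟶ t.regluedScheme hp hU :=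
  ⟨⟨t.regluedInclPresheafed p, isLocalHom_stalkMap_regluedIncl hp hU S⟩⟩

instance isClosedImmersion_regluedIncl : IsClosedImmersion (regluedIncl hp hU S) where
  stalkMap_surjective := surjective_stalkMap_regluedIncl hp hU S
  isClosedEmbedding := Topology.IsClosedEmbedding.id

theorem regluedIncl_over : regluedIncl hp hU S ≫ (t.regluedScheme hp hU ↘ Spec (.of k[ε])) =
    (X ↘ Spec (.of k)) ≫ Spec.map (CommRingCat.ofHom
      (TrivSqZeroExt.fstHom k k k : k[ε] →ₐ[k] k).toRingHom) := by
  let _ : X.Over (Spec (.of k[ε])) := ⟨(X ↘ Spec (.of k)) ≫ Spec.map (CommRingCat.ofHom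
    (TrivSqZeroExt.fstHom k k k : k[ε] →ₐ[k] k).toRingHom)⟩
  refine comp_over_of_algebraMap (regluedIncl hp hU S) fun c => ?_
  refine (congrArg (regluedIncl hp hU S).appTop.hom
    (t.algebraMap_regluedScheme hp hU ⊤ c)).trans ?_
  have h1 := appLE_algebraMap (R' := k[ε]) (𝟙 X) (TrivSqZeroExt.fstHom k k k : k[ε] →ₐ[k] k).toRingHom
    (Category.id_comp _) (V := ⊤) (U := ⊤) le_rfl c
  have h2 : (𝟙 X : X ⟶ X).appLE ⊤ ⊤ le_rfl = 𝟙 Γ(X, ⊤) :=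
    (Scheme.Hom.appLE_eq_app (𝟙 X)).trans (Scheme.Hom.id_app ⊤)
  exact h1.symm.trans (ConcreteCategory.congr_hom h2 (algebraMap k[ε] Γ(X, ⊤) c))

theorem exists_eq_eps_smul_reglued (V : (t.regluedScheme hp hU).Opens) (hV : IsAffineOpen V)
    (x : Γ(t.regluedScheme hp hU, V)) (hx : ((regluedIncl hp hU S).app V).hom x = 0) :
    ∃ y : Γ(t.regluedScheme hp hU, V), x = (ε : k[ε]) • y := by
  obtain ⟨y, hy⟩ := exists_eq_eps_mul_reglued hU
    ((regluedIncl hp hU S).app_surjective V hV) x hx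
  refine ⟨y, hy.trans ?_⟩
  exact (congrArg (· * y) (t.algebraMap_regluedScheme hp hU V ε)).symm.trans
    (Algebra.smul_def (A := Γ(t.regluedScheme hp hU, V)) (ε : k[ε]) y).symm

/-- The reglued thickening. -/
noncomputable def regluedThickening : FlatThickening k X where
  total := t.regluedScheme hp hU
  flat := t.flat_regluedScheme hp hU
  incl := regluedIncl hp hU S
  isPullback := isPullback_of_ker (regluedIncl hp hU S) (regluedIncl_over hp hU S)
    (exists_eq_eps_smul_reglued hp hU S)

/-- The open subset of the reglued scheme with a given closed fibre. -/
def regluedOpn (W : X.Opens) : (regluedThickening hp hU S).total.Opens := W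

theorem opn_regluedThickening (W : X.Opens) :
    (regluedThickening hp hU S).opn W = regluedOpn hp hU S W :=
  (regluedThickening hp hU S).incl_preimage_opn W

/-- Sections of the reglued structure sheaf, as sections of the reglued thickening. -/
noncomputable def regluedSections (W : X.Opens) :
    t.reglued p W →+* Γ((regluedThickening hp hU S).total, (regluedThickening hp hU S).opn W) :=
  (resHom k[ε] (opn_regluedThickening hp hU S W).le).toRingHom

theorem regluedSections_algebraMap (W : X.Opens) (c : k[ε]) :
    regluedSections hp hU S W (t.regluedAlgebraMap p W c) = algebraMap k[ε] _ c :=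
  (congrArg (regluedSections hp hU S W) (t.algebraMap_regluedScheme hp hU W c)).symm.trans
    (AlgHom.commutes (resHom k[ε] (opn_regluedThickening hp hU S W).le) c)

theorem res_regluedSections {W W' : X.Opens} (h : W' ≤ W) (x : t.reglued p W) :
    resHom k[ε] ((regluedThickening hp hU S).opn_mono h) (regluedSections hp hU S W x) =
      regluedSections hp hU S W' (regluedRes h x) := by
  have h' : regluedOpn hp hU S W' ≤ regluedOpn hp hU S W := h
  have key : ∀ x : Γ((regluedThickening hp hU S).total, regluedOpn hp hU S W),
      resHom k[ε] ((regluedThickening hp hU S).opn_mono h)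
        (resHom k[ε] (opn_regluedThickening hp hU S W).le x) =
      resHom k[ε] (opn_regluedThickening hp hU S W').le (resHom k[ε] h' x) := fun x => by
    rw [resHom_resHom, resHom_resHom]
  exact key x

theorem proj_regluedSections (W : X.Opens) (x : t.reglued p W) :
    (regluedThickening hp hU S).proj W (regluedSections hp hU S W x) = x.1.1 := by
  have key : ∀ x : Γ((regluedThickening hp hU S).total, regluedOpn hp hU S W),
      (regluedThickening hp hU S).proj W (resHom k[ε] (opn_regluedThickening hp hU S W).le x) =
      resHom k (le_refl W) ((regluedThickening hp hU S).red (regluedOpn hp hU S W) x) := fun x => by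
    rw [proj_eq, ← res_red]
    exact resHom_resHom k _ _ _
  exact (key x).trans (resHom_refl k _ _)

/-- The section of the reglued structure sheaf that is `S f` in the part over `U i`. -/
noncomputable def regluedLift (i : I) (W : X.Opens) (h : W ≤ U i) : Γ(X, W) →+* t.reglued p W :=
  ((RingEquiv.ofBijective (regluedEval (t := t) p i W) (regluedEval_bijective hp i h)).symm :
    _ →+* _).comp ((S.s (W ⊓ U i) le_top).comp
      (resHom k (inf_le_left : W ⊓ U i ≤ W)).toRingHom)

theorem regluedLift_snd (i : I) {W : X.Opens} (h : W ≤ U i) (f : Γ(X, W)) :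
    (regluedLift hp S i W h f).1.2 i = S.s (W ⊓ U i) le_top (resHom k inf_le_left f) :=
  (RingEquiv.ofBijective (regluedEval (t := t) p i W)
    (regluedEval_bijective hp i h)).apply_symm_apply _

theorem regluedLift_fst (i : I) {W : X.Opens} (h : W ≤ U i) (f : Γ(X, W)) :
    (regluedLift hp S i W h f).1.1 = f := by
  refine resHom_injective (R := k) (inf_eq_left.2 h) ?_
  refine (reglued_proj _ i).symm.trans ((congrArg _ (regluedLift_snd hp S i h f)).trans ?_)
  rw [S.proj_s]

theorem regluedRes_regluedLift (i : I) {W W' : X.Opens} (h : W ≤ U i) (h' : W' ≤ W) (f : Γ(X, W)) :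
    regluedRes h' (regluedLift hp S i W h f) =
      regluedLift hp S i W' (h'.trans h) (resHom k h' f) := by
  refine regluedEval_injective i (h'.trans h) ?_
  refine Eq.trans ?_ (regluedLift_snd hp S i (h'.trans h) _).symm
  refine (congrArg (resHom k[ε] (t.opn_mono (inf_le_inf_right (U i) h')))
    (regluedLift_snd hp S i h f)).trans ?_
  rw [S.res_s _ _ _ (inf_le_inf_right _ h'), resHom_resHom, resHom_resHom]

theorem regluedLift_algebraMap (i : I) {W : X.Opens} (h : W ≤ U i) (c : k) :
    regluedLift hp S i W h (algebraMap k _ c) =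
      t.regluedAlgebraMap p W (TrivSqZeroExt.inl c) := by
  refine regluedEval_injective i h ?_
  refine (regluedLift_snd hp S i h _).trans ?_
  rw [AlgHom.commutes, S.s_algebraMap]
  rfl

/-- The lift through `U i` has component `S f` at `i`, hence `S f - ε p_ij f` at `j`, where the lift
through `U j` has `S f`. The transition fields are therefore `p_ij` and not their negatives. -/
theorem regluedLift_sub (i j : I) {W : X.Opens} (hi : W ≤ U i) (hj : W ≤ U j) (f : Γ(X, W)) :
    regluedLift hp S j W hj f = regluedLift hp S i W hi f + t.regluedAlgebraMap p W ε *
      regluedLift hp S i W hi ((p i j).eval (le_inf hi hj) ![f]) := by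
  refine regluedEval_injective j hj ?_
  refine (regluedLift_snd hp S j hj f).trans ?_
  have h1 := reglued_compat (regluedLift hp S i W hi f) i j (le_refl W) hi hj
  rw [regluedLift_snd, regluedLift_fst, S.res_s _ _ _ (le_inf le_rfl hi), resHom_resHom] at h1
  have h2 := congrArg (resHom k[ε] (t.opn_mono (inf_le_left : W ⊓ U j ≤ W))) h1
  rw [map_add, resHom_resHom, t.res_infl, S.res_s _ _ _ inf_le_left, resHom_resHom] at h2
  refine h2.trans (congrArg₂ (· + ·) ?_ ?_)
  · exact resHom_refl k[ε] _ _
  · change _ = algebraMap k[ε] _ ε * (regluedLift hp S i W hi _).1.2 j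
    rw [← Algebra.smul_def, ← t.infl_proj, reglued_proj, regluedLift_fst, resHom_refl]

/-- The splittings of the reglued thickening. -/
noncomputable def regluedSplitting (i : I) : (regluedThickening hp hU S).Splitting (U i) where
  s W h := (regluedSections hp hU S W).comp (regluedLift hp S i W h)
  s_algebraMap W h c :=
    (congrArg (regluedSections hp hU S W) (regluedLift_algebraMap hp S i h c)).trans
      (regluedSections_algebraMap hp hU S W _)
  res_s _ W' h h' f := (res_regluedSections hp hU S h' _).trans
    (congrArg (regluedSections hp hU S W') (regluedRes_regluedLift hp S i h h' f))
  proj_s W h f := (proj_regluedSections hp hU S W _).trans (regluedLift_fst hp S i h f)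

theorem isTransition_regluedSplitting (i j : I) :
    (regluedSplitting hp hU S i).IsTransition (regluedSplitting hp hU S j) (p i j) :=
  fun W h f => by
    rw [(regluedSplitting hp hU S i).infl_eq (h.trans inf_le_left), Algebra.smul_def,
      ← regluedSections_algebraMap]
    refine (congrArg (regluedSections hp hU S W) (regluedLift_sub hp S i j (h.trans inf_le_left)
      (h.trans inf_le_right) f)).trans ?_
    exact (map_add _ _ _).trans (congrArg₂ (· + ·) rfl (map_mul _ _ _))

end Scheme

/-- Every cocycle of vector fields and bivector fields comes from a Poisson deformation. -/
theorem _root_.PoissonDeformation.exists_cechData_of_isCocycle [Smooth (X ↘ Spec (.of k))]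
    {Λ₀ : PoissonStructure k X} (hU : iSup U = ⊤) (hU' : ∀ i, IsAffineOpen (U i))
    {Q : ∀ i, PolyvectorField k X 2 (U i)} (h : Λ₀.IsCocycle U p Q) :
    ∃ (ξ : FirstOrderPoissonDeformation Λ₀) (D : CechData ξ), ∀ c,
      IsCechClass (F := Λ₀.truncatedComplex) U p (fun i => -Q i) c →
        IsCechClass (F := Λ₀.truncatedComplex) D.U D.p (fun i => -D.Λ i) c := by
  have hp : IsVectorCocycle p := h.cocycle
  -- The thickening to be reglued is `X × Spec k[ε]`, whose canonical splitting is defined over all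
  -- of `X`.
  have hS := isTransition_regluedSplitting hp hU (trivialSplitting k X)
  obtain ⟨P, hP, hP'⟩ := exists_poisson_isBivector hU hS h
  exact ⟨_, CechData.ofSplittings U hU' hU _ Q hP' p hS, fun c hc => hc⟩

end FlatThickening

/-! ### The class of a deformation and the bijection with hypercohomology. -/

namespace PoissonDeformation

variable {k : Type u} [Field k] {X : Scheme.{u}} [X.Over (Spec (.of k))] {Λ₀ : PoissonStructure k X}

theorem exists_class [Smooth (X ↘ Spec (.of k))] (ξ : FirstOrderPoissonDeformation Λ₀) :
    ∃ c : hypercohomology Λ₀.truncatedComplex 1, ∀ D : CechData ξ,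
      IsCechClass (F := Λ₀.truncatedComplex) D.U D.p (fun i => -D.Λ i) c := by
  obtain ⟨D⟩ := CechData.nonempty (ξ := ξ)
  obtain ⟨c, hc⟩ := D.isCechCocycle.exists_isCechClass D.iSup_eq_top
  refine ⟨c, fun D' => ?_⟩
  obtain ⟨c', hc'⟩ := D'.isCechCocycle.exists_isCechClass D'.iSup_eq_top
  rwa [D.isCechClass_unique D' hc hc']

/-- The hypercohomology class of a first-order Poisson deformation. -/
noncomputable def cls [Smooth (X ↘ Spec (.of k))] (ξ : FirstOrderPoissonDeformation Λ₀) :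
    hypercohomology Λ₀.truncatedComplex 1 := ξ.exists_class.choose

variable [Smooth (X ↘ Spec (.of k))]

theorem isCechClass_cls (ξ : FirstOrderPoissonDeformation Λ₀) (D : CechData ξ) :
    IsCechClass (F := Λ₀.truncatedComplex) D.U D.p (fun i => -D.Λ i) ξ.cls :=
  ξ.exists_class.choose_spec D

theorem cls_eq {ξ : FirstOrderPoissonDeformation Λ₀} (D : CechData ξ)
    {c : hypercohomology Λ₀.truncatedComplex 1}
    (hc : IsCechClass (F := Λ₀.truncatedComplex) D.U D.p (fun i => -D.Λ i) c) : ξ.cls = c :=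
  D.isCechClass_unique D (isCechClass_cls ξ D) hc

theorem cls_eq_iff (ξ η : FirstOrderPoissonDeformation Λ₀) : ξ.cls = η.cls ↔ Isomorphic ξ η := by
  obtain ⟨D⟩ := CechData.nonempty (ξ := ξ)
  obtain ⟨D'⟩ := CechData.nonempty (ξ := η)
  refine ⟨fun h => ?_, fun h => ?_⟩
  · exact isomorphic_of_isCechClass D D' (isCechClass_cls ξ D) (h ▸ isCechClass_cls η D')
  · obtain ⟨D'', hD''⟩ := h.exists_cechData D'
    exact cls_eq D'' ((hD'' _).1 (isCechClass_cls η D'))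

/-- Affine open sets form a basis, so a class has a cocycle on some affine cover, and this cocycle
is realized by regluing `X × Spec k[ε]`. -/
theorem cls_surjective : Function.Surjective (cls : FirstOrderPoissonDeformation Λ₀ → _) :=
  fun c => by
    obtain ⟨I, U, p, m, hUa, hU, hcoc, hc⟩ := exists_isCechClass_of_isBasis X.isBasis_affineOpens c
    -- The cocycle of a deformation contains `-Λ_i`, so the bivector fields to be realized are `-m
    -- i`.
    have hm : m = fun i => -(fun i => -m i) i := funext fun i => (neg_neg _).symm
    rw [hm] at hcoc hc
    obtain ⟨ξ, D, hD⟩ := exists_cechData_of_isCocycle hU hUa ((Λ₀.isCechCocycle_iff U p _).1 hcoc)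
    exact ⟨ξ, cls_eq D (hD c hc)⟩

/-- Some trivial deformation exists and has the zero cocycle. A deformation of class zero is
therefore isomorphic to it, and triviality passes along isomorphisms. -/
theorem cls_eq_zero_iff (ξ : FirstOrderPoissonDeformation Λ₀) : ξ.cls = 0 ↔ ξ.IsTrivial := by
  refine ⟨fun h => ?_, fun h => ?_⟩
  · obtain ⟨η, hη⟩ := exists_isTrivial Λ₀
    obtain ⟨D, hD⟩ := hη.exists_cechData
    exact IsTrivial.of_isomorphic ((cls_eq_iff ξ η).1 (h.trans (cls_eq D hD).symm)) hη
  · obtain ⟨D, hD⟩ := h.exists_cechData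
    exact cls_eq D hD

end PoissonDeformation

theorem mainTheorem1 {k : Type u} [Field k] [IsAlgClosed k] [CharZero k] (X : Scheme.{u})
    [X.Over (Spec (.of k))] [IsIntegral X] [IsSeparated (X ↘ Spec (.of k))]
    [QuasiCompact (X ↘ Spec (.of k))] [Smooth (X ↘ Spec (.of k))] (Λ₀ : PoissonStructure k X) :
    ∃ κ : PoissonDef Λ₀ (TrivSqZeroExt.fstHom k k k : k[ε] →ₐ[k] k) ≃
        hypercohomology Λ₀.truncatedComplex 1,
      (∀ ξ : FirstOrderPoissonDeformation Λ₀, Nonempty (CechData ξ) ∧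
        ∀ D : CechData ξ, IsCechClass (F := Λ₀.truncatedComplex) D.U D.p (fun i => -D.Λ i) (κ ⟦ξ⟧)) ∧
      ∀ ξ : FirstOrderPoissonDeformation Λ₀, κ ⟦ξ⟧ = 0 ↔ ξ.IsTrivial := by
  let f : PoissonDef Λ₀ (TrivSqZeroExt.fstHom k k k : k[ε] →ₐ[k] k) →
      hypercohomology Λ₀.truncatedComplex 1 :=
    Quotient.lift PoissonDeformation.cls fun ξ η h => (PoissonDeformation.cls_eq_iff ξ η).2 h
  have hf : Function.Bijective f := by
    refine ⟨fun a b => ?_, fun c => ?_⟩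
    · induction a using Quotient.inductionOn
      induction b using Quotient.inductionOn
      exact fun h => Quotient.sound ((PoissonDeformation.cls_eq_iff _ _).1 h)
    · obtain ⟨ξ, hξ⟩ := PoissonDeformation.cls_surjective c
      exact ⟨⟦ξ⟧, hξ⟩
  exact ⟨Equiv.ofBijective f hf, fun ξ => ⟨CechData.nonempty, PoissonDeformation.isCechClass_cls ξ⟩,
    PoissonDeformation.cls_eq_zero_iff⟩
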